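/- **Setting.** Let $d\ge 1$. For $L\ge 1$ let $\mathbb Z_L^d$ be the discrete torus, with $N=L^d$ sites. Let $f,g,a:\mathbb Z^d\to\mathbb R$ be fixed arrays, independent of $L$, with finite support (locality) and with $f_{-k}=f_k$, $g_{-k}=g_k$, $a_{-k}=a_k$ (reflection symmetry). They induce feedback operators on $\mathbb Z_L^d$, $$(Fx)_k=\sum_{j\in\mathbb Z^d} f_j\,x_{k-j},\qquad x_k\in\mathbb R^d,$$ and likewise $G$ and $A$. The array elements act as multiples of the identity on the $d$ components of the local state (coordinate decoupling and isotropy). Position feedback and averaging are relative: $\sum_k f_k=\sum_k a_k=0$. The velocity feedback contains absolute feedback: $g_o:=-\sum_k g_k>0$. Let $c_o>0$ be the integral gain and $\varepsilon\ge 0$ the relative noise intensity. Consider the system with distributed integral control and noisy velocity measurement $$\dot z=Az-c_o v-c_o\varepsilon\,\eta,\qquad \dot x=v,\qquad \dot v=z+Fx+Gv+w,$$ where $w$ and $\eta$ are independent standard vector white noises. The initial state is deterministic and arbitrary. Write $\hat f(\theta)=\sum_k f_ke^{-i\theta\cdot k}$, and similarly $\hat g,\hat a$. Assume that for every $\theta\in[-\pi,\pi]^d\setminus\{0\}$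 the matrices $$\begin{bmatrix}0&1\\ \hat f(\theta)&\hat g(\theta)\end{bmatrix},\qquad \begin{bmatrix}\hat a(\theta)&0&-c_o\\0&0&1\\1&\hat f(\theta)&\hat g(\theta)\end{bmatrix}$$ are Hurwitz. Assume also that $\sum_k f_k(k\cdot u)^2\neq0$ and $\sum_k a_k(k\cdot u)^2\ne 0$ for every nonzero $u\in\mathbb R^d$. (The last condition follows from the stability condition if $f_k,a_k\ge0$ for $k\neq0$.) Put $\beta=\max\{\|f\|_\infty,\|g\|_\infty\}$. The per-site variance is $V_N=\lim_{t\to\infty}\mathbb E\{y_k^Ty_k\}$. For the *global error*, $y_k=x_k-\frac1N\sum_l x_l$. For the *local error*, $y_k=(x_k-x_{k-e_r})_{r=1,\dots,d}$. Define $$S_{\rm loc}(N)=\begin{cases}N&d=1\\ \log N&d=2\\ 1&d\ge3\end{cases}\qquad S_{\rm glob}(N)=\begin{cases}N^3&d=1\\ N&d=2\\ N^{1/3}&d=3\\ \log N&d=4\\ 1&d\ge5.\end{cases}$$ **Claim 1 (scaling in $N$ and $\varepsilon$).** There are constants $\underline c,\bar c>0$ and $\bar N$, depending only on $d,f,g,a,c_o$,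 such that for all $\varepsilon\ge0$ and all $N=L^d\ge\bar N$ the limit $V_N$ exists for both errors, is the same for every site $k$ and every initial state, and satisfies $$\underline c\left(\frac1\beta+\frac{\varepsilon^2}{\beta}S(N)\right)\le V_N\le\bar c\left(\frac1\beta+\frac{\varepsilon^2}{\beta}S(N)\right),$$ with $S=S_{\rm loc}$ for the local error and $S=S_{\rm glob}$ for the global error. **Claim 2 (constants independent of $\beta$ as the position gains grow).** For every $\varepsilon_{\max}>0$ there are constants $\underline c,\bar c>0$, depending only on $d,f,g,a,c_o,\varepsilon_{\max}$, such that for all $s\ge1$ and $0<\varepsilon\le\varepsilon_{\max}$ there is $\bar N=\bar N(s,\varepsilon)$ with the following property. For all $N=L^d\ge\bar N$, the limits and the same two-sided bounds hold for the system in which $f$ is replaced by $sf$ and $\beta$ by $\max\{\|sf\|_\infty,\|g\|_\infty\}$. -/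

import Mathlib

open Filter Topology MeasureTheory ProbabilityTheory

noncomputable section

namespace NoisyIntegralControl

/-! ### Feedback arrays

A feedback operator is given by a real array on `ℤ^d`. Finite support of a fixed array, which does
not change with the lattice size, is the locality assumption: there is a feedback window
independent of `L` outside of which the array vanishes. The array element at `k` stands for the
`d × d` matrix `f k • 1` (coordinate decoupling and isotropy): the same scalar array acts on each of
the `d` components of the local state. -/

/-- Local feedback arrays on `ℤ^d`. -/
abbrev FeedbackArray (d : ℕ) := (Fin d → ℤ) →₀ ℝ

/-- Only relative measurements are used: the array elements sum to zero. -/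
def IsRelative {d : ℕ} (f : FeedbackArray d) : Prop := ∑ k ∈ f.support, f k = 0

/-- Reflection symmetry. -/
def IsSymmetric {d : ℕ} (f : FeedbackArray d) : Prop := ∀ k, f (-k) = f k

/-- The gain `g_o` of the absolute part of the feedback: if `g` is written as relative feedback
minus `g_o` times the own state, then the array elements sum to `-g_o`. -/
def absoluteGain {d : ℕ} (g : FeedbackArray d) : ℝ := -∑ k ∈ g.support, g k

/-- The quadratic form `u ↦ ∑ f_k (k · u)²` vanishes only at `u = 0`. -/
def IsNondegenerate {d : ℕ} (f : FeedbackArray d) : Prop :=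
  ∀ u : Fin d → ℝ, u ≠ 0 → ∑ k ∈ f.support, f k * (∑ i, (k i : ℝ) * u i) ^ 2 ≠ 0

/-- `‖f‖_∞ = max_k |f_k|`. -/
def supNorm {d : ℕ} (f : FeedbackArray d) : ℝ := ⨆ k, |f k|

/-- The algorithm parameter `β = max {‖f‖_∞, ‖g‖_∞}`. -/
def algParam {d : ℕ} (f g : FeedbackArray d) : ℝ := max (supNorm f) (supNorm g)

/-- The Fourier symbol `∑_k f_k e^{-i θ·k}`. -/
def symbol {d : ℕ} (f : FeedbackArray d) (θ : Fin d → ℝ) : ℂ :=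
  ∑ k ∈ f.support, (f k : ℂ) * Complex.exp (-Complex.I * ((∑ i, θ i * (k i : ℝ) : ℝ) : ℂ))

/-- All eigenvalues lie in the open left half plane. -/
def IsHurwitz {n : ℕ} (M : Matrix (Fin n) (Fin n) ℂ) : Prop := ∀ z ∈ spectrum ℂ M, z.re < 0

/-- Stability under static feedback (`u = 0`) at every nonzero spatial frequency. -/
def StaticStable {d : ℕ} (f g : FeedbackArray d) : Prop :=
  ∀ θ : Fin d → ℝ, (∀ i, |θ i| ≤ Real.pi) → θ ≠ 0 →
    IsHurwitz !![0, 1; symbol f θ, symbol g θ]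

/-- Stability under distributed integral control at every nonzero spatial frequency. -/
def IntegralStable {d : ℕ} (f g a : FeedbackArray d) (c : ℝ) : Prop :=
  ∀ θ : Fin d → ℝ, (∀ i, |θ i| ≤ Real.pi) → θ ≠ 0 →
    IsHurwitz !![symbol a θ, 0, -(c : ℂ); 0, 0, 1; 1, symbol f θ, symbol g θ]

/-! ### The networked system on the discrete torus -/

/-- The nodes of the discrete torus `ℤ_L^d`. -/
abbrev Site (d L : ℕ) := Fin d → ZMod L

/-- One `d`-dimensional vector at each site. -/
abbrev SiteVec (d L : ℕ) := Site d L × Fin d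

/-- The full state: block `0` is `z`, block `1` is `x`, block `2` is `v`. -/
abbrev State (d L : ℕ) := Fin 3 × SiteVec d L

/-- The array on `ℤ_L^d` induced by an array on `ℤ^d`. If `L` exceeds the width of the feedback
window, at most one term of the sum is nonzero. -/
def torusArray {d : ℕ} (L : ℕ) (f : FeedbackArray d) (m : Site d L) : ℝ :=
  ∑ k ∈ f.support, if (fun i => (k i : ZMod L)) = m then f k else 0

/-- The feedback operator `(F x)_k = ∑_l f_{k-l} x_l`, with `f_{k-l}` a multiple of the identity
on the `d` components. -/
def feedbackOp {d : ℕ} (L : ℕ) (f : FeedbackArray d) :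
    Matrix (SiteVec d L) (SiteVec d L) ℝ :=
  fun p p' => if p.2 = p'.2 then torusArray L f (p.1 - p'.1) else 0

/-- The system matrix of `ż = A z - c_o v`, `ẋ = v`, `v̇ = z + F x + G v`. -/
def systemMatrix {d : ℕ} (L : ℕ) (f g a : FeedbackArray d) (c : ℝ) :
    Matrix (State d L) (State d L) ℝ :=
  Matrix.comp _ _ _ _ _
    !![feedbackOp L a, 0, -(c • (1 : Matrix (SiteVec d L) (SiteVec d L) ℝ));
       0, 0, 1;
       1, feedbackOp L f, feedbackOp L g]

/-- The input matrix: channel `0` is the process disturbance, channel `1` the (normalized)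
measurement noise. -/
def inputMatrix (d L : ℕ) (c ε : ℝ) : Matrix (State d L) (Fin 2 × SiteVec d L) ℝ :=
  Matrix.comp _ _ _ _ _
    !![0, -((c * ε) • (1 : Matrix (SiteVec d L) (SiteVec d L) ℝ));
       0, 0;
       1, 0]

/-- Covariance at time `t` of the solution of the linear stochastic equation
`dψ = M ψ dt + B dW`, with `W` a standard vector Wiener process and deterministic initial value:
`∫₀ᵗ e^{sM} B Bᵀ e^{sMᵀ} ds`. -/
def covarianceAt {d L : ℕ} [NeZero L] (f g a : FeedbackArray d) (c ε t : ℝ) :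
    Matrix (State d L) (State d L) ℝ :=
  let M := systemMatrix L f g a c
  let B := inputMatrix d L c ε
  fun p p' => ∫ s in (0 : ℝ)..t,
    (NormedSpace.exp (s • M) * B * B.transpose * NormedSpace.exp (s • M.transpose)) p p'

/-- Law at time `t` of the solution of `dψ = M ψ dt + B dW`, `ψ(0) = ψ₀`: the Gaussian law with
mean `e^{tM} ψ₀` and the covariance above. -/
def stateLaw {d L : ℕ} [NeZero L] (f g a : FeedbackArray d) (c ε : ℝ) (ψ₀ : State d L → ℝ)
    (t : ℝ) : Measure (EuclideanSpace ℝ (State d L)) :=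
  multivariateGaussian
    (WithLp.toLp 2 ((NormedSpace.exp (t • systemMatrix L f g a c)).mulVec ψ₀))
    (covarianceAt f g a c ε t)

/-- Position of the agent at site `k`. -/
def position {d L : ℕ} (ψ : EuclideanSpace ℝ (State d L)) (k : Site d L) (j : Fin d) : ℝ :=
  ψ (1, (k, j))

/-- `y_kᵀ y_k` for the global error `y_k = x_k - N⁻¹ ∑_l x_l`, where `N = L^d`. -/
def globalErrorSq {d L : ℕ} [NeZero L] (k : Site d L) (ψ : EuclideanSpace ℝ (State d L)) : ℝ :=
  ∑ j, (position ψ k j - 1 / ((L : ℝ) ^ d) * ∑ l, position ψ l j) ^ 2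

/-- `y_kᵀ y_k` for the local error, the vector of the deviations `x_k - x_{k - e_r}` from the
nearest neighbor in each of the lattice directions `r`. -/
def localErrorSq {d L : ℕ} [NeZero L] (k : Site d L) (ψ : EuclideanSpace ℝ (State d L)) : ℝ :=
  ∑ r, ∑ j, (position ψ k j - position ψ (k - Pi.single r 1) j) ^ 2

/-- `V = lim_{t → ∞} E{y_kᵀ y_k}` at every site `k`, from every initial state. -/
def IsPerSiteVariance {d L : ℕ} [NeZero L]
    (errSq : Site d L → EuclideanSpace ℝ (State d L) → ℝ)
    (f g a : FeedbackArray d) (c ε V : ℝ) : Prop :=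
  ∀ (k : Site d L) (ψ₀ : State d L → ℝ),
    Tendsto (fun t : ℝ => ∫ ψ, errSq k ψ ∂(stateLaw f g a c ε ψ₀ t)) atTop (𝓝 V)

/-! ### The scalings -/

/-- `N`, `log N`, `1` for `d = 1`, `d = 2`, `d ≥ 3`. -/
def localGrowth (d : ℕ) (N : ℝ) : ℝ :=
  if d = 1 then N else if d = 2 then Real.log N else 1

/-- `N³`, `N`, `N^{1/3}`, `log N`, `1` for `d = 1`, `2`, `3`, `4`, `d ≥ 5`. -/
def globalGrowth (d : ℕ) (N : ℝ) : ℝ :=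
  if d = 1 then N ^ 3 else if d = 2 then N else if d = 3 then N ^ (1 / 3 : ℝ)
  else if d = 4 then Real.log N else 1

/-- The per-site variance exists and lies between `cl` and `cu` times
`1/β + (ε²/β) · growth(N)`. -/
def VarianceBounds {d L : ℕ} [NeZero L]
    (errSq : Site d L → EuclideanSpace ℝ (State d L) → ℝ) (growth : ℝ → ℝ)
    (cl cu : ℝ) (f g a : FeedbackArray d) (c ε : ℝ) : Prop :=
  ∃ V : ℝ, IsPerSiteVariance errSq f g a c ε V ∧
    cl * (1 / algParam f g + ε ^ 2 / algParam f g * growth ((L : ℝ) ^ d)) ≤ V ∧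
    V ≤ cu * (1 / algParam f g + ε ^ 2 / algParam f g * growth ((L : ℝ) ^ d))

/-- Both scalings at once, on the torus `ℤ_L^d`. -/
def LocalAndGlobalBounds {d : ℕ} (L : ℕ) [NeZero L] (cl cu : ℝ) (f g a : FeedbackArray d)
    (c ε : ℝ) : Prop :=
  VarianceBounds (L := L) localErrorSq (localGrowth d) cl cu f g a c ε ∧
  VarianceBounds (L := L) globalErrorSq (globalGrowth d) cl cu f g a c ε

end NoisyIntegralControl

end

/-!
The proof diagonalizes the network in space and computes every quantity mode by mode.

*Reduction to modes.* The covariance of a linear observation with weights `b` is the integrated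
squared output of the adjoint system `h' = h M` started in `b` (`dotProduct_covarianceAt`), and the
second moment of a Gaussian law splits into squared mean plus variance. The discrete Fourier
transform turns the feedback operators into multiplication by their symbols, which are real by
reflection symmetry, so that the transformed adjoint response obeys a real third-order system at
each frequency (`IsModeSolution`). With `-α`, `-φ`, `-γ` the symbols of `a`, `f`, `g`, stability
means `α, φ, γ > 0` away from frequency zero. A tilted energy shows that such a mode decays, and two
explicit quadratic forms give the integrals of its squared outputs: with
`Δ = (α + γ) (α γ + c) + γ φ`, unit process noise contributes `(φ + α (α + γ)) / (2 φ Δ)`, and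
unit noise at the integrator contributes `(α + γ) / (2 α φ Δ)`. The constant mode is not stable, but
the errors have zero total weight and do not excite it. By Parseval, the per-site variance is `d`
times the lattice average of the mode variances, weighted by `1` for the global and by
`∑ᵣ 2 (1 - cos θᵣ)` for the local error (`isPerSiteVariance_global`, `isPerSiteVariance_local`).

*Asymptotics.* Relative feedback and nondegeneracy give `α, φ ≍ ‖θ‖²`, absolute velocity feedback
gives `γ ≍ 1` (`exists_parameter_bounds`). Scaling the position gains by `s` replaces `φ` by `s φ`,
hence the process noise contributes at least a multiple of `1 / s` and at most multiples of `1` and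
of `1 / (s ‖θ‖²)`, while the measurement noise contributes `ε² / (s ‖θ‖⁴ (1 + s ‖θ‖²))` up to
constants (`exists_mode_estimates`). It remains to average `‖θ‖⁻ᵖ` over the nonzero frequencies,
with `p = 2` (local) or `p = 4` (global). Summing over shells of the sup norm, which have of the
order of `mᵈ⁻¹` points, yields `Lᵖ⁻ᵈ`, `log L` or `1` for `d < p`, `d = p` or `d > p`. In the first
two cases the growth comes from an arbitrarily small neighborhood of the origin
(`exists_le_latticeAverage`), in particular from `s ‖θ‖² ≤ 1`, where the factor `1 + s ‖θ‖²` is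
harmless; this is why the constants do not depend on `s` once the torus is large. For `d > p` the
lower bound uses the process noise alone, which suffices for `ε ≤ εmax`. For `d ≤ 2` the process
noise part of the global error need not be of order `1 / s`, but it is bounded and the diverging
measurement noise part dominates it.
-/

noncomputable section

namespace NoisyIntegralControl

/-! ### The adjoint third-order system of a single spatial mode -/

/-- The Routh–Hurwitz expression `a₁ a₂ - a₃` of the characteristic polynomial
`s³ + (α + γ) s² + (α γ + φ + c) s + α φ` of a mode. -/
def routh (α φ γ c : ℝ) : ℝ := (α + γ) * (α * γ + c) + γ * φ

/-- Stationary variance of the position of a mode driven by unit process noise. -/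
def processVar (α φ γ c : ℝ) : ℝ := (φ + α * (α + γ)) / (2 * φ * routh α φ γ c)

/-- Stationary variance of the position of a mode driven by unit noise entering the integrator. -/
def integratorVar (α φ γ c : ℝ) : ℝ := (α + γ) / (2 * α * φ * routh α φ γ c)

/-- The equations of the adjoint dynamics of a mode: `u' = u M` for the `3 × 3` block `M` of the
system matrix with symbols `-α`, `-φ`, `-γ`. -/
structure IsModeSolution {E : Type*} [NormedAddCommGroup E] [NormedSpace ℝ E]
    (α φ γ c : ℝ) (u₀ u₁ u₂ : ℝ → E) : Prop where
  deriv₀ : ∀ t, HasDerivAt u₀ (-(α • u₀ t) + u₂ t) t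
  deriv₁ : ∀ t, HasDerivAt u₁ (-(φ • u₂ t)) t
  deriv₂ : ∀ t, HasDerivAt u₂ (-(c • u₀ t) + u₁ t - γ • u₂ t) t

lemma IsModeSolution.map {E F : Type*} [NormedAddCommGroup E] [NormedSpace ℝ E]
    [NormedAddCommGroup F] [NormedSpace ℝ F] {α φ γ c : ℝ} {u₀ u₁ u₂ : ℝ → E}
    (h : IsModeSolution α φ γ c u₀ u₁ u₂) (T : E →L[ℝ] F) :
    IsModeSolution α φ γ c (fun t => T (u₀ t)) (fun t => T (u₁ t)) (fun t => T (u₂ t)) where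
  deriv₀ t := (T.hasFDerivAt.comp_hasDerivAt t (h.deriv₀ t)).congr_deriv (by simp)
  deriv₁ t := (T.hasFDerivAt.comp_hasDerivAt t (h.deriv₁ t)).congr_deriv (by simp)
  deriv₂ t := (T.hasFDerivAt.comp_hasDerivAt t (h.deriv₂ t)).congr_deriv (by simp)

/-- Grönwall in the form `W' ≤ -κ W` implies `W → 0`. -/
lemma tendsto_zero_of_deriv_le {W W' : ℝ → ℝ} {κ : ℝ} (hκ : 0 < κ) (hW : ∀ t, 0 ≤ W t)
    (hd : ∀ t, HasDerivAt W (W' t) t) (hle : ∀ t, W' t ≤ -κ * W t) :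
    Tendsto W atTop (𝓝 0) := by
  have hd2 : ∀ t, HasDerivAt (fun t => Real.exp (κ * t) * W t)
      (Real.exp (κ * t) * κ * W t + Real.exp (κ * t) * W' t) t := by
    intro t
    have h1 : HasDerivAt (fun t : ℝ => κ * t) κ t := by
      simpa using (hasDerivAt_id t).const_mul κ
    exact h1.exp.mul (hd t)
  have hanti : Antitone (fun t => Real.exp (κ * t) * W t) := by
    apply antitone_of_hasDerivAt_nonpos hd2
    intro t
    have := Real.exp_pos (κ * t)
    have h3 : Real.exp (κ * t) * W' t ≤ Real.exp (κ * t) * (-κ * W t) :=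
      mul_le_mul_of_nonneg_left (hle t) this.le
    simp only [Pi.zero_apply]
    nlinarith
  have hbound : ∀ᶠ t in atTop, W t ≤ W 0 * Real.exp (-(κ * t)) := by
    filter_upwards [eventually_ge_atTop 0] with t ht
    have h := hanti ht
    simp only [mul_zero, Real.exp_zero, one_mul] at h
    rw [Real.exp_neg, ← div_eq_mul_inv, le_div_iff₀ (Real.exp_pos _)]
    linarith
  have hlim : Tendsto (fun t => W 0 * Real.exp (-(κ * t))) atTop (𝓝 0) := by
    have : Tendsto (fun t => Real.exp (-(κ * t))) atTop (𝓝 0) :=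
      Real.tendsto_exp_neg_atTop_nhds_zero.comp (tendsto_id.const_mul_atTop hκ)
    simpa using this.const_mul (W 0)
  exact tendsto_of_tendsto_of_tendsto_of_le_of_le' tendsto_const_nhds hlim
    (Eventually.of_forall hW) hbound

/-- A real mode with positive parameters decays. The Lyapunov function is the energy
`c u₀² + u₂² + u₁² / φ`, tilted by `-2 δ u₁ u₂` to make its dissipation definite. -/
lemma IsModeSolution.tendsto_zero {α φ γ c : ℝ} (hα : 0 < α) (hφ : 0 < φ) (hγ : 0 < γ)
    (hc : 0 < c) {u₀ u₁ u₂ : ℝ → ℝ} (h : IsModeSolution α φ γ c u₀ u₁ u₂) :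
    Tendsto u₀ atTop (𝓝 0) ∧ Tendsto u₁ atTop (𝓝 0) ∧ Tendsto u₂ atTop (𝓝 0) := by
  obtain ⟨δ, hδ, hδ1, hδ2⟩ : ∃ δ : ℝ, 0 < δ ∧ δ * (2 * c) ≤ α ∧ δ * (2 * (φ + γ ^ 2)) ≤ γ := by
    refine ⟨min (α / (2 * c)) (γ / (2 * (φ + γ ^ 2))), by positivity, ?_, ?_⟩
    · rw [← le_div_iff₀ (by positivity)]; exact min_le_left _ _
    · rw [← le_div_iff₀ (by positivity)]; exact min_le_right _ _
  set W : ℝ → ℝ := fun t => c * u₀ t ^ 2 + u₂ t ^ 2 + u₁ t ^ 2 / φ - 2 * δ * (u₁ t * u₂ t) with hWdef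
  have hδγ : δ * γ ≤ 1 / 2 := by
    have : γ * (δ * γ) ≤ γ * (1 / 2) := by nlinarith [mul_pos hδ hφ]
    exact le_of_mul_le_mul_left this hγ
  have hcross : ∀ t, |2 * δ * (u₁ t * u₂ t)| ≤ u₁ t ^ 2 / (2 * φ) + u₂ t ^ 2 / 2 := by
    intro t
    have hsq : 4 * φ * δ ^ 2 ≤ 1 := by nlinarith [mul_pos hδ hφ, mul_pos hδ hγ, sq_nonneg γ]
    have h1 : u₁ t ^ 2 / (2 * φ) = φ / 2 * (u₁ t / φ) ^ 2 := by field_simp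
    have h2 : u₁ t * u₂ t = φ * ((u₁ t / φ) * u₂ t) := by field_simp
    rw [h1, h2, abs_le]
    set p := u₁ t / φ
    set q := u₂ t
    have h4 : 4 * φ * δ ^ 2 * q ^ 2 ≤ q ^ 2 := by nlinarith [sq_nonneg q]
    constructor
    · nlinarith [mul_nonneg hφ.le (sq_nonneg (p + 2 * δ * q))]
    · nlinarith [mul_nonneg hφ.le (sq_nonneg (p - 2 * δ * q))]
  have hWlow : ∀ t, c * u₀ t ^ 2 + u₂ t ^ 2 / 2 + u₁ t ^ 2 / (2 * φ) ≤ W t := by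
    intro t
    have h1 := (abs_le.1 (hcross t)).2
    have h2 : u₁ t ^ 2 / φ = 2 * (u₁ t ^ 2 / (2 * φ)) := by field_simp
    simp only [hWdef]
    linarith
  have hWup : ∀ t, W t ≤ c * u₀ t ^ 2 + 3 / 2 * u₂ t ^ 2 + 3 * (u₁ t ^ 2 / (2 * φ)) := by
    intro t
    have h1 := (abs_le.1 (hcross t)).1
    have h2 : u₁ t ^ 2 / φ = 2 * (u₁ t ^ 2 / (2 * φ)) := by field_simp
    simp only [hWdef]
    linarith
  have hdW : ∀ t, HasDerivAt W (-(2 * c * α) * u₀ t ^ 2 - 2 * γ * u₂ t ^ 2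
      + 2 * δ * φ * u₂ t ^ 2 - 2 * δ * u₁ t ^ 2 + 2 * δ * u₁ t * (c * u₀ t + γ * u₂ t)) t := by
    intro t
    have h0 := h.deriv₀ t
    have h1 := h.deriv₁ t
    have h2 := h.deriv₂ t
    simp only [smul_eq_mul] at h0 h1 h2
    have := ((((h0.pow 2).const_mul c).add (h2.pow 2)).add ((h1.pow 2).div_const φ)).sub
      ((h1.mul h2).const_mul (2 * δ))
    refine this.congr_deriv ?_
    field_simp
    ring
  set κ := min α (min (2 / 3 * γ) (2 / 3 * δ * φ)) with hκdef
  have hκ : 0 < κ := by positivity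
  have hκ1 : κ ≤ α := min_le_left _ _
  have hκ2 : κ ≤ 2 / 3 * γ := (min_le_right _ _).trans (min_le_left _ _)
  have hκ3 : κ ≤ 2 / 3 * δ * φ := (min_le_right _ _).trans (min_le_right _ _)
  have hWnn : ∀ t, 0 ≤ W t := fun t => le_trans (by positivity) (hWlow t)
  have hW : Tendsto W atTop (𝓝 0) := by
    refine tendsto_zero_of_deriv_le hκ hWnn hdW fun t => ?_
    have h1 : κ * W t ≤ κ * (c * u₀ t ^ 2 + 3 / 2 * u₂ t ^ 2 + 3 * (u₁ t ^ 2 / (2 * φ))) :=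
      mul_le_mul_of_nonneg_left (hWup t) hκ.le
    have ha : κ * (c * u₀ t ^ 2) ≤ α * (c * u₀ t ^ 2) :=
      mul_le_mul_of_nonneg_right hκ1 (by positivity)
    have hb : κ * (3 / 2 * u₂ t ^ 2) ≤ 2 / 3 * γ * (3 / 2 * u₂ t ^ 2) :=
      mul_le_mul_of_nonneg_right hκ2 (by positivity)
    have hd : κ * (3 * (u₁ t ^ 2 / (2 * φ))) ≤ 2 / 3 * δ * φ * (3 * (u₁ t ^ 2 / (2 * φ))) :=
      mul_le_mul_of_nonneg_right hκ3 (by positivity)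
    have hd' : 2 / 3 * δ * φ * (3 * (u₁ t ^ 2 / (2 * φ))) = δ * u₁ t ^ 2 := by
      field_simp
    have he : 2 * δ * u₁ t * (c * u₀ t + γ * u₂ t) ≤
        δ * u₁ t ^ 2 + 2 * δ * c ^ 2 * u₀ t ^ 2 + 2 * δ * γ ^ 2 * u₂ t ^ 2 := by
      nlinarith [mul_nonneg hδ.le (sq_nonneg (u₁ t - 2 * c * u₀ t)),
        mul_nonneg hδ.le (sq_nonneg (u₁ t - 2 * γ * u₂ t))]
    have hf : 2 * δ * c ^ 2 * u₀ t ^ 2 ≤ α * c * u₀ t ^ 2 := by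
      have : δ * (2 * c) * (c * u₀ t ^ 2) ≤ α * (c * u₀ t ^ 2) :=
        mul_le_mul_of_nonneg_right hδ1 (by positivity)
      linarith
    have hg : δ * (2 * (φ + γ ^ 2)) * u₂ t ^ 2 ≤ γ * u₂ t ^ 2 :=
      mul_le_mul_of_nonneg_right hδ2 (by positivity)
    linarith
  have key : ∀ (u : ℝ → ℝ) (k : ℝ), 0 < k → (∀ t, k * u t ^ 2 ≤ W t) →
      Tendsto u atTop (𝓝 0) := by
    intro u k hk hu
    have h1 : Tendsto (fun t => u t ^ 2) atTop (𝓝 0) := by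
      refine tendsto_of_tendsto_of_tendsto_of_le_of_le tendsto_const_nhds
        (by simpa using hW.const_mul k⁻¹) (fun t => sq_nonneg _) fun t => ?_
      have := hu t
      rw [inv_mul_eq_div, le_div_iff₀ hk]
      linarith
    have h2 : Tendsto (fun t => |u t|) atTop (𝓝 0) := by
      have := (Real.continuous_sqrt.tendsto 0).comp h1
      simpa [Function.comp_def, Real.sqrt_sq_eq_abs] using this
    exact (tendsto_zero_iff_abs_tendsto_zero u).2 h2
  refine ⟨key u₀ c hc fun t => ?_, key u₁ (1 / (2 * φ)) (by positivity) fun t => ?_,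
    key u₂ (1 / 2) (by norm_num) fun t => ?_⟩
  all_goals
    have := hWlow t
    have h1 : 0 ≤ c * u₀ t ^ 2 := by positivity
    have h2 : 0 ≤ u₁ t ^ 2 / (2 * φ) := by positivity
    have h3 : 0 ≤ u₂ t ^ 2 := by positivity
    have h4 : 1 / (2 * φ) * u₁ t ^ 2 = u₁ t ^ 2 / (2 * φ) := by field_simp
    linarith

lemma tendsto_integral_of_primitive {F q : ℝ → ℝ} (hF : ∀ t, HasDerivAt F (-q t) t)
    (hq : Continuous q) (hlim : Tendsto F atTop (𝓝 0)) :
    Tendsto (fun t => ∫ s in (0 : ℝ)..t, q s) atTop (𝓝 (F 0)) := by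
  have h1 : ∀ t, ∫ s in (0 : ℝ)..t, q s = F 0 - F t := by
    intro t
    have := intervalIntegral.integral_eq_sub_of_hasDerivAt (a := 0) (b := t)
      (fun x _ => hF x) (hq.neg.intervalIntegrable 0 t)
    rw [intervalIntegral.integral_neg] at this
    linarith
  simp_rw [h1]
  simpa using tendsto_const_nhds.sub hlim

lemma IsModeSolution.continuous {E : Type*} [NormedAddCommGroup E] [NormedSpace ℝ E]
    {α φ γ c : ℝ} {u₀ u₁ u₂ : ℝ → E} (h : IsModeSolution α φ γ c u₀ u₁ u₂) :
    Continuous u₀ ∧ Continuous u₁ ∧ Continuous u₂ :=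
  ⟨continuous_iff_continuousAt.2 fun t => (h.deriv₀ t).continuousAt,
    continuous_iff_continuousAt.2 fun t => (h.deriv₁ t).continuousAt,
    continuous_iff_continuousAt.2 fun t => (h.deriv₂ t).continuousAt⟩

/-- The integrals of `u₀²` and `u₂²` over `[0, ∞)`, computed from two quadratic forms whose
derivatives along the solution are `-u₀²` and `-u₂²` (explicit solutions of Lyapunov equations). -/
lemma IsModeSolution.tendsto_integral {α φ γ c : ℝ} (hα : 0 < α) (hφ : 0 < φ) (hγ : 0 < γ)
    (hc : 0 < c) {u₀ u₁ u₂ : ℝ → ℝ} (h : IsModeSolution α φ γ c u₀ u₁ u₂)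
    (h0 : u₀ 0 = 0) (h2 : u₂ 0 = 0) :
    Tendsto (fun t => ∫ s in (0 : ℝ)..t, u₀ s ^ 2) atTop
      (𝓝 (u₁ 0 ^ 2 * integratorVar α φ γ c)) ∧
    Tendsto (fun t => ∫ s in (0 : ℝ)..t, u₂ s ^ 2) atTop
      (𝓝 (u₁ 0 ^ 2 * processVar α φ γ c)) := by
  obtain ⟨l0, l1, l2⟩ := h.tendsto_zero hα hφ hγ hc
  obtain ⟨c0, c1, c2⟩ := h.continuous
  have hΔ : 0 < routh α φ γ c := by unfold routh; positivity
  set Δ := routh α φ γ c with hΔdef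
  have hΔeq : Δ = (α + γ) * (α * γ + c) + γ * φ := rfl
  -- `energy' = -2 c α u₀² - 2 γ u₂²` and `cross' = u₂² - (c + α (α + γ) + φ) u₀²`
  let energy : ℝ → ℝ := fun t => c * u₀ t ^ 2 + u₂ t ^ 2 + u₁ t ^ 2 / φ
  let cross : ℝ → ℝ := fun t => u₀ t * u₂ t + u₀ t * u₁ t / α + u₁ t ^ 2 / (2 * α * φ)
    + (α + γ + φ / α) / 2 * u₀ t ^ 2
  have hdE : ∀ t, HasDerivAt energy (-(2 * c * α) * u₀ t ^ 2 - 2 * γ * u₂ t ^ 2) t := by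
    intro t
    have d0 := h.deriv₀ t
    have d1 := h.deriv₁ t
    have d2 := h.deriv₂ t
    simp only [smul_eq_mul] at d0 d1 d2
    refine ((((d0.pow 2).const_mul c).add (d2.pow 2)).add ((d1.pow 2).div_const φ)).congr_deriv ?_
    field_simp
    ring
  have hdC : ∀ t, HasDerivAt cross (u₂ t ^ 2 - (c + α * (α + γ) + φ) * u₀ t ^ 2) t := by
    intro t
    have d0 := h.deriv₀ t
    have d1 := h.deriv₁ t
    have d2 := h.deriv₂ t
    simp only [smul_eq_mul] at d0 d1 d2
    refine ((((d0.mul d2).add ((d0.mul d1).div_const α)).add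
      ((d1.pow 2).div_const (2 * α * φ))).add
      ((d0.pow 2).const_mul ((α + γ + φ / α) / 2))).congr_deriv ?_
    field_simp
    ring
  have lE : Tendsto energy atTop (𝓝 0) := by
    have := (((l0.pow 2).const_mul c).add (l2.pow 2)).add ((l1.pow 2).div_const φ)
    simpa using this
  have lC : Tendsto cross atTop (𝓝 0) := by
    have := (((l0.mul l2).add ((l0.mul l1).div_const α)).add
      ((l1.pow 2).div_const (2 * α * φ))).add ((l0.pow 2).const_mul ((α + γ + φ / α) / 2))
    simpa using this
  have hQ0 : ∀ t, HasDerivAt (fun t => (energy t + 2 * γ * cross t) / (2 * Δ)) (-u₀ t ^ 2) t := by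
    intro t
    refine (((hdE t).add ((hdC t).const_mul (2 * γ))).div_const (2 * Δ)).congr_deriv ?_
    rw [div_eq_iff (by positivity), hΔeq]
    ring
  have lQ0 : Tendsto (fun t => (energy t + 2 * γ * cross t) / (2 * Δ)) atTop (𝓝 0) := by
    simpa using (lE.add (lC.const_mul (2 * γ))).div_const (2 * Δ)
  have hQ2 : ∀ t, HasDerivAt (fun t => (energy t - 2 * c * α *
      ((energy t + 2 * γ * cross t) / (2 * Δ))) / (2 * γ)) (-u₂ t ^ 2) t := by
    intro t
    refine (((hdE t).sub ((hQ0 t).const_mul (2 * c * α))).div_const (2 * γ)).congr_deriv ?_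
    rw [div_eq_iff (by positivity)]
    ring
  have lQ2 : Tendsto (fun t => (energy t - 2 * c * α *
      ((energy t + 2 * γ * cross t) / (2 * Δ))) / (2 * γ)) atTop (𝓝 0) := by
    simpa using (lE.sub (lQ0.const_mul (2 * c * α))).div_const (2 * γ)
  have e0 : energy 0 = u₁ 0 ^ 2 / φ := by simp [energy, h0, h2]
  have e1 : cross 0 = u₁ 0 ^ 2 / (2 * α * φ) := by simp [cross, h0]
  have hI0 : (energy 0 + 2 * γ * cross 0) / (2 * Δ) = u₁ 0 ^ 2 * integratorVar α φ γ c := by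
    rw [e0, e1, integratorVar, ← hΔdef]
    field_simp
  have hI2 : (energy 0 - 2 * c * α * ((energy 0 + 2 * γ * cross 0) / (2 * Δ))) / (2 * γ) =
      u₁ 0 ^ 2 * processVar α φ γ c := by
    rw [e0, e1, processVar, ← hΔdef]
    field_simp
    rw [hΔeq]
    ring
  constructor
  · rw [← hI0]
    exact tendsto_integral_of_primitive hQ0 (c0.pow 2) lQ0
  · rw [← hI2]
    exact tendsto_integral_of_primitive hQ2 (c2.pow 2) lQ2

/-- The complex version, obtained from the real and imaginary parts. -/
lemma IsModeSolution.complex_limits {α φ γ c : ℝ} (hα : 0 < α) (hφ : 0 < φ) (hγ : 0 < γ)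
    (hc : 0 < c) {u₀ u₁ u₂ : ℝ → ℂ} (h : IsModeSolution α φ γ c u₀ u₁ u₂)
    (h0 : u₀ 0 = 0) (h2 : u₂ 0 = 0) :
    (Tendsto u₀ atTop (𝓝 0) ∧ Tendsto u₁ atTop (𝓝 0) ∧ Tendsto u₂ atTop (𝓝 0)) ∧
    Tendsto (fun t => ∫ s in (0 : ℝ)..t, ‖u₀ s‖ ^ 2) atTop
      (𝓝 (‖u₁ 0‖ ^ 2 * integratorVar α φ γ c)) ∧
    Tendsto (fun t => ∫ s in (0 : ℝ)..t, ‖u₂ s‖ ^ 2) atTop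
      (𝓝 (‖u₁ 0‖ ^ 2 * processVar α φ γ c)) := by
  have hre := h.map Complex.reCLM
  have him := h.map Complex.imCLM
  simp only [Complex.reCLM_apply, Complex.imCLM_apply] at hre him
  obtain ⟨r0, r1, r2⟩ := hre.tendsto_zero hα hφ hγ hc
  obtain ⟨i0, i1, i2⟩ := him.tendsto_zero hα hφ hγ hc
  obtain ⟨R0, R2⟩ := hre.tendsto_integral hα hφ hγ hc (by simp [h0]) (by simp [h2])
  obtain ⟨I0, I2⟩ := him.tendsto_integral hα hφ hγ hc (by simp [h0]) (by simp [h2])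
  obtain ⟨c0, -, c2⟩ := hre.continuous
  obtain ⟨d0, -, d2⟩ := him.continuous
  have hn : ∀ z : ℂ, ‖z‖ ^ 2 = z.re ^ 2 + z.im ^ 2 := fun z => by
    rw [Complex.sq_norm, Complex.normSq_apply]; ring
  have hlim : ∀ u : ℝ → ℂ, Tendsto (fun t => (u t).re) atTop (𝓝 0) →
      Tendsto (fun t => (u t).im) atTop (𝓝 0) → Tendsto u atTop (𝓝 0) := by
    intro u hr hi
    have := ((Complex.continuous_ofReal.tendsto 0).comp hr).add
      (((Complex.continuous_ofReal.tendsto 0).comp hi).mul_const Complex.I)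
    simpa [Function.comp_def, Complex.re_add_im] using this
  refine ⟨⟨hlim _ r0 i0, hlim _ r1 i1, hlim _ r2 i2⟩, ?_, ?_⟩
  · simp_rw [hn]
    rw [add_mul]
    refine (R0.add I0).congr fun t => ?_
    rw [intervalIntegral.integral_add] <;>
      exact Continuous.intervalIntegrable (by fun_prop) _ _
  · simp_rw [hn]
    rw [add_mul]
    refine (R2.add I2).congr fun t => ?_
    rw [intervalIntegral.integral_add] <;>
      exact Continuous.intervalIntegrable (by fun_prop) _ _

/-- The spatially constant mode, which is not asymptotically stable, stays at rest. -/
lemma IsModeSolution.eq_zero_of_initial_zero {γ c : ℝ} (hγ : 0 < γ) (hc : 0 < c)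
    {u₀ u₁ u₂ : ℝ → ℝ} (h : IsModeSolution 0 0 γ c u₀ u₁ u₂)
    (h0 : u₀ 0 = 0) (h1 : u₁ 0 = 0) (h2 : u₂ 0 = 0) {t : ℝ} (ht : 0 ≤ t) :
    u₀ t = 0 ∧ u₁ t = 0 ∧ u₂ t = 0 := by
  have hu1 : ∀ s, u₁ s = 0 := by
    intro s
    have hd : ∀ s, HasDerivAt u₁ 0 s := fun s => by simpa using h.deriv₁ s
    rw [is_const_of_deriv_eq_zero (fun s => (hd s).differentiableAt) (fun s => (hd s).deriv) s 0, h1]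
  have hd : ∀ s, HasDerivAt (fun s => c * u₀ s ^ 2 + u₂ s ^ 2) (-(2 * γ) * u₂ s ^ 2) s := by
    intro s
    have d0 := h.deriv₀ s
    have d2 := h.deriv₂ s
    simp only [smul_eq_mul, hu1 s] at d0 d2
    refine (((d0.pow 2).const_mul c).add (d2.pow 2)).congr_deriv ?_
    simp only [zero_mul, neg_zero, zero_add, add_zero, Nat.cast_ofNat, Nat.add_one_sub_one, pow_one]
    ring
  have hanti := antitone_of_hasDerivAt_nonpos hd fun s => by
    simp only [Pi.zero_apply]; nlinarith [sq_nonneg (u₂ s)]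
  have := hanti ht
  simp only [h0, h2] at this
  have a0 : u₀ t ^ 2 = 0 := by nlinarith [sq_nonneg (u₀ t), sq_nonneg (u₂ t)]
  have a2 : u₂ t ^ 2 = 0 := by nlinarith [sq_nonneg (u₀ t), sq_nonneg (u₂ t)]
  exact ⟨by simpa using a0, hu1 t, by simpa using a2⟩

lemma IsModeSolution.complex_eq_zero_of_initial_zero {γ c : ℝ} (hγ : 0 < γ) (hc : 0 < c)
    {u₀ u₁ u₂ : ℝ → ℂ} (h : IsModeSolution 0 0 γ c u₀ u₁ u₂)
    (h0 : u₀ 0 = 0) (h1 : u₁ 0 = 0) (h2 : u₂ 0 = 0) {t : ℝ} (ht : 0 ≤ t) :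
    u₀ t = 0 ∧ u₁ t = 0 ∧ u₂ t = 0 := by
  have hre := (h.map Complex.reCLM).eq_zero_of_initial_zero hγ hc (by simp [h0]) (by simp [h1])
    (by simp [h2]) ht
  have him := (h.map Complex.imCLM).eq_zero_of_initial_zero hγ hc (by simp [h0]) (by simp [h1])
    (by simp [h2]) ht
  simp only [Complex.reCLM_apply, Complex.imCLM_apply] at hre him
  exact ⟨Complex.ext hre.1 him.1, Complex.ext hre.2.1 him.2.1, Complex.ext hre.2.2 him.2.2⟩

/-! ### Second moments of linear observations of the state -/

section Observations

lemma integral_sq_multivariateGaussian {ι : Type*} [Fintype ι] [DecidableEq ι]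
    (μ : EuclideanSpace ℝ ι) {S : Matrix ι ι ℝ} (hS : S.PosSemidef) (b : ι → ℝ) :
    ∫ ψ, (∑ p, b p * ψ p) ^ 2 ∂(multivariateGaussian μ S) =
      (∑ p, b p * μ p) ^ 2 + b ⬝ᵥ S.mulVec b := by
  set P := multivariateGaussian μ S
  have hmem : MemLp id 2 P := IsGaussian.memLp_two_id
  have hin : ∀ ψ : EuclideanSpace ℝ ι, inner ℝ (WithLp.toLp 2 b) ψ = ∑ p, b p * ψ p := by
    intro ψ
    simp [PiLp.inner_apply, mul_comm]
  have hX : MemLp (fun ψ : EuclideanSpace ℝ ι => inner ℝ (WithLp.toLp 2 b) ψ) 2 P :=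
    hmem.const_inner _
  have h1 := covarianceBilin_self hmem (WithLp.toLp 2 b)
  have h2 : covarianceBilin P (WithLp.toLp 2 b) (WithLp.toLp 2 b) = b ⬝ᵥ S.mulVec b := by
    simp [P, covarianceBilin_multivariateGaussian hS]
  have h3 := variance_eq_sub hX
  have h4 : ∫ ψ, inner ℝ (WithLp.toLp 2 b) ψ ∂P = ∑ p, b p * μ p := by
    have h5 := integral_inner (𝕜 := ℝ) (hmem.integrable (by norm_num)) (WithLp.toLp 2 b)
    simp only [id_eq] at h5
    rw [h5, integral_id_multivariateGaussian, hin]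
  rw [← h1, h2, h4] at h3
  simp only [Pi.pow_apply, hin] at h3
  linarith

section MatrixExponential

attribute [local instance] Matrix.linftyOpNormedRing Matrix.linftyOpNormedAlgebra
  Matrix.linftyOpNormedAddCommGroup Matrix.linftyOpNormedSpace

lemma hasDerivAt_exp_apply {ι : Type*} [Fintype ι] [DecidableEq ι] (M : Matrix ι ι ℝ)
    (p q : ι) (t : ℝ) :
    HasDerivAt (fun t : ℝ => NormedSpace.exp (t • M) p q) ((NormedSpace.exp (t • M) * M) p q) t := by
  have h := hasDerivAt_exp_smul_const M t
  let T : Matrix ι ι ℝ →L[ℝ] ℝ := LinearMap.toContinuousLinearMap (Matrix.entryLinearMap ℝ ℝ p q)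
  exact T.hasFDerivAt.comp_hasDerivAt t h

/-- The row vector `bᵀ e^{tM}` solves `h' = h M`. -/
lemma hasDerivAt_vecMul_exp {ι : Type*} [Fintype ι] [DecidableEq ι] (M : Matrix ι ι ℝ)
    (b : ι → ℝ) (q : ι) (t : ℝ) :
    HasDerivAt (fun t : ℝ => (Matrix.vecMul b (NormedSpace.exp (t • M))) q)
      (Matrix.vecMul (Matrix.vecMul b (NormedSpace.exp (t • M))) M q) t := by
  rw [Matrix.vecMul_vecMul]
  simp only [Matrix.vecMul, dotProduct]
  exact HasDerivAt.fun_sum fun p _ => (hasDerivAt_exp_apply M p q t).const_mul (b p)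

lemma continuous_vecMul_exp {ι : Type*} [Fintype ι] [DecidableEq ι] (M : Matrix ι ι ℝ)
    (b : ι → ℝ) (q : ι) :
    Continuous (fun t : ℝ => (Matrix.vecMul b (NormedSpace.exp (t • M))) q) :=
  continuous_iff_continuousAt.2 fun t => (hasDerivAt_vecMul_exp M b q t).continuousAt

lemma continuous_exp_mul_apply {ι κ : Type*} [Fintype ι] [DecidableEq ι] (M : Matrix ι ι ℝ)
    (B : Matrix ι κ ℝ) (p : ι) (q : κ) :
    Continuous (fun t : ℝ => (NormedSpace.exp (t • M) * B) p q) := by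
  simp only [Matrix.mul_apply]
  refine continuous_finsetSum _ fun r _ => Continuous.mul ?_ continuous_const
  exact continuous_iff_continuousAt.2 fun t => (hasDerivAt_exp_apply M p r t).continuousAt

end MatrixExponential

variable {d L : ℕ} [NeZero L]

lemma covarianceAt_apply (f g a : FeedbackArray d) (c ε t : ℝ) (p p' : State d L) :
    covarianceAt f g a c ε t p p' = ∫ s in (0 : ℝ)..t,
      ∑ q, (NormedSpace.exp (s • systemMatrix L f g a c) * inputMatrix d L c ε) p q *
        (NormedSpace.exp (s • systemMatrix L f g a c) * inputMatrix d L c ε) p' q := by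
  simp only [covarianceAt]
  refine intervalIntegral.integral_congr fun s _ => ?_
  rw [← Matrix.transpose_smul, Matrix.exp_transpose, Matrix.mul_assoc, ← Matrix.transpose_mul,
    Matrix.mul_apply]
  rfl

/-- The variance of the observation with weights `b` is the integrated squared response of the
adjoint system started in `b`. -/
lemma dotProduct_covarianceAt (f g a : FeedbackArray d) (c ε t : ℝ) (b : State d L → ℝ) :
    b ⬝ᵥ (covarianceAt f g a c ε t).mulVec b = ∫ s in (0 : ℝ)..t,
      ∑ q, (Matrix.vecMul (Matrix.vecMul b (NormedSpace.exp (s • systemMatrix L f g a c)))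
        (inputMatrix d L c ε) q) ^ 2 := by
  have hc := continuous_exp_mul_apply (systemMatrix L f g a c) (inputMatrix d L c ε)
  simp only [dotProduct, Matrix.mulVec, Finset.mul_sum, covarianceAt_apply]
  have h1 : ∀ p p' : State d L, b p * ((∫ s in (0 : ℝ)..t,
      ∑ q, (NormedSpace.exp (s • systemMatrix L f g a c) * inputMatrix d L c ε) p q *
        (NormedSpace.exp (s • systemMatrix L f g a c) * inputMatrix d L c ε) p' q) * b p') =
      ∫ s in (0 : ℝ)..t, b p * ((
      ∑ q, (NormedSpace.exp (s • systemMatrix L f g a c) * inputMatrix d L c ε) p q *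
        (NormedSpace.exp (s • systemMatrix L f g a c) * inputMatrix d L c ε) p' q) * b p') := by
    intro p p'
    rw [intervalIntegral.integral_const_mul, intervalIntegral.integral_mul_const]
  have hcc : ∀ p p' : State d L, Continuous fun s : ℝ => b p * ((
      ∑ q, (NormedSpace.exp (s • systemMatrix L f g a c) * inputMatrix d L c ε) p q *
        (NormedSpace.exp (s • systemMatrix L f g a c) * inputMatrix d L c ε) p' q) * b p') := by
    intro p p'
    exact continuous_const.mul ((continuous_finsetSum _ fun q _ => (hc p q).mul (hc p' q)).mul
      continuous_const)
  simp only [h1]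
  have h2 : ∀ p : State d L, (∑ p', ∫ s in (0 : ℝ)..t, b p * ((
      ∑ q, (NormedSpace.exp (s • systemMatrix L f g a c) * inputMatrix d L c ε) p q *
        (NormedSpace.exp (s • systemMatrix L f g a c) * inputMatrix d L c ε) p' q) * b p')) =
      ∫ s in (0 : ℝ)..t, ∑ p', b p * ((
      ∑ q, (NormedSpace.exp (s • systemMatrix L f g a c) * inputMatrix d L c ε) p q *
        (NormedSpace.exp (s • systemMatrix L f g a c) * inputMatrix d L c ε) p' q) * b p') :=
    fun p => (intervalIntegral.integral_finsetSum fun p' _ =>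
      (hcc p p').intervalIntegrable _ _).symm
  simp only [h2]
  rw [← intervalIntegral.integral_finsetSum fun p _ =>
      (continuous_finsetSum _ fun p' _ => hcc p p').intervalIntegrable _ _]
  refine intervalIntegral.integral_congr fun s _ => ?_
  simp only [Matrix.vecMul_vecMul]
  set R := NormedSpace.exp (s • systemMatrix L f g a c) * inputMatrix d L c ε
  simp only [Matrix.vecMul, dotProduct, sq, Finset.sum_mul_sum]
  rw [Finset.sum_comm (s := (Finset.univ : Finset (Fin 2 × SiteVec d L)))]
  refine Finset.sum_congr rfl fun p _ => ?_
  rw [Finset.sum_comm (s := (Finset.univ : Finset (Fin 2 × SiteVec d L)))]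
  refine Finset.sum_congr rfl fun p' _ => ?_
  rw [Finset.sum_mul, Finset.mul_sum]
  exact Finset.sum_congr rfl fun q _ => by ring

lemma posSemidef_covarianceAt (f g a : FeedbackArray d) (c ε : ℝ) {t : ℝ} (ht : 0 ≤ t) :
    (covarianceAt (L := L) f g a c ε t).PosSemidef := by
  refine Matrix.PosSemidef.of_dotProduct_mulVec_nonneg ?_ fun b => ?_
  · ext p p'
    simp only [Matrix.conjTranspose_apply, star_trivial, covarianceAt_apply]
    simp_rw [mul_comm]
  · rw [star_trivial, dotProduct_covarianceAt]
    exact intervalIntegral.integral_nonneg ht fun s _ => Finset.sum_nonneg fun q _ => sq_nonneg _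

lemma integral_sq_stateLaw (f g a : FeedbackArray d) (c ε : ℝ) (ψ₀ : State d L → ℝ) {t : ℝ}
    (ht : 0 ≤ t) (b : State d L → ℝ) :
    ∫ ψ, (∑ p, b p * ψ p) ^ 2 ∂(stateLaw f g a c ε ψ₀ t) =
      (∑ p, Matrix.vecMul b (NormedSpace.exp (t • systemMatrix L f g a c)) p * ψ₀ p) ^ 2 +
      ∫ s in (0 : ℝ)..t,
      ∑ q, (Matrix.vecMul (Matrix.vecMul b (NormedSpace.exp (s • systemMatrix L f g a c)))
        (inputMatrix d L c ε) q) ^ 2 := by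
  rw [stateLaw, integral_sq_multivariateGaussian _ (posSemidef_covarianceAt f g a c ε ht),
    dotProduct_covarianceAt]
  congr 2
  exact Matrix.dotProduct_mulVec b _ ψ₀

lemma integrable_sq_stateLaw (f g a : FeedbackArray d) (c ε t : ℝ) (ψ₀ b : State d L → ℝ) :
    Integrable (fun ψ => (∑ p, b p * ψ p) ^ 2) (stateLaw f g a c ε ψ₀ t) := by
  have hmem : MemLp id 2 (stateLaw f g a c ε ψ₀ t) := by
    unfold stateLaw
    exact IsGaussian.memLp_two_id
  have hX := (hmem.const_inner (𝕜 := ℝ) (WithLp.toLp 2 b)).integrable_sq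
  refine hX.congr (Eventually.of_forall fun ψ => ?_)
  simp [PiLp.inner_apply, mul_comm]

/-- The input channels read off the `v`-block (process noise) and the `z`-block (measurement
noise) of the adjoint state. -/
lemma sum_sq_vecMul_inputMatrix (c ε : ℝ) (h : State d L → ℝ) :
    ∑ q, (Matrix.vecMul h (inputMatrix d L c ε) q) ^ 2 =
      ∑ j, ((∑ m, h (2, (m, j)) ^ 2) + (c * ε) ^ 2 * ∑ m, h (0, (m, j)) ^ 2) := by
  have e00 : ∀ σ τ, inputMatrix d L c ε (0, σ) (0, τ) = 0 := fun _ _ => rfl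
  have e01 : ∀ σ τ, inputMatrix d L c ε (0, σ) (1, τ) =
    -((c * ε) • (1 : Matrix (SiteVec d L) (SiteVec d L) ℝ)) σ τ := fun _ _ => rfl
  have e10 : ∀ σ τ, inputMatrix d L c ε (1, σ) (0, τ) = 0 := fun _ _ => rfl
  have e11 : ∀ σ τ, inputMatrix d L c ε (1, σ) (1, τ) = 0 := fun _ _ => rfl
  have e20 : ∀ σ τ, inputMatrix d L c ε (2, σ) (0, τ) =
    (1 : Matrix (SiteVec d L) (SiteVec d L) ℝ) σ τ := fun _ _ => rfl
  have e21 : ∀ σ τ, inputMatrix d L c ε (2, σ) (1, τ) = 0 := fun _ _ => rfl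
  have h0 : ∀ σ, Matrix.vecMul h (inputMatrix d L c ε) (0, σ) = h (2, σ) := by
    intro σ
    simp only [Matrix.vecMul, dotProduct]
    rw [Fintype.sum_prod_type, Fin.sum_univ_three]
    simp only [e00, e10, e20, Matrix.one_apply, mul_zero, Finset.sum_const_zero, zero_add,
      mul_ite, mul_one, Finset.sum_ite_eq', Finset.mem_univ, if_true]
  have h1 : ∀ σ, Matrix.vecMul h (inputMatrix d L c ε) (1, σ) = -(c * ε) * h (0, σ) := by
    intro σ
    simp only [Matrix.vecMul, dotProduct]
    rw [Fintype.sum_prod_type, Fin.sum_univ_three]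
    simp only [e01, e11, e21, Matrix.smul_apply, Matrix.one_apply, mul_zero,
      Finset.sum_const_zero, add_zero, smul_eq_mul, mul_neg, mul_ite, mul_one,
      Finset.sum_neg_distrib, Finset.sum_ite_eq', Finset.mem_univ, if_true]
    ring
  rw [Fintype.sum_prod_type, Fin.sum_univ_two]
  simp only [h0, h1]
  rw [Finset.sum_add_distrib, ← Finset.mul_sum, Fintype.sum_prod_type_right, Fintype.sum_prod_type_right,
    Finset.mul_sum]
  congr 1
  refine Finset.sum_congr rfl fun j _ => ?_
  rw [Finset.mul_sum]
  exact Finset.sum_congr rfl fun m _ => by ring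

end Observations

/-! ### The discrete Fourier transform on the torus -/

section Fourier

variable {d L : ℕ} [NeZero L]

/-- The character `m ↦ e^{2πi n·m/L}` of the torus. -/
def siteChar (n m : Site d L) : ℂ := ZMod.stdAddChar (∑ i, n i * m i)

/-- The discrete Fourier transform `∑ₘ e^{2πi n·m/L} wₘ`. -/
def siteDFT (n : Site d L) (w : Site d L → ℝ) : ℂ := ∑ m, siteChar n m * w m

/-- The spatial frequency `2π n / L` with representative in `(-π, π]^d`. -/
def freq (n : Site d L) : Fin d → ℝ := fun i => 2 * Real.pi * ((n i).valMinAbs : ℝ) / L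

lemma siteChar_zero_left (m : Site d L) : siteChar 0 m = 1 := by simp [siteChar]

lemma siteChar_zero_right (n : Site d L) : siteChar n 0 = 1 := by simp [siteChar]

lemma siteChar_add (n m m' : Site d L) : siteChar n (m + m') = siteChar n m * siteChar n m' := by
  simp [siteChar, mul_add, Finset.sum_add_distrib, AddChar.map_add_eq_mul]

lemma norm_siteChar (n m : Site d L) : ‖siteChar n m‖ = 1 := by
  rw [siteChar, ZMod.stdAddChar_apply]
  exact Circle.norm_coe _

lemma siteChar_neg (n m : Site d L) : siteChar n (-m) = starRingEnd ℂ (siteChar n m) := by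
  have h1 : siteChar n m * siteChar n (-m) = 1 := by
    rw [← siteChar_add, add_neg_cancel, siteChar_zero_right]
  have h2 : siteChar n m * starRingEnd ℂ (siteChar n m) = 1 := by
    rw [Complex.mul_conj', norm_siteChar]; simp
  have h3 : siteChar n m ≠ 0 := fun h => by simp [h] at h1
  exact mul_left_cancel₀ h3 (h1.trans h2.symm)

lemma addChar_sum {ι A : Type*} [AddCommMonoid A] (χ : AddChar A ℂ) (s : Finset ι) (x : ι → A) :
    χ (∑ i ∈ s, x i) = ∏ i ∈ s, χ (x i) := by
  classical
  induction s using Finset.induction_on with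
  | empty => simp
  | insert i s hi ih => rw [Finset.sum_insert hi, Finset.prod_insert hi, AddChar.map_add_eq_mul, ih]

lemma sum_siteChar (m : Site d L) :
    ∑ n, siteChar n m = if m = 0 then (L : ℂ) ^ d else 0 := by
  have h1 : ∀ n : Site d L, siteChar n m = ∏ i, (ZMod.stdAddChar (n i * m i) : ℂ) := by
    intro n
    simp only [siteChar]
    exact addChar_sum _ _ _
  simp only [h1]
  have h2 := Finset.prod_univ_sum (fun _ : Fin d => (Finset.univ : Finset (ZMod L)))
    (fun i x => (ZMod.stdAddChar (x * m i) : ℂ))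
  rw [Fintype.piFinset_univ] at h2
  rw [← h2]
  simp only [AddChar.sum_mulShift _ (ZMod.isPrimitive_stdAddChar L), ZMod.card]
  split_ifs with hm
  · subst hm; simp
  · obtain ⟨i, hi⟩ := Function.ne_iff.1 hm
    exact Finset.prod_eq_zero (Finset.mem_univ i) (by rw [if_neg (by simpa using hi), Nat.cast_zero])

lemma parseval (w : Site d L → ℝ) :
    ∑ n, ‖siteDFT n w‖ ^ 2 = (L : ℝ) ^ d * ∑ m, w m ^ 2 := by
  have h1 : ∀ n : Site d L, ((‖siteDFT n w‖ ^ 2 : ℝ) : ℂ) =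
      ∑ m, ∑ m', siteChar n (m - m') * (w m * w m') := by
    intro n
    push_cast
    rw [← Complex.mul_conj', siteDFT, map_sum, Finset.sum_mul_sum]
    refine Finset.sum_congr rfl fun m _ => Finset.sum_congr rfl fun m' _ => ?_
    rw [map_mul, ← siteChar_neg, Complex.conj_ofReal, sub_eq_add_neg, siteChar_add]
    ring
  have h2 : ((∑ n, ‖siteDFT n w‖ ^ 2 : ℝ) : ℂ) = (((L : ℝ) ^ d * ∑ m, w m ^ 2 : ℝ) : ℂ) := by
    rw [Complex.ofReal_sum]
    simp only [h1]
    rw [Finset.sum_comm]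
    push_cast
    rw [Finset.mul_sum]
    refine Finset.sum_congr rfl fun m _ => ?_
    rw [Finset.sum_comm]
    simp only [← Finset.sum_mul, sum_siteChar, sub_eq_zero, ite_mul, zero_mul,
      Finset.sum_ite_eq, Finset.mem_univ, if_true]
    ring
  exact_mod_cast h2

lemma siteChar_intCast (n : Site d L) (k : Fin d → ℤ) :
    siteChar n (fun i => (k i : ZMod L)) =
      Complex.exp (Complex.I * ((∑ i, freq n i * (k i : ℝ) : ℝ) : ℂ)) := by
  have h1 : (∑ i, n i * (k i : ZMod L)) = ((∑ i, (n i).valMinAbs * k i : ℤ) : ZMod L) := by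
    push_cast
    simp
  rw [siteChar, h1, ZMod.stdAddChar_coe]
  congr 1
  simp only [freq]
  push_cast
  rw [Finset.mul_sum, Finset.mul_sum, Finset.sum_div]
  refine Finset.sum_congr rfl fun i _ => ?_
  ring

lemma sum_siteChar_neg_mul_torusArray (f : FeedbackArray d) (n : Site d L) :
    ∑ k, siteChar n (-k) * torusArray L f k = symbol f (freq n) := by
  simp only [torusArray, Complex.ofReal_sum, Finset.mul_sum]
  rw [Finset.sum_comm, symbol]
  refine Finset.sum_congr rfl fun k _ => ?_
  rw [Finset.sum_eq_single (fun i => (k i : ZMod L))]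
  · have : -(fun i => (k i : ZMod L)) = fun i => ((-k i : ℤ) : ZMod L) := by
      ext i; simp
    rw [this, siteChar_intCast n (fun i => -k i)]
    simp only [if_true]
    rw [mul_comm]
    congr 2
    push_cast
    simp
  · intro m _ hm
    simp [hm.symm]
  · simp

/-- The transform diagonalizes the feedback operators. -/
lemma siteDFT_convolution (f : FeedbackArray d) (n : Site d L) (w : Site d L → ℝ) :
    siteDFT n (fun m => ∑ l, w l * torusArray L f (l - m)) =
      symbol f (freq n) * siteDFT n w := by
  rw [← sum_siteChar_neg_mul_torusArray, siteDFT, siteDFT, Finset.sum_mul_sum]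
  simp only [Complex.ofReal_sum, Finset.mul_sum]
  rw [Finset.sum_comm, Finset.sum_comm (s := (Finset.univ : Finset (Site d L)))
    (f := fun i j => siteChar n (-i) * (torusArray L f i : ℂ) * (siteChar n j * (w j : ℂ)))]
  refine Finset.sum_congr rfl fun l _ => ?_
  refine Fintype.sum_equiv (Equiv.subLeft l) _ _ fun m => ?_
  simp only [Equiv.subLeft_apply]
  have : siteChar n m = siteChar n (-(l - m)) * siteChar n l := by
    rw [← siteChar_add]; congr 1; abel
  rw [this]
  push_cast
  ring

lemma siteDFT_add (n : Site d L) (w w' : Site d L → ℝ) :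
    siteDFT n (fun m => w m + w' m) = siteDFT n w + siteDFT n w' := by
  simp [siteDFT, mul_add, Finset.sum_add_distrib]

lemma siteDFT_const_mul (n : Site d L) (r : ℝ) (w : Site d L → ℝ) :
    siteDFT n (fun m => r * w m) = r * siteDFT n w := by
  simp only [siteDFT, Finset.mul_sum]
  exact Finset.sum_congr rfl fun m _ => by push_cast; ring

lemma hasDerivAt_siteDFT (n : Site d L) {w : ℝ → Site d L → ℝ} {w' : Site d L → ℝ} {t : ℝ}
    (h : ∀ m, HasDerivAt (fun t => w t m) (w' m) t) :
    HasDerivAt (fun t => siteDFT n (w t)) (siteDFT n w') t := by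
  simp only [siteDFT]
  exact HasDerivAt.fun_sum fun m _ => ((h m).ofReal_comp).const_mul _

/-! ### Reduction of the network to its modes -/

lemma sum_mul_feedbackOp (f : FeedbackArray d) (w : SiteVec d L → ℝ) (m : Site d L) (j : Fin d) :
    ∑ σ, w σ * feedbackOp L f σ (m, j) = ∑ l, w (l, j) * torusArray L f (l - m) := by
  rw [Fintype.sum_prod_type]
  refine Finset.sum_congr rfl fun l _ => ?_
  simp [feedbackOp]

lemma vecMul_systemMatrix (f g a : FeedbackArray d) (c : ℝ) (h : State d L → ℝ)
    (m : Site d L) (j : Fin d) :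
    Matrix.vecMul h (systemMatrix L f g a c) (0, (m, j)) =
      (∑ l, h (0, (l, j)) * torusArray L a (l - m)) + h (2, (m, j)) ∧
    Matrix.vecMul h (systemMatrix L f g a c) (1, (m, j)) =
      ∑ l, h (2, (l, j)) * torusArray L f (l - m) ∧
    Matrix.vecMul h (systemMatrix L f g a c) (2, (m, j)) =
      -c * h (0, (m, j)) + h (1, (m, j)) + ∑ l, h (2, (l, j)) * torusArray L g (l - m) := by
  have e00 : ∀ σ τ, systemMatrix L f g a c (0, σ) (0, τ) = feedbackOp L a σ τ := fun _ _ => rfl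
  have e10 : ∀ σ τ, systemMatrix L f g a c (1, σ) (0, τ) = 0 := fun _ _ => rfl
  have e20 : ∀ σ τ, systemMatrix L f g a c (2, σ) (0, τ) =
    (1 : Matrix (SiteVec d L) (SiteVec d L) ℝ) σ τ := fun _ _ => rfl
  have e01 : ∀ σ τ, systemMatrix L f g a c (0, σ) (1, τ) = 0 := fun _ _ => rfl
  have e11 : ∀ σ τ, systemMatrix L f g a c (1, σ) (1, τ) = 0 := fun _ _ => rfl
  have e21 : ∀ σ τ, systemMatrix L f g a c (2, σ) (1, τ) = feedbackOp L f σ τ := fun _ _ => rfl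
  have e02 : ∀ σ τ, systemMatrix L f g a c (0, σ) (2, τ) =
    -(c • (1 : Matrix (SiteVec d L) (SiteVec d L) ℝ)) σ τ := fun _ _ => rfl
  have e12 : ∀ σ τ, systemMatrix L f g a c (1, σ) (2, τ) =
    (1 : Matrix (SiteVec d L) (SiteVec d L) ℝ) σ τ := fun _ _ => rfl
  have e22 : ∀ σ τ, systemMatrix L f g a c (2, σ) (2, τ) = feedbackOp L g σ τ := fun _ _ => rfl
  refine ⟨?_, ?_, ?_⟩ <;>
    simp only [Matrix.vecMul, dotProduct] <;>
    rw [Fintype.sum_prod_type, Fin.sum_univ_three]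
  · simp only [e00, e10, e20]
    rw [sum_mul_feedbackOp a (fun σ => h (0, σ))]
    simp [Matrix.one_apply]
  · simp only [e01, e11, e21]
    rw [sum_mul_feedbackOp f (fun σ => h (2, σ))]
    simp
  · simp only [e02, e12, e22]
    rw [sum_mul_feedbackOp g (fun σ => h (2, σ))]
    simp [Matrix.one_apply, mul_comm]

/-- The Fourier coefficients of the adjoint response solve the mode equations. -/
lemma isModeSolution_siteDFT {f g a : FeedbackArray d} {c : ℝ} (n : Site d L) {α φ γ : ℝ}
    (ha : symbol a (freq n) = ((-α : ℝ) : ℂ)) (hf : symbol f (freq n) = ((-φ : ℝ) : ℂ))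
    (hg : symbol g (freq n) = ((-γ : ℝ) : ℂ)) (b : State d L → ℝ) (j : Fin d) :
    IsModeSolution α φ γ c
      (fun t => siteDFT n fun m => Matrix.vecMul b
        (NormedSpace.exp (t • systemMatrix L f g a c)) (0, (m, j)))
      (fun t => siteDFT n fun m => Matrix.vecMul b
        (NormedSpace.exp (t • systemMatrix L f g a c)) (1, (m, j)))
      (fun t => siteDFT n fun m => Matrix.vecMul b
        (NormedSpace.exp (t • systemMatrix L f g a c)) (2, (m, j))) where
  deriv₀ t := by
    refine (hasDerivAt_siteDFT n fun m => hasDerivAt_vecMul_exp _ b (0, (m, j)) t).congr_deriv ?_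
    simp only [(vecMul_systemMatrix f g a c _ _ j).1]
    rw [siteDFT_add, siteDFT_convolution a n (fun l => Matrix.vecMul b
        (NormedSpace.exp (t • systemMatrix L f g a c)) (0, (l, j))), ha]
    simp [Complex.real_smul]
  deriv₁ t := by
    refine (hasDerivAt_siteDFT n fun m => hasDerivAt_vecMul_exp _ b (1, (m, j)) t).congr_deriv ?_
    simp only [(vecMul_systemMatrix f g a c _ _ j).2.1]
    rw [siteDFT_convolution f n (fun l => Matrix.vecMul b
        (NormedSpace.exp (t • systemMatrix L f g a c)) (2, (l, j))), hf]
    simp [Complex.real_smul]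
  deriv₂ t := by
    refine (hasDerivAt_siteDFT n fun m => hasDerivAt_vecMul_exp _ b (2, (m, j)) t).congr_deriv ?_
    simp only [(vecMul_systemMatrix f g a c _ _ j).2.2]
    rw [siteDFT_add, siteDFT_add, siteDFT_const_mul, siteDFT_convolution g n (fun l => Matrix.vecMul b
        (NormedSpace.exp (t • systemMatrix L f g a c)) (2, (l, j))), hg]
    simp [Complex.real_smul]
    ring

/-- The state weights observing `∑ₗ bₗ xₗ` in the component `j`. -/
def positionWeight (b : Site d L → ℝ) (j : Fin d) : State d L → ℝ :=
  fun p => if p.1 = 1 ∧ p.2.2 = j then b p.2.1 else 0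

lemma sum_positionWeight_mul (b : Site d L → ℝ) (j : Fin d) (ψ : EuclideanSpace ℝ (State d L)) :
    ∑ p, positionWeight b j p * ψ p = ∑ l, b l * position ψ l j := by
  rw [Fintype.sum_prod_type, Fin.sum_univ_three]
  simp [positionWeight, position, Fintype.sum_prod_type]

/-- The stationary second moment of the relative observation `∑ₗ bₗ xₗ`. The nonconstant modes
are stable; the constant mode is only marginally stable, but `∑ₗ bₗ = 0` keeps it at rest. -/
theorem tendsto_integral_sq_stateLaw {f g a : FeedbackArray d} {c : ℝ} (hc : 0 < c) (ε : ℝ)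
    {α φ γ : Site d L → ℝ}
    (ha : ∀ n : Site d L, symbol a (freq n) = ((-α n : ℝ) : ℂ))
    (hf : ∀ n : Site d L, symbol f (freq n) = ((-φ n : ℝ) : ℂ))
    (hg : ∀ n : Site d L, symbol g (freq n) = ((-γ n : ℝ) : ℂ))
    (hα : ∀ n, n ≠ 0 → 0 < α n) (hφ : ∀ n, n ≠ 0 → 0 < φ n) (hγ : ∀ n, 0 < γ n)
    (hα0 : α 0 = 0) (hφ0 : φ 0 = 0)
    (b : Site d L → ℝ) (hb : ∑ l, b l = 0) (j : Fin d) (ψ₀ : State d L → ℝ) :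
    Tendsto (fun t => ∫ ψ, (∑ l, b l * position ψ l j) ^ 2 ∂(stateLaw f g a c ε ψ₀ t)) atTop
      (𝓝 (1 / (L : ℝ) ^ d * ∑ n with n ≠ 0, ‖siteDFT n b‖ ^ 2 *
        (processVar (α n) (φ n) (γ n) c + (c * ε) ^ 2 * integratorVar (α n) (φ n) (γ n) c))) := by
  set h : ℝ → State d L → ℝ := fun t => Matrix.vecMul (positionWeight b j)
    (NormedSpace.exp (t • systemMatrix L f g a c)) with hh
  have hL : (0 : ℝ) < (L : ℝ) ^ d := pow_pos (Nat.cast_pos.2 (NeZero.pos L)) d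
  have hcont : ∀ p, Continuous fun t => h t p := fun p => continuous_vecMul_exp _ _ p
  have hinit : h 0 = positionWeight b j := by simp [hh, NormedSpace.exp_zero]
  have hmode : ∀ n j', IsModeSolution (α n) (φ n) (γ n) c
      (fun t => siteDFT n fun m => h t (0, (m, j')))
      (fun t => siteDFT n fun m => h t (1, (m, j')))
      (fun t => siteDFT n fun m => h t (2, (m, j'))) := fun n j' =>
    isModeSolution_siteDFT n (ha n) (hf n) (hg n) _ j'
  have i0 : ∀ n j', siteDFT n (fun m => h 0 (0, (m, j'))) = 0 := by
    intro n j'; simp [hinit, positionWeight, siteDFT]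
  have i2 : ∀ n j', siteDFT n (fun m => h 0 (2, (m, j'))) = 0 := by
    intro n j'; simp [hinit, positionWeight, siteDFT]
  have i1 : ∀ n j', siteDFT n (fun m => h 0 (1, (m, j'))) = if j' = j then siteDFT n b else 0 := by
    intro n j'
    by_cases hj : j' = j <;> simp [hinit, positionWeight, siteDFT, hj]
  have i1z : ∀ j', siteDFT 0 (fun m => h 0 (1, (m, j'))) = 0 := by
    intro j'
    rw [i1]
    split_ifs
    · simp only [siteDFT, siteChar_zero_left, one_mul]
      exact_mod_cast hb
    · rfl
  -- the constant mode is not excited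
  have hzero : ∀ j' t, 0 ≤ t → siteDFT 0 (fun m => h t (0, (m, j'))) = 0 ∧
      siteDFT 0 (fun m => h t (1, (m, j'))) = 0 ∧ siteDFT 0 (fun m => h t (2, (m, j'))) = 0 := by
    intro j' t ht
    have := hmode 0 j'
    rw [hα0, hφ0] at this
    exact this.complex_eq_zero_of_initial_zero (hγ 0) hc (i0 0 j') (i1z j') (i2 0 j') ht
  have hlim := fun n (hn : n ≠ 0) j' =>
    (hmode n j').complex_limits (hα n hn) (hφ n hn) (hγ n) hc (i0 n j') (i2 n j')
  -- all coefficients decay, hence so does the adjoint response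
  have hdecay : ∀ i : Fin 3, ∀ n j', Tendsto (fun t => siteDFT n fun m => h t (i, (m, j')))
      atTop (𝓝 0) := by
    intro i n j'
    by_cases hn : n = 0
    · subst hn
      refine tendsto_const_nhds.congr' ?_
      filter_upwards [eventually_ge_atTop 0] with t ht
      obtain ⟨z0, z1, z2⟩ := hzero j' t ht
      fin_cases i
      · exact z0.symm
      · exact z1.symm
      · exact z2.symm
    · obtain ⟨⟨l0, l1, l2⟩, -⟩ := hlim n hn j'
      fin_cases i
      · exact l0
      · exact l1
      · exact l2
  have hdecay' : ∀ p, Tendsto (fun t => h t p) atTop (𝓝 0) := by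
    rintro ⟨i, m, j'⟩
    have h1 : Tendsto (fun t => 1 / (L : ℝ) ^ d *
        ∑ n, ‖siteDFT n fun m => h t (i, (m, j'))‖ ^ 2) atTop (𝓝 0) := by
      have := (tendsto_finsetSum Finset.univ fun n _ =>
        ((hdecay i n j').norm.pow 2)).const_mul (1 / (L : ℝ) ^ d)
      simpa using this
    have h2 : Tendsto (fun t => h t (i, (m, j')) ^ 2) atTop (𝓝 0) := by
      refine tendsto_of_tendsto_of_tendsto_of_le_of_le tendsto_const_nhds h1
        (fun t => sq_nonneg _) fun t => ?_
      simp only [parseval]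
      rw [← mul_assoc, one_div, inv_mul_cancel₀ hL.ne', one_mul]
      exact Finset.single_le_sum (f := fun m => h t (i, (m, j')) ^ 2)
        (fun m _ => sq_nonneg _) (Finset.mem_univ m)
    have h3 : Tendsto (fun t => |h t (i, (m, j'))|) atTop (𝓝 0) := by
      have := (Real.continuous_sqrt.tendsto 0).comp h2
      simpa [Function.comp_def, Real.sqrt_sq_eq_abs] using this
    exact (tendsto_zero_iff_abs_tendsto_zero _).2 h3
  have hmean : Tendsto (fun t => (∑ p, h t p * ψ₀ p) ^ 2) atTop (𝓝 0) := by
    have := (tendsto_finsetSum Finset.univ fun p _ => (hdecay' p).mul_const (ψ₀ p)).pow 2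
    simpa using this
  have hdcont : ∀ (i : Fin 3) n j', Continuous fun t => siteDFT n fun m => h t (i, (m, j')) := by
    intro i n j'
    simp only [siteDFT]
    exact continuous_finsetSum _ fun m _ => continuous_const.mul
      (Complex.continuous_ofReal.comp (hcont _))
  have hint : ∀ t, 0 ≤ t → ∫ s in (0 : ℝ)..t,
      ∑ q, (Matrix.vecMul (h s) (inputMatrix d L c ε) q) ^ 2 =
      1 / (L : ℝ) ^ d * ∑ j', ∑ n with n ≠ 0,
        ((∫ s in (0 : ℝ)..t, ‖siteDFT n fun m => h s (2, (m, j'))‖ ^ 2) +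
        (c * ε) ^ 2 * ∫ s in (0 : ℝ)..t, ‖siteDFT n fun m => h s (0, (m, j'))‖ ^ 2) := by
    intro t ht
    have e1 : ∀ s ∈ Set.uIcc 0 t, ∑ q, (Matrix.vecMul (h s) (inputMatrix d L c ε) q) ^ 2 =
        1 / (L : ℝ) ^ d * ∑ j', ∑ n with n ≠ 0,
          (‖siteDFT n fun m => h s (2, (m, j'))‖ ^ 2 +
            (c * ε) ^ 2 * ‖siteDFT n fun m => h s (0, (m, j'))‖ ^ 2) := by
      intro s hs
      rw [Set.uIcc_of_le ht] at hs
      rw [sum_sq_vecMul_inputMatrix, Finset.mul_sum]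
      refine Finset.sum_congr rfl fun j' _ => ?_
      rw [Finset.sum_filter_of_ne, Finset.sum_add_distrib, ← Finset.mul_sum, parseval, parseval]
      · field_simp
      · intro n _ hne hn
        subst hn
        obtain ⟨z0, -, z2⟩ := hzero j' s hs.1
        simp [z0, z2] at hne
    rw [intervalIntegral.integral_congr e1, intervalIntegral.integral_const_mul,
      intervalIntegral.integral_finsetSum]
    · congr 1
      refine Finset.sum_congr rfl fun j' _ => ?_
      rw [intervalIntegral.integral_finsetSum]
      · refine Finset.sum_congr rfl fun n _ => ?_
        rw [intervalIntegral.integral_add, intervalIntegral.integral_const_mul]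
        · exact ((hdcont 2 n j').norm.pow 2).intervalIntegrable _ _
        · exact (continuous_const.mul ((hdcont 0 n j').norm.pow 2)).intervalIntegrable _ _
      · intro n _
        exact (((hdcont 2 n j').norm.pow 2).add
          (continuous_const.mul ((hdcont 0 n j').norm.pow 2))).intervalIntegrable _ _
    · intro j' _
      exact (continuous_finsetSum _ fun n _ => ((hdcont 2 n j').norm.pow 2).add
          (continuous_const.mul ((hdcont 0 n j').norm.pow 2))).intervalIntegrable _ _
  have hval : ∀ t, 0 ≤ t → ∫ ψ, (∑ l, b l * position ψ l j) ^ 2 ∂(stateLaw f g a c ε ψ₀ t) =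
      (∑ p, h t p * ψ₀ p) ^ 2 + 1 / (L : ℝ) ^ d * ∑ j', ∑ n with n ≠ 0,
        ((∫ s in (0 : ℝ)..t, ‖siteDFT n fun m => h s (2, (m, j'))‖ ^ 2) +
        (c * ε) ^ 2 * ∫ s in (0 : ℝ)..t, ‖siteDFT n fun m => h s (0, (m, j'))‖ ^ 2) := by
    intro t ht
    rw [← hint t ht]
    simp only [← sum_positionWeight_mul]
    exact integral_sq_stateLaw f g a c ε ψ₀ ht (positionWeight b j)
  have hmain : Tendsto (fun t => (∑ p, h t p * ψ₀ p) ^ 2 + 1 / (L : ℝ) ^ d *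
      ∑ j', ∑ n with n ≠ 0,
        ((∫ s in (0 : ℝ)..t, ‖siteDFT n fun m => h s (2, (m, j'))‖ ^ 2) +
        (c * ε) ^ 2 * ∫ s in (0 : ℝ)..t, ‖siteDFT n fun m => h s (0, (m, j'))‖ ^ 2)) atTop
      (𝓝 (0 + 1 / (L : ℝ) ^ d * ∑ j', ∑ n with n ≠ 0,
        (‖if j' = j then siteDFT n b else 0‖ ^ 2 * processVar (α n) (φ n) (γ n) c +
        (c * ε) ^ 2 * (‖if j' = j then siteDFT n b else 0‖ ^ 2 *
          integratorVar (α n) (φ n) (γ n) c)))) := by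
    refine hmean.add (Tendsto.const_mul _ (tendsto_finsetSum _ fun j' _ =>
      tendsto_finsetSum _ fun n hn => ?_))
    obtain ⟨-, k0, k2⟩ := hlim n (by simpa using hn) j'
    rw [i1] at k0 k2
    exact k2.add (k0.const_mul _)
  rw [zero_add, Finset.sum_eq_single j (fun j' _ hj => by simp [hj]) (by simp)] at hmain
  simp only [if_true] at hmain
  have hsum : ∀ n : Site d L, ‖siteDFT n b‖ ^ 2 *
      (processVar (α n) (φ n) (γ n) c + (c * ε) ^ 2 * integratorVar (α n) (φ n) (γ n) c) =
      ‖siteDFT n b‖ ^ 2 * processVar (α n) (φ n) (γ n) c +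
        (c * ε) ^ 2 * (‖siteDFT n b‖ ^ 2 * integratorVar (α n) (φ n) (γ n) c) := fun n => by ring
  simp only [hsum]
  refine hmain.congr' ?_
  filter_upwards [eventually_ge_atTop 0] with t ht
  exact (hval t ht).symm

end Fourier

/-! ### Mode parameters: symbols of the feedback arrays -/

section Symbols

variable {d : ℕ}

/-- The negated symbol of a reflection symmetric array, a real number:
`-∑ₖ fₖ cos (θ·k)`. -/
def negSymbol (f : FeedbackArray d) (θ : Fin d → ℝ) : ℝ :=
  -∑ k ∈ f.support, f k * Real.cos (∑ i, θ i * (k i : ℝ))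

lemma symbol_eq_neg_negSymbol {f : FeedbackArray d} (hf : IsSymmetric f) (θ : Fin d → ℝ) :
    symbol f θ = ((-negSymbol f θ : ℝ) : ℂ) := by
  have hexp : ∀ x : ℝ, Complex.exp (-Complex.I * (x : ℂ)) = ⟨Real.cos x, -Real.sin x⟩ := by
    intro x
    have : -Complex.I * (x : ℂ) = ((-x : ℝ) : ℂ) * Complex.I := by push_cast; ring
    rw [this]
    apply Complex.ext
    · rw [Complex.exp_ofReal_mul_I_re, Real.cos_neg]
    · rw [Complex.exp_ofReal_mul_I_im, Real.sin_neg]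
  have hodd : ∑ k ∈ f.support, f k * Real.sin (∑ i, θ i * (k i : ℝ)) = 0 := by
    have h1 : ∑ k ∈ f.support, f k * Real.sin (∑ i, θ i * (k i : ℝ)) =
        ∑ k ∈ f.support, -(f k * Real.sin (∑ i, θ i * (k i : ℝ))) := by
      refine Finset.sum_equiv (Equiv.neg _) (fun k => ?_) fun k _ => ?_
      · simp [hf k]
      · simp [hf k, Real.sin_neg]
    rw [Finset.sum_neg_distrib] at h1
    linarith
  simp only [symbol, negSymbol, neg_neg, hexp]
  apply Complex.ext
  · rw [Complex.re_sum, Complex.ofReal_re]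
    exact Finset.sum_congr rfl fun k _ => by simp
  · rw [Complex.im_sum, Complex.ofReal_im, ← neg_eq_zero, ← hodd, ← Finset.sum_neg_distrib]
    exact Finset.sum_congr rfl fun k _ => by simp

lemma continuous_negSymbol (f : FeedbackArray d) : Continuous (negSymbol f) := by
  unfold negSymbol
  fun_prop

lemma negSymbol_zero (f : FeedbackArray d) : negSymbol f 0 = absoluteGain f := by
  simp [negSymbol, absoluteGain]

lemma negSymbol_zero_of_isRelative {f : FeedbackArray d} (hf : IsRelative f) :
    negSymbol f 0 = 0 := by
  rw [negSymbol_zero, absoluteGain, hf, neg_zero]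

lemma negSymbol_smul {s : ℝ} (hs : s ≠ 0) (f : FeedbackArray d) (θ : Fin d → ℝ) :
    negSymbol (s • f) θ = s * negSymbol f θ := by
  simp only [negSymbol, Finsupp.support_smul_eq hs, Finsupp.smul_apply, smul_eq_mul, mul_neg,
    Finset.mul_sum, mul_assoc]

lemma IsSymmetric.smul {f : FeedbackArray d} (hf : IsSymmetric f) (s : ℝ) :
    IsSymmetric (s • f) := fun k => by simp [hf k]

lemma negSymbol_eq_of_isRelative {f : FeedbackArray d} (hf : IsRelative f) (θ : Fin d → ℝ) :
    negSymbol f θ = ∑ k ∈ f.support, f k * (1 - Real.cos (∑ i, θ i * (k i : ℝ))) := by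
  simp only [mul_sub, mul_one, Finset.sum_sub_distrib]
  rw [show ∑ k ∈ f.support, f k = 0 from hf, zero_sub, negSymbol]

/-- A bound for `|k · θ| / ‖θ‖` in terms of the sup norm of `θ`. -/
lemma abs_sum_mul_le (θ : Fin d → ℝ) (k : Fin d → ℤ) :
    |∑ i, θ i * (k i : ℝ)| ≤ (∑ i, |(k i : ℝ)|) * ‖θ‖ := by
  refine (Finset.abs_sum_le_sum_abs _ _).trans ?_
  rw [Finset.sum_mul]
  refine Finset.sum_le_sum fun i _ => ?_
  rw [abs_mul, mul_comm]
  exact mul_le_mul_of_nonneg_left (norm_le_pi_norm θ i) (abs_nonneg _)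

lemma abs_one_sub_cos_sub_le (x : ℝ) : |1 - Real.cos x - x ^ 2 / 2| ≤ x ^ 4 := by
  rcases le_total |x| 1 with hx | hx
  · have h := Real.cos_bound hx
    have e : |x| ^ 4 = x ^ 4 := by rw [← abs_pow]; exact abs_of_nonneg (by positivity)
    rw [e] at h
    have e2 : 1 - Real.cos x - x ^ 2 / 2 = -(Real.cos x - (1 - x ^ 2 / 2)) := by ring
    rw [e2, abs_neg]
    exact h.trans (by nlinarith [sq_nonneg (x ^ 2)])
  · have h1 := Real.cos_le_one x
    have h2 := Real.one_sub_sq_div_two_le_cos (x := x)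
    have h3 : 1 ≤ x ^ 2 := by rw [← sq_abs]; nlinarith
    rw [abs_le]
    constructor <;> nlinarith [sq_nonneg (x ^ 2)]

lemma exists_negSymbol_le {f : FeedbackArray d} (hf : IsRelative f) :
    ∃ C : ℝ, 0 < C ∧ ∀ θ, negSymbol f θ ≤ C * ‖θ‖ ^ 2 := by
  refine ⟨(∑ k ∈ f.support, |f k| * (∑ i, |(k i : ℝ)|) ^ 2) + 1, by positivity, fun θ => ?_⟩
  rw [negSymbol_eq_of_isRelative hf]
  have h1 : ∑ k ∈ f.support, f k * (1 - Real.cos (∑ i, θ i * (k i : ℝ))) ≤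
      (∑ k ∈ f.support, |f k| * (∑ i, |(k i : ℝ)|) ^ 2) * ‖θ‖ ^ 2 := by
    rw [Finset.sum_mul]
    refine Finset.sum_le_sum fun k _ => ?_
    have h2 := Real.cos_le_one (∑ i, θ i * (k i : ℝ))
    have h3 := Real.one_sub_sq_div_two_le_cos (x := ∑ i, θ i * (k i : ℝ))
    have h4 : (∑ i, θ i * (k i : ℝ)) ^ 2 ≤ ((∑ i, |(k i : ℝ)|) * ‖θ‖) ^ 2 := by
      rw [← sq_abs]
      exact pow_le_pow_left₀ (abs_nonneg _) (abs_sum_mul_le θ k) 2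
    have h5 : 1 - Real.cos (∑ i, θ i * (k i : ℝ)) ≤ ((∑ i, |(k i : ℝ)|) * ‖θ‖) ^ 2 := by
      nlinarith [sq_nonneg (∑ i, θ i * (k i : ℝ))]
    calc f k * (1 - Real.cos (∑ i, θ i * (k i : ℝ)))
        ≤ |f k| * (1 - Real.cos (∑ i, θ i * (k i : ℝ))) :=
          mul_le_mul_of_nonneg_right (le_abs_self _) (by linarith)
      _ ≤ |f k| * ((∑ i, |(k i : ℝ)|) * ‖θ‖) ^ 2 := mul_le_mul_of_nonneg_left h5 (abs_nonneg _)
      _ = _ := by ring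
  nlinarith [sq_nonneg ‖θ‖]

/-- The quadratic form that governs the symbol at low frequency. -/
def symbolForm (f : FeedbackArray d) (u : Fin d → ℝ) : ℝ :=
  ∑ k ∈ f.support, f k * (∑ i, (k i : ℝ) * u i) ^ 2

lemma symbolForm_smul (f : FeedbackArray d) (t : ℝ) (u : Fin d → ℝ) :
    symbolForm f (t • u) = t ^ 2 * symbolForm f u := by
  simp only [symbolForm, Finset.mul_sum]
  refine Finset.sum_congr rfl fun k _ => ?_
  have : ∑ i, (k i : ℝ) * (t • u) i = t * ∑ i, (k i : ℝ) * u i := by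
    rw [Finset.mul_sum]
    exact Finset.sum_congr rfl fun i _ => by simp only [Pi.smul_apply, smul_eq_mul]; ring
  rw [this]
  ring

lemma exists_abs_negSymbol_sub_le {f : FeedbackArray d} (hf : IsRelative f) :
    ∃ C : ℝ, 0 < C ∧ ∀ θ, |negSymbol f θ - symbolForm f θ / 2| ≤ C * ‖θ‖ ^ 4 := by
  refine ⟨(∑ k ∈ f.support, |f k| * (∑ i, |(k i : ℝ)|) ^ 4) + 1, by positivity, fun θ => ?_⟩
  rw [negSymbol_eq_of_isRelative hf, symbolForm, Finset.sum_div, ← Finset.sum_sub_distrib]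
  have h1 : |∑ k ∈ f.support, (f k * (1 - Real.cos (∑ i, θ i * (k i : ℝ))) -
      f k * (∑ i, (k i : ℝ) * θ i) ^ 2 / 2)| ≤
      (∑ k ∈ f.support, |f k| * (∑ i, |(k i : ℝ)|) ^ 4) * ‖θ‖ ^ 4 := by
    refine (Finset.abs_sum_le_sum_abs _ _).trans ?_
    rw [Finset.sum_mul]
    refine Finset.sum_le_sum fun k _ => ?_
    have e : ∑ i, (k i : ℝ) * θ i = ∑ i, θ i * (k i : ℝ) :=
      Finset.sum_congr rfl fun i _ => mul_comm _ _
    rw [e]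
    have h2 := abs_one_sub_cos_sub_le (∑ i, θ i * (k i : ℝ))
    have h4 : (∑ i, θ i * (k i : ℝ)) ^ 4 ≤ ((∑ i, |(k i : ℝ)|) * ‖θ‖) ^ 4 := by
      have e4 : (∑ i, θ i * (k i : ℝ)) ^ 4 = |∑ i, θ i * (k i : ℝ)| ^ 4 := by
        rw [← abs_pow]; exact (abs_of_nonneg (by positivity)).symm
      rw [e4]
      exact pow_le_pow_left₀ (abs_nonneg _) (abs_sum_mul_le θ k) 4
    have e5 : f k * (1 - Real.cos (∑ i, θ i * (k i : ℝ))) - f k * (∑ i, θ i * (k i : ℝ)) ^ 2 / 2 =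
      f k * (1 - Real.cos (∑ i, θ i * (k i : ℝ)) - (∑ i, θ i * (k i : ℝ)) ^ 2 / 2) := by ring
    rw [e5, abs_mul, mul_assoc, ← mul_pow]
    exact mul_le_mul_of_nonneg_left (h2.trans h4) (abs_nonneg _)
  have : 0 ≤ ‖θ‖ ^ 4 := by positivity
  linarith

/-- Positivity of the symbol away from the origin makes its low-frequency form positive definite. -/
lemma symbolForm_pos {f : FeedbackArray d} (hf : IsRelative f) (hnd : IsNondegenerate f)
    (hpos : ∀ θ, ‖θ‖ ≤ Real.pi → θ ≠ 0 → 0 < negSymbol f θ) {u : Fin d → ℝ} (hu : u ≠ 0) :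
    0 < symbolForm f u := by
  refine lt_of_le_of_ne ?_ (hnd u hu).symm
  by_contra hneg
  push Not at hneg
  obtain ⟨C, hC, hbound⟩ := exists_abs_negSymbol_sub_le hf
  have h1 : ∀ᶠ t : ℝ in 𝓝[>] 0, symbolForm f u / 2 + C * t ^ 2 * ‖u‖ ^ 4 < 0 := by
    have : Tendsto (fun t : ℝ => symbolForm f u / 2 + C * t ^ 2 * ‖u‖ ^ 4) (𝓝 0)
        (𝓝 (symbolForm f u / 2 + C * 0 ^ 2 * ‖u‖ ^ 4)) :=
      Continuous.tendsto (by fun_prop) 0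
    exact (this.eventually_lt_const (by simpa using by linarith)).filter_mono nhdsWithin_le_nhds
  have h2 : ∀ᶠ t : ℝ in 𝓝[>] 0, t * ‖u‖ < Real.pi := by
    have : Tendsto (fun t : ℝ => t * ‖u‖) (𝓝 0) (𝓝 (0 * ‖u‖)) :=
      Continuous.tendsto (by fun_prop) 0
    exact (this.eventually_lt_const (by simpa using Real.pi_pos)).filter_mono nhdsWithin_le_nhds
  obtain ⟨t, ⟨h1t, h2t⟩, ht⟩ := ((h1.and h2).and self_mem_nhdsWithin).exists
  have ht : 0 < t := ht
  have hn : ‖t • u‖ = t * ‖u‖ := by rw [norm_smul, Real.norm_of_nonneg ht.le]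
  have h3 := hpos (t • u) (by rw [hn]; exact h2t.le) (smul_ne_zero ht.ne' hu)
  have h4 := (abs_le.1 (hbound (t • u))).2
  rw [symbolForm_smul, hn] at h4
  have h5 : t ^ 2 * (symbolForm f u / 2 + C * t ^ 2 * ‖u‖ ^ 4) < 0 :=
    mul_neg_of_pos_of_neg (by positivity) h1t
  nlinarith

lemma exists_le_negSymbol {f : FeedbackArray d} (hf : IsRelative f) (hnd : IsNondegenerate f)
    (hpos : ∀ θ, ‖θ‖ ≤ Real.pi → θ ≠ 0 → 0 < negSymbol f θ) :
    ∃ m : ℝ, 0 < m ∧ ∀ θ, ‖θ‖ ≤ Real.pi → m * ‖θ‖ ^ 2 ≤ negSymbol f θ := by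
  obtain ⟨C, hC, hbound⟩ := exists_abs_negSymbol_sub_le hf
  have hQc : Continuous (symbolForm f) := by unfold symbolForm; fun_prop
  obtain ⟨q, hq, hqle⟩ := (isCompact_sphere (0 : Fin d → ℝ) 1).exists_forall_le' (a := (0 : ℝ))
    hQc.continuousOn fun u hu => symbolForm_pos hf hnd hpos fun h => by simp [h] at hu
  have hQ : ∀ θ, q * ‖θ‖ ^ 2 ≤ symbolForm f θ := by
    intro θ
    rcases eq_or_ne θ 0 with rfl | hθ
    · simp [symbolForm]
    · have hn : 0 < ‖θ‖ := norm_pos_iff.2 hθ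
      have h1 := hqle (‖θ‖⁻¹ • θ) (by simp [norm_smul, hn.ne'])
      rw [symbolForm_smul, inv_pow, inv_mul_eq_div, le_div_iff₀ (by positivity)] at h1
      exact h1
  set K := Metric.closedBall (0 : Fin d → ℝ) Real.pi ∩ {θ | q / (4 * C) ≤ ‖θ‖ ^ 2} with hK
  have hKc : IsCompact K := (isCompact_closedBall _ _).inter_right
    (isClosed_le continuous_const (by fun_prop))
  obtain ⟨m, hm, hmle⟩ := hKc.exists_forall_le' (a := (0 : ℝ)) (continuous_negSymbol f).continuousOn
    fun θ hθ => hpos θ (by simpa using hθ.1) fun h => by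
      have h2 : q / (4 * C) ≤ ‖θ‖ ^ 2 := hθ.2
      have : 0 < q / (4 * C) := by positivity
      simp [h] at h2
      linarith
  refine ⟨min (q / 4) (m / Real.pi ^ 2), by positivity, fun θ hθ => ?_⟩
  rcases lt_or_ge (‖θ‖ ^ 2) (q / (4 * C)) with hlt | hge
  · have h1 := (abs_le.1 (hbound θ)).1
    have h2 := hQ θ
    rw [lt_div_iff₀ (by positivity)] at hlt
    have h3 : min (q / 4) (m / Real.pi ^ 2) * ‖θ‖ ^ 2 ≤ q / 4 * ‖θ‖ ^ 2 :=
      mul_le_mul_of_nonneg_right (min_le_left _ _) (sq_nonneg _)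
    have h4 : C * ‖θ‖ ^ 4 ≤ q / 4 * ‖θ‖ ^ 2 := by nlinarith [sq_nonneg ‖θ‖]
    linarith
  · have h1 := hmle θ ⟨by simpa using hθ, hge⟩
    have h3 : min (q / 4) (m / Real.pi ^ 2) * ‖θ‖ ^ 2 ≤ m / Real.pi ^ 2 * Real.pi ^ 2 :=
      mul_le_mul (min_le_right _ _) (pow_le_pow_left₀ (norm_nonneg _) hθ 2) (sq_nonneg _)
        (by positivity)
    rw [div_mul_cancel₀ _ (by positivity)] at h3
    linarith

end Symbols

/-! ### Sign conditions from stability -/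

lemma mem_spectrum_of_det_eq_zero {n : ℕ} {M : Matrix (Fin n) (Fin n) ℂ} {z : ℂ}
    (h : (algebraMap ℂ (Matrix (Fin n) (Fin n) ℂ) z - M).det = 0) : z ∈ spectrum ℂ M := by
  rw [spectrum.mem_iff, Matrix.isUnit_iff_isUnit_det, h]
  simp

lemma pos_of_isHurwitz_two {φ γ : ℝ}
    (h : IsHurwitz !![0, 1; ((-φ : ℝ) : ℂ), ((-γ : ℝ) : ℂ)]) : 0 < φ ∧ 0 < γ := by
  have key : ∀ z : ℂ, z ^ 2 + γ * z + φ = 0 → z.re < 0 := by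
    intro z hz
    refine h z (mem_spectrum_of_det_eq_zero ?_)
    rw [Matrix.det_fin_two]
    simp [Matrix.algebraMap_matrix_apply]
    linear_combination hz
  have hreal : 0 ≤ γ ^ 2 - 4 * φ → Real.sqrt (γ ^ 2 - 4 * φ) < γ := by
    intro hd
    have h1 := key (((-γ + Real.sqrt (γ ^ 2 - 4 * φ)) / 2 : ℝ) : ℂ) (by
      norm_cast
      nlinarith [Real.sq_sqrt hd])
    rw [Complex.ofReal_re] at h1
    linarith
  have hφ : 0 < φ := by
    by_contra hneg
    push Not at hneg
    have h1 := hreal (by nlinarith [sq_nonneg γ])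
    have h2 : |γ| ≤ Real.sqrt (γ ^ 2 - 4 * φ) := Real.abs_le_sqrt (by linarith)
    linarith [le_abs_self γ]
  refine ⟨hφ, ?_⟩
  rcases le_or_gt 0 (γ ^ 2 - 4 * φ) with hd | hd
  · exact (Real.sqrt_nonneg _).trans_lt (hreal hd)
  · obtain ⟨r, hr⟩ : ∃ r : ℝ, r ^ 2 = 4 * φ - γ ^ 2 :=
      ⟨Real.sqrt (4 * φ - γ ^ 2), Real.sq_sqrt (by linarith)⟩
    have h1 := key ⟨-γ / 2, r / 2⟩ (by
      apply Complex.ext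
      · simp [sq]
        nlinarith
      · simp [sq]
        ring)
    simp only at h1
    linarith

lemma pos_of_isHurwitz_three {α φ γ c : ℝ} (hc : 0 < c) (hφ : 0 < φ)
    (h : IsHurwitz !![((-α : ℝ) : ℂ), 0, -(c : ℂ); 0, 0, 1; 1, ((-φ : ℝ) : ℂ), ((-γ : ℝ) : ℂ)]) :
    0 < α := by
  by_contra hneg
  push Not at hneg
  -- for `α ≤ 0` the characteristic polynomial changes sign on `[0, -α]`
  have hcont : ContinuousOn (fun s : ℝ => (s + α) * (s ^ 2 + γ * s + φ) + c * s)
      (Set.Icc 0 (-α)) := by fun_prop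
  obtain ⟨s, hs, hs0⟩ := intermediate_value_Icc (by linarith) hcont
    (show (0 : ℝ) ∈ Set.Icc _ _ from ⟨by nlinarith, by nlinarith⟩)
  have hs0 : (s + α) * (s ^ 2 + γ * s + φ) + c * s = 0 := hs0
  have h1 := h (s : ℂ) (mem_spectrum_of_det_eq_zero (by
    rw [Matrix.det_fin_three]
    simp [Matrix.algebraMap_matrix_apply]
    have : ((((s + α) * (s ^ 2 + γ * s + φ) + c * s : ℝ)) : ℂ) = 0 := by rw [hs0]; simp
    push_cast at this
    linear_combination this))
  rw [Complex.ofReal_re] at h1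
  linarith [hs.1]

/-- Two-sided bounds for the mode parameters: the relative feedbacks vanish quadratically at the
origin, the absolute velocity feedback keeps the damping away from zero. -/
theorem exists_parameter_bounds {d : ℕ} {f g a : FeedbackArray d} {c : ℝ} (hc : 0 < c)
    (hf_rel : IsRelative f) (ha_rel : IsRelative a) (hf_symm : IsSymmetric f)
    (hg_symm : IsSymmetric g) (ha_symm : IsSymmetric a) (hg_abs : 0 < absoluteGain g)
    (hf_nondeg : IsNondegenerate f) (ha_nondeg : IsNondegenerate a) (h_static : StaticStable f g)
    (h_integral : IntegralStable f g a c) :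
    ∃ m C : ℝ, 0 < m ∧ 0 < C ∧ ∀ θ : Fin d → ℝ, ‖θ‖ ≤ Real.pi →
      (m * ‖θ‖ ^ 2 ≤ negSymbol a θ ∧ negSymbol a θ ≤ C * ‖θ‖ ^ 2) ∧
      (m * ‖θ‖ ^ 2 ≤ negSymbol f θ ∧ negSymbol f θ ≤ C * ‖θ‖ ^ 2) ∧
      (m ≤ negSymbol g θ ∧ negSymbol g θ ≤ C) := by
  have hbox : ∀ θ : Fin d → ℝ, ‖θ‖ ≤ Real.pi → ∀ i, |θ i| ≤ Real.pi :=
    fun θ hθ i => (norm_le_pi_norm θ i).trans hθ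
  have hst : ∀ θ, ‖θ‖ ≤ Real.pi → θ ≠ 0 → 0 < negSymbol f θ ∧ 0 < negSymbol g θ := by
    intro θ hθ h0
    have := h_static θ (hbox θ hθ) h0
    rw [symbol_eq_neg_negSymbol hf_symm, symbol_eq_neg_negSymbol hg_symm] at this
    exact pos_of_isHurwitz_two this
  have hin : ∀ θ, ‖θ‖ ≤ Real.pi → θ ≠ 0 → 0 < negSymbol a θ := by
    intro θ hθ h0
    have := h_integral θ (hbox θ hθ) h0
    rw [symbol_eq_neg_negSymbol hf_symm, symbol_eq_neg_negSymbol hg_symm,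
      symbol_eq_neg_negSymbol ha_symm] at this
    exact pos_of_isHurwitz_three hc (hst θ hθ h0).1 this
  have hg : ∀ θ, ‖θ‖ ≤ Real.pi → 0 < negSymbol g θ := by
    intro θ hθ
    rcases eq_or_ne θ 0 with rfl | h0
    · rwa [negSymbol_zero]
    · exact (hst θ hθ h0).2
  obtain ⟨m₁, hm₁, hle₁⟩ := exists_le_negSymbol ha_rel ha_nondeg hin
  obtain ⟨m₂, hm₂, hle₂⟩ := exists_le_negSymbol hf_rel hf_nondeg fun θ hθ h0 => (hst θ hθ h0).1
  obtain ⟨m₃, hm₃, hle₃⟩ := (isCompact_closedBall (0 : Fin d → ℝ) Real.pi).exists_forall_le'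
    (a := (0 : ℝ)) (continuous_negSymbol g).continuousOn fun θ hθ => hg θ (by simpa using hθ)
  obtain ⟨C₁, hC₁, hge₁⟩ := exists_negSymbol_le ha_rel
  obtain ⟨C₂, hC₂, hge₂⟩ := exists_negSymbol_le hf_rel
  obtain ⟨C₃, hge₃⟩ := (isCompact_closedBall (0 : Fin d → ℝ) Real.pi).bddAbove_image
    (continuous_negSymbol g).continuousOn
  refine ⟨min m₁ (min m₂ m₃), max C₁ (max C₂ C₃), by positivity,
    lt_max_of_lt_left hC₁, fun θ hθ => ?_⟩
  have hsq := sq_nonneg ‖θ‖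
  have hmem : θ ∈ Metric.closedBall (0 : Fin d → ℝ) Real.pi := by simpa using hθ
  refine ⟨⟨?_, ?_⟩, ⟨?_, ?_⟩, ?_, ?_⟩
  · exact (mul_le_mul_of_nonneg_right (min_le_left _ _) hsq).trans (hle₁ θ hθ)
  · exact (hge₁ θ).trans (mul_le_mul_of_nonneg_right (le_max_left _ _) hsq)
  · exact (mul_le_mul_of_nonneg_right ((min_le_right _ _).trans (min_le_left _ _)) hsq).trans
      (hle₂ θ hθ)
  · exact (hge₂ θ).trans (mul_le_mul_of_nonneg_right
      ((le_max_left _ _).trans (le_max_right _ _)) hsq)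
  · exact ((min_le_right _ _).trans (min_le_right _ _)).trans (hle₃ θ hmem)
  · exact (hge₃ (Set.mem_image_of_mem _ hmem)).trans ((le_max_right _ _).trans (le_max_right _ _))

/-! ### Lattice sums -/

section LatticeSums

variable {d L : ℕ}

/-- The sup norm of the integer representative of `n` closest to the origin. -/
def siteNorm (n : Site d L) : ℕ := Finset.univ.sup fun i => (n i).valMinAbs.natAbs

lemma siteNorm_le_iff {n : Site d L} {m : ℕ} :
    siteNorm n ≤ m ↔ ∀ i, (n i).valMinAbs.natAbs ≤ m := by
  simp [siteNorm]

lemma freq_zero : freq (0 : Site d L) = 0 := by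
  ext i; simp [freq]

/-- The order of growth of the lattice average of `‖θ‖^{-p}`. -/
def latticeGrowth (d p L : ℕ) : ℝ :=
  if d < p then (L : ℝ) ^ (p - d) else if d = p then Real.log L else 1

lemma latticeGrowth_nonneg (hL : 1 ≤ L) (p : ℕ) : 0 ≤ latticeGrowth d p L := by
  unfold latticeGrowth
  split_ifs
  · positivity
  · exact Real.log_nonneg (by exact_mod_cast hL)
  · exact zero_le_one

lemma siteNorm_eq_zero {n : Site d L} : siteNorm n = 0 ↔ n = 0 := by
  rw [← Nat.le_zero, siteNorm_le_iff]
  simp [funext_iff]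

lemma siteNorm_pos {n : Site d L} (hn : n ≠ 0) : 1 ≤ siteNorm n :=
  Nat.one_le_iff_ne_zero.2 fun h => hn (siteNorm_eq_zero.1 h)

variable [NeZero L]

lemma siteNorm_le_half (n : Site d L) : siteNorm n ≤ L / 2 :=
  siteNorm_le_iff.2 fun _ => ZMod.natAbs_valMinAbs_le _

lemma norm_freq (n : Site d L) : ‖freq n‖ = 2 * Real.pi / L * siteNorm n := by
  have hL : (0 : ℝ) < L := Nat.cast_pos.2 (NeZero.pos L)
  have hk : 0 < 2 * Real.pi / L := by positivity
  have hcoord : ∀ i, ‖freq n i‖ = 2 * Real.pi / L * ((n i).valMinAbs.natAbs : ℝ) := by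
    intro i
    have : freq n i = 2 * Real.pi / L * ((n i).valMinAbs : ℝ) := by simp only [freq]; ring
    rw [this, norm_mul, Real.norm_of_nonneg hk.le, Nat.cast_natAbs, Real.norm_eq_abs, Int.cast_abs]
  apply le_antisymm
  · rw [pi_norm_le_iff_of_nonneg (by positivity)]
    intro i
    rw [hcoord]
    refine mul_le_mul_of_nonneg_left ?_ hk.le
    exact_mod_cast siteNorm_le_iff.1 le_rfl i
  · have h1 : siteNorm n ≤ ⌊‖freq n‖ / (2 * Real.pi / L)⌋₊ := by
      refine siteNorm_le_iff.2 fun i => Nat.le_floor ?_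
      rw [le_div_iff₀ hk, mul_comm, ← hcoord]
      exact norm_le_pi_norm _ _
    have h2 := (Nat.cast_le (α := ℝ).2 h1).trans (Nat.floor_le (by positivity))
    rw [le_div_iff₀ hk] at h2
    linarith

lemma norm_freq_le_pi (n : Site d L) : ‖freq n‖ ≤ Real.pi := by
  have hL : (0 : ℝ) < L := Nat.cast_pos.2 (NeZero.pos L)
  have h1 : (siteNorm n : ℝ) ≤ L / 2 := (Nat.cast_le.2 (siteNorm_le_half n)).trans Nat.cast_div_le
  rw [norm_freq, div_mul_eq_mul_div, div_le_iff₀ hL]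
  nlinarith [Real.pi_pos]

lemma freq_ne_zero {n : Site d L} (hn : n ≠ 0) : freq n ≠ 0 := by
  have hL : (0 : ℝ) < L := Nat.cast_pos.2 (NeZero.pos L)
  have : (0 : ℝ) < siteNorm n := Nat.cast_pos.2 (siteNorm_pos hn)
  rw [← norm_pos_iff, norm_freq]
  positivity

lemma card_filter_natAbs_eq_le (m : ℕ) :
    (Finset.univ.filter fun x : ZMod L => x.valMinAbs.natAbs = m).card ≤ 2 := by
  refine (Finset.card_le_card_of_injOn (t := {(m : ℤ), -(m : ℤ)}) ZMod.valMinAbs ?_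
    (ZMod.injective_valMinAbs.injOn)).trans Finset.card_le_two
  intro x hx
  have hx : x.valMinAbs.natAbs = m := by simpa using hx
  simp only [Finset.coe_insert, Finset.coe_singleton, Set.mem_insert_iff, Set.mem_singleton_iff]
  omega

lemma card_filter_natAbs_le_le (m : ℕ) :
    (Finset.univ.filter fun x : ZMod L => x.valMinAbs.natAbs ≤ m).card ≤ 2 * m + 1 := by
  refine (Finset.card_le_card_of_injOn (t := Finset.Icc (-(m : ℤ)) m) ZMod.valMinAbs ?_
    (ZMod.injective_valMinAbs.injOn)).trans ?_
  · intro x hx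
    have hx : x.valMinAbs.natAbs ≤ m := by simpa using hx
    simp only [Finset.coe_Icc, Set.mem_Icc]
    omega
  · rw [Int.card_Icc]; omega

lemma prod_ite_eq_mul_pow (i : Fin d) (u v : ℕ) :
    ∏ j : Fin d, (if j = i then u else v) = u * v ^ (d - 1) := by
  rw [← Finset.mul_prod_erase _ _ (Finset.mem_univ i), if_pos rfl]
  congr 1
  rw [Finset.prod_congr rfl fun j hj => if_neg (Finset.ne_of_mem_erase hj), Finset.prod_const,
    Finset.card_erase_of_mem (Finset.mem_univ i), Finset.card_univ, Fintype.card_fin]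

/-- Shells of the torus grow at most like `m^(d-1)`. -/
lemma card_shell_le (m : ℕ) (hm : 1 ≤ m) :
    (Finset.univ.filter fun n : Site d L => siteNorm n = m).card ≤
      d * (2 * (2 * m + 1) ^ (d - 1)) := by
  classical
  have hsub : (Finset.univ.filter fun n : Site d L => siteNorm n = m) ⊆
      Finset.univ.biUnion fun i : Fin d => Fintype.piFinset fun j =>
        if j = i then Finset.univ.filter fun x : ZMod L => x.valMinAbs.natAbs = m
        else Finset.univ.filter fun x : ZMod L => x.valMinAbs.natAbs ≤ m := by
    intro n hn
    have hn : siteNorm n = m := by simpa using hn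
    have hne : (Finset.univ : Finset (Fin d)).Nonempty := by
      by_contra h
      rw [Finset.not_nonempty_iff_eq_empty] at h
      simp [siteNorm, h] at hn
      omega
    obtain ⟨i, -, hi⟩ := Finset.exists_mem_eq_sup _ hne fun i => (n i).valMinAbs.natAbs
    rw [Finset.mem_biUnion]
    refine ⟨i, Finset.mem_univ i, Fintype.mem_piFinset.2 fun j => ?_⟩
    split_ifs with hj
    · subst hj
      simpa using hi.symm.trans hn
    · simpa using siteNorm_le_iff.1 hn.le j
  refine (Finset.card_le_card hsub).trans (Finset.card_biUnion_le.trans ?_)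
  refine (Finset.sum_le_card_nsmul _ _ (2 * (2 * m + 1) ^ (d - 1)) fun i _ => ?_).trans (by simp)
  rw [Fintype.card_piFinset, ← prod_ite_eq_mul_pow i]
  refine Finset.prod_le_prod' fun j _ => ?_
  split_ifs
  · exact card_filter_natAbs_eq_le m
  · exact card_filter_natAbs_le_le m

/-- Shells of the torus grow at least like `m^(d-1)`, up to half the side length. -/
lemma le_card_shell (i : Fin d) {m : ℕ} (hm : m ≤ L / 2) :
    m ^ (d - 1) ≤ (Finset.univ.filter fun n : Site d L => siteNorm n = m).card := by
  classical
  set S : Finset (Fin d → ℕ) := Fintype.piFinset fun j => if j = i then {m} else Finset.range (m + 1)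
    with hS
  have hcard : S.card = (m + 1) ^ (d - 1) := by
    rw [hS, Fintype.card_piFinset, ← one_mul ((m + 1) ^ (d - 1)), ← prod_ite_eq_mul_pow i]
    refine Finset.prod_congr rfl fun j _ => ?_
    split_ifs <;> simp
  have hmem : ∀ k ∈ S, k i = m ∧ ∀ j, k j ≤ m := by
    intro k hk
    have hk := Fintype.mem_piFinset.1 hk
    have hi : k i = m := by simpa using hk i
    refine ⟨hi, fun j => ?_⟩
    rcases eq_or_ne j i with rfl | hj
    · exact hi.le
    · have := hk j
      rw [if_neg hj, Finset.mem_range] at this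
      omega
  have hval : ∀ k ∈ S, ∀ j, ((k j : ℕ) : ZMod L).valMinAbs = k j := fun k hk j =>
    ZMod.valMinAbs_natCast_of_le_half (((hmem k hk).2 j).trans hm)
  refine (Nat.pow_le_pow_left (Nat.le_succ m) _).trans (hcard.symm.le.trans ?_)
  refine Finset.card_le_card_of_injOn (fun k j => (k j : ZMod L)) ?_ ?_
  · intro k hk
    rw [Finset.coe_filter, Set.mem_ofPred_eq]
    refine ⟨Finset.mem_univ _, le_antisymm (siteNorm_le_iff.2 fun j => ?_) ?_⟩
    · rw [hval k hk j, Int.natAbs_natCast]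
      exact (hmem k hk).2 j
    · have := siteNorm_le_iff.1 (le_refl (siteNorm fun j => (k j : ZMod L))) i
      rw [hval k hk i, Int.natAbs_natCast, (hmem k hk).1] at this
      exact this
  · intro k hk k' hk' h
    ext j
    have h1 := hval k hk j
    rw [show ((k j : ℕ) : ZMod L) = (k' j : ℕ) from congrFun h j, hval k' hk' j] at h1
    exact_mod_cast h1.symm

/-- The lattice average of `‖θ‖^{-p}` over the nonzero frequencies of norm at most `ρ`. -/
def latticeAverage (d L : ℕ) [NeZero L] (p : ℕ) (ρ : ℝ) : ℝ :=
  1 / (L : ℝ) ^ d * ∑ n : Site d L with n ≠ 0 ∧ ‖freq n‖ ≤ ρ, 1 / ‖freq n‖ ^ p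

lemma one_div_norm_freq_pow (n : Site d L) (p : ℕ) :
    1 / ‖freq n‖ ^ p = ((L : ℝ) / (2 * Real.pi)) ^ p * (1 / (siteNorm n : ℝ) ^ p) := by
  rw [norm_freq, mul_pow, div_pow, div_pow]
  have hL : (0 : ℝ) < L := Nat.cast_pos.2 (NeZero.pos L)
  rw [one_div, mul_inv, inv_div, one_div]

lemma latticeAverage_eq (p : ℕ) (ρ : ℝ) :
    latticeAverage d L p ρ = ((L : ℝ) / (2 * Real.pi)) ^ p / (L : ℝ) ^ d *
      ∑ n : Site d L with n ≠ 0 ∧ ‖freq n‖ ≤ ρ, 1 / (siteNorm n : ℝ) ^ p := by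
  rw [latticeAverage]
  simp only [one_div_norm_freq_pow]
  rw [← Finset.mul_sum]
  ring

lemma sum_shells_le (p : ℕ) (ρ : ℝ) :
    ∑ n : Site d L with n ≠ 0 ∧ ‖freq n‖ ≤ ρ, 1 / (siteNorm n : ℝ) ^ p ≤
      (d * 2 * 3 ^ (d - 1) : ℝ) *
        ∑ m ∈ Finset.Icc 1 (L / 2), (m : ℝ) ^ (d - 1) / (m : ℝ) ^ p := by
  have h1 : ∑ n : Site d L with n ≠ 0 ∧ ‖freq n‖ ≤ ρ, 1 / (siteNorm n : ℝ) ^ p ≤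
      ∑ n : Site d L with n ≠ 0, 1 / (siteNorm n : ℝ) ^ p :=
    Finset.sum_le_sum_of_subset_of_nonneg
      (Finset.monotone_filter_right _ fun n _ hn => hn.1) fun _ _ _ => by positivity
  refine h1.trans ?_
  rw [← Finset.sum_fiberwise_of_maps_to (t := Finset.Icc 1 (L / 2)) (g := siteNorm)
    fun n hn => Finset.mem_Icc.2 ⟨siteNorm_pos (by simpa using hn), siteNorm_le_half n⟩,
    Finset.mul_sum]
  refine Finset.sum_le_sum fun m hm => ?_
  have hm1 : 1 ≤ m := (Finset.mem_Icc.1 hm).1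
  have hm0 : (0 : ℝ) < m := by exact_mod_cast hm1
  rw [Finset.sum_congr rfl fun n hn => by rw [(Finset.mem_filter.1 hn).2], Finset.sum_const,
    nsmul_eq_mul, mul_one_div, ← mul_div_assoc]
  refine div_le_div_of_nonneg_right ?_ (by positivity)
  have h2 : ((Finset.univ.filter fun n : Site d L => n ≠ 0).filter fun n => siteNorm n = m).card ≤
      d * (2 * (2 * m + 1) ^ (d - 1)) :=
    (Finset.card_le_card (Finset.filter_subset_filter _ (Finset.filter_subset _ _))).trans
      (card_shell_le m hm1)
  have h3 : d * (2 * (2 * m + 1) ^ (d - 1)) ≤ d * (2 * (3 * m) ^ (d - 1)) := by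
    gcongr
    omega
  calc _ ≤ ((d * (2 * (3 * m) ^ (d - 1)) : ℕ) : ℝ) := Nat.cast_le.2 (h2.trans h3)
    _ = _ := by push_cast; ring

lemma cast_harmonic (K : ℕ) : ((harmonic K : ℚ) : ℝ) = ∑ m ∈ Finset.Icc 1 K, 1 / (m : ℝ) := by
  rw [harmonic_eq_sum_Icc]
  push_cast
  simp

/-- The upper bound for lattice averages. -/
lemma exists_latticeAverage_le (d p : ℕ) (hd : 1 ≤ d) :
    ∃ C : ℝ, 0 < C ∧ ∀ (L : ℕ) [NeZero L], 2 ≤ L → ∀ ρ : ℝ,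
      latticeAverage d L p ρ ≤ C * latticeGrowth d p L := by
  set B : ℝ := (1 / (2 * Real.pi)) ^ p * (d * 2 * 3 ^ (d - 1)) with hB
  have hd0 : (0 : ℝ) < d := by exact_mod_cast hd
  have hB0 : 0 < B := by positivity
  -- it suffices to estimate the sum over the shells
  suffices h : ∃ C : ℝ, 0 < C ∧ ∀ L : ℕ, 2 ≤ L → (L : ℝ) ^ p / (L : ℝ) ^ d *
      ∑ m ∈ Finset.Icc 1 (L / 2), (m : ℝ) ^ (d - 1) / (m : ℝ) ^ p ≤ C * latticeGrowth d p L by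
    obtain ⟨C, hC, h⟩ := h
    refine ⟨B * C, by positivity, fun L _ hL ρ => ?_⟩
    rw [latticeAverage_eq]
    calc _ ≤ ((L : ℝ) / (2 * Real.pi)) ^ p / (L : ℝ) ^ d * ((d * 2 * 3 ^ (d - 1) : ℝ) *
          ∑ m ∈ Finset.Icc 1 (L / 2), (m : ℝ) ^ (d - 1) / (m : ℝ) ^ p) :=
          mul_le_mul_of_nonneg_left (sum_shells_le p ρ) (by positivity)
      _ = B * ((L : ℝ) ^ p / (L : ℝ) ^ d *
          ∑ m ∈ Finset.Icc 1 (L / 2), (m : ℝ) ^ (d - 1) / (m : ℝ) ^ p) := by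
          rw [hB, div_pow, div_pow]; ring
      _ ≤ B * (C * latticeGrowth d p L) := mul_le_mul_of_nonneg_left (h L hL) hB0.le
      _ = _ := by ring
  rcases lt_trichotomy d p with hlt | heq | hgt
  · refine ⟨2, two_pos, fun L hL => ?_⟩
    have hL0 : (0 : ℝ) < L := by exact_mod_cast (by omega : 0 < L)
    have hsum : ∑ m ∈ Finset.Icc 1 (L / 2), (m : ℝ) ^ (d - 1) / (m : ℝ) ^ p ≤ 2 := by
      calc _ ≤ ∑ m ∈ Finset.Ioo 0 (L / 2 + 1), ((m : ℝ) ^ 2)⁻¹ := by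
            rw [show Finset.Icc 1 (L / 2) = Finset.Ioo 0 (L / 2 + 1) by
              ext m; simp only [Finset.mem_Icc, Finset.mem_Ioo]; omega]
            refine Finset.sum_le_sum fun m hm => ?_
            have hm1 : (1 : ℝ) ≤ m := by exact_mod_cast (Finset.mem_Ioo.1 hm).1
            rw [div_le_iff₀ (by positivity), inv_mul_eq_div, le_div_iff₀ (by positivity), ← pow_add]
            exact pow_le_pow_right₀ hm1 (by omega)
        _ ≤ 2 := by simpa using sum_Ioo_inv_sq_le (α := ℝ) 0 (L / 2 + 1)
    rw [latticeGrowth, if_pos hlt]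
    have e : (L : ℝ) ^ p / (L : ℝ) ^ d = (L : ℝ) ^ (p - d) := by
      rw [div_eq_iff (by positivity), ← pow_add]; congr 1; omega
    rw [e, mul_comm]
    exact mul_le_mul_of_nonneg_right hsum (by positivity)
  · subst heq
    have hlog2 : 0 < Real.log 2 := Real.log_pos one_lt_two
    refine ⟨1 / Real.log 2 + 1, by positivity, fun L hL => ?_⟩
    have hL0 : (0 : ℝ) < L := by exact_mod_cast (by omega : 0 < L)
    have hsum : ∑ m ∈ Finset.Icc 1 (L / 2), (m : ℝ) ^ (d - 1) / (m : ℝ) ^ d ≤ 1 + Real.log L := by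
      calc _ = ((harmonic (L / 2) : ℚ) : ℝ) := by
            rw [cast_harmonic]
            refine Finset.sum_congr rfl fun m hm => ?_
            have hm0 : (0 : ℝ) < m := by exact_mod_cast (Finset.mem_Icc.1 hm).1
            rw [div_eq_div_iff (by positivity) (by positivity), one_mul, ← pow_succ]
            congr 1
            omega
        _ ≤ 1 + Real.log ((L / 2 : ℕ) : ℝ) := harmonic_le_one_add_log _
        _ ≤ 1 + Real.log L := by
            have : (0 : ℝ) < ((L / 2 : ℕ) : ℝ) := by exact_mod_cast (by omega : 0 < L / 2)
            have h2 : ((L / 2 : ℕ) : ℝ) ≤ L := by exact_mod_cast Nat.div_le_self L 2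
            linarith [Real.log_le_log this h2]
    have hlog : Real.log 2 ≤ Real.log L := Real.log_le_log two_pos (by exact_mod_cast hL)
    rw [latticeGrowth, if_neg (lt_irrefl d), if_pos rfl, div_self (by positivity), one_mul]
    have h3 : 1 ≤ 1 / Real.log 2 * Real.log L := by
      rw [one_div, inv_mul_eq_div, le_div_iff₀ hlog2]; linarith
    linarith
  · refine ⟨1, one_pos, fun L hL => ?_⟩
    have hL0 : (0 : ℝ) < L := by exact_mod_cast (by omega : 0 < L)
    have hL1 : (1 : ℝ) ≤ L := by exact_mod_cast (by omega : 1 ≤ L)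
    have hsum : ∑ m ∈ Finset.Icc 1 (L / 2), (m : ℝ) ^ (d - 1) / (m : ℝ) ^ p ≤
        (L : ℝ) ^ (d - p) := by
      calc _ ≤ ∑ m ∈ Finset.Icc 1 (L / 2), (L : ℝ) ^ (d - 1 - p) := by
            refine Finset.sum_le_sum fun m hm => ?_
            have hm' := Finset.mem_Icc.1 hm
            have hm0 : (0 : ℝ) < m := by exact_mod_cast hm'.1
            have e : (m : ℝ) ^ (d - 1) = (m : ℝ) ^ (d - 1 - p) * (m : ℝ) ^ p := by
              rw [← pow_add]; congr 1; omega
            rw [e, mul_div_cancel_right₀ _ (by positivity)]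
            exact pow_le_pow_left₀ hm0.le
              (by exact_mod_cast hm'.2.trans (Nat.div_le_self L 2)) _
        _ = ((L / 2 : ℕ) : ℝ) * (L : ℝ) ^ (d - 1 - p) := by
            rw [Finset.sum_const, Nat.card_Icc, nsmul_eq_mul]; simp
        _ ≤ L * (L : ℝ) ^ (d - 1 - p) := by
            refine mul_le_mul_of_nonneg_right ?_ (by positivity)
            exact_mod_cast Nat.div_le_self L 2
        _ = (L : ℝ) ^ (d - p) := by rw [← pow_succ']; congr 1; omega
    rw [latticeGrowth, if_neg (by omega), if_neg (by omega)]
    have e : (L : ℝ) ^ d = (L : ℝ) ^ p * (L : ℝ) ^ (d - p) := by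
      rw [← pow_add]; congr 1; omega
    calc _ ≤ (L : ℝ) ^ p / (L : ℝ) ^ d * (L : ℝ) ^ (d - p) :=
          mul_le_mul_of_nonneg_left hsum (by positivity)
      _ = 1 * 1 := by rw [e]; field_simp

lemma le_latticeAverage_of_shells {K : ℕ} (i : Fin d) (p : ℕ) {ρ : ℝ} (hK : K ≤ L / 2)
    (hρ : 2 * Real.pi / L * K ≤ ρ) :
    ((L : ℝ) / (2 * Real.pi)) ^ p / (L : ℝ) ^ d *
      ∑ m ∈ Finset.Icc 1 K, (m : ℝ) ^ (d - 1) / (m : ℝ) ^ p ≤ latticeAverage d L p ρ := by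
  have hL : (0 : ℝ) < L := Nat.cast_pos.2 (NeZero.pos L)
  rw [latticeAverage_eq]
  refine mul_le_mul_of_nonneg_left ?_ (by positivity)
  have h1 : ∑ n : Site d L with siteNorm n ∈ Finset.Icc 1 K, 1 / (siteNorm n : ℝ) ^ p ≤
      ∑ n : Site d L with n ≠ 0 ∧ ‖freq n‖ ≤ ρ, 1 / (siteNorm n : ℝ) ^ p := by
    refine Finset.sum_le_sum_of_subset_of_nonneg
      (Finset.monotone_filter_right _ fun n _ hn => ?_) fun _ _ _ => by positivity
    rw [Finset.mem_Icc] at hn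
    refine ⟨fun h => ?_, ?_⟩
    · rw [siteNorm_eq_zero.2 h] at hn; omega
    · rw [norm_freq]
      refine le_trans (mul_le_mul_of_nonneg_left ?_ (by positivity)) hρ
      exact_mod_cast hn.2
  refine le_trans ?_ h1
  rw [← Finset.sum_fiberwise_of_maps_to (t := Finset.Icc 1 K) (g := siteNorm)
    fun n hn => (Finset.mem_filter.1 hn).2]
  refine Finset.sum_le_sum fun m hm => ?_
  rw [Finset.sum_congr rfl fun n hn => by rw [(Finset.mem_filter.1 hn).2], Finset.sum_const,
    nsmul_eq_mul, mul_one_div]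
  refine div_le_div_of_nonneg_right ?_ (by positivity)
  have h2 := le_card_shell (L := L) i ((Finset.mem_Icc.1 hm).2.trans hK)
  have h3 : ((Finset.univ.filter fun n : Site d L => siteNorm n ∈ Finset.Icc 1 K).filter
      fun n => siteNorm n = m) = Finset.univ.filter fun n : Site d L => siteNorm n = m := by
    ext n
    simp only [Finset.mem_filter, Finset.mem_univ, true_and, and_iff_right_iff_imp]
    intro h; rwa [h]
  rw [h3]
  exact_mod_cast h2

/-- In the divergent cases `d ≤ p` the frequencies in an arbitrarily small ball carry the full
growth, with a constant independent of the ball. -/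
lemma exists_le_latticeAverage (d p : ℕ) (hd : 1 ≤ d) (hdp : d ≤ p) :
    ∃ c : ℝ, 0 < c ∧ ∀ ρ : ℝ, 0 < ρ → ∃ L₀ : ℕ, ∀ (L : ℕ) [NeZero L], L₀ ≤ L →
      c * latticeGrowth d p L ≤ latticeAverage d L p ρ := by
  have hπ := Real.pi_pos
  refine ⟨(1 / (2 * Real.pi)) ^ p / 2, by positivity, fun ρ hρ => ?_⟩
  rcases hdp.lt_or_eq with hlt | heq
  · -- the lowest frequencies suffice
    refine ⟨max 2 ⌈2 * Real.pi / ρ⌉₊, fun L _ hL => ?_⟩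
    have hL2 : 2 ≤ L := (le_max_left _ _).trans hL
    have hL0 : (0 : ℝ) < L := by exact_mod_cast (by omega : 0 < L)
    have hLρ : 2 * Real.pi / ρ ≤ L := (Nat.le_ceil _).trans
      (by exact_mod_cast (le_max_right _ _).trans hL)
    have h1 := le_latticeAverage_of_shells (L := L) (d := d) (K := 1) ⟨0, hd⟩ p (ρ := ρ) (by omega)
      (by rw [Nat.cast_one, mul_one, div_le_iff₀ hL0]; rw [div_le_iff₀ hρ] at hLρ; linarith)
    refine le_trans ?_ h1
    rw [latticeGrowth, if_pos hlt, Finset.Icc_self, Finset.sum_singleton]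
    have e : (L : ℝ) ^ p = (L : ℝ) ^ (p - d) * (L : ℝ) ^ d := by
      rw [← pow_add]; congr 1; omega
    have e2 : ((L : ℝ) / (2 * Real.pi)) ^ p / (L : ℝ) ^ d =
        (1 / (2 * Real.pi)) ^ p * (L : ℝ) ^ (p - d) := by
      rw [div_pow, e, one_div, inv_pow]; field_simp
    rw [e2]
    have : 0 ≤ (1 / (2 * Real.pi)) ^ p * (L : ℝ) ^ (p - d) := by positivity
    simp only [Nat.cast_one, one_pow, div_one, mul_one]
    linarith
  · subst heq
    set κ := min (ρ / (2 * Real.pi)) (1 / 2) with hκ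
    have hκ0 : 0 < κ := by positivity
    refine ⟨max 1 ⌈1 / κ ^ 2⌉₊, fun L _ hL => ?_⟩
    have hL1 : 1 ≤ L := (le_max_left _ _).trans hL
    have hL0 : (0 : ℝ) < L := by exact_mod_cast hL1
    have hLκ : 1 / κ ^ 2 ≤ L := (Nat.le_ceil _).trans
      (by exact_mod_cast (le_max_right _ _).trans hL)
    have hKle : (⌊κ * L⌋₊ : ℝ) ≤ κ * L := Nat.floor_le (by positivity)
    have hK2 : ⌊κ * L⌋₊ ≤ L / 2 := by
      rw [Nat.le_div_iff_mul_le two_pos]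
      have h3 : κ * L ≤ 1 / 2 * L := mul_le_mul_of_nonneg_right (min_le_right _ _) hL0.le
      have h4 : (⌊κ * L⌋₊ : ℝ) * 2 ≤ L := by linarith
      exact_mod_cast h4
    have hKρ : 2 * Real.pi / L * ⌊κ * L⌋₊ ≤ ρ := by
      have h3 : κ * L ≤ ρ / (2 * Real.pi) * L := mul_le_mul_of_nonneg_right (min_le_left _ _) hL0.le
      calc _ ≤ 2 * Real.pi / L * (ρ / (2 * Real.pi) * L) :=
            mul_le_mul_of_nonneg_left (hKle.trans h3) (by positivity)
        _ = ρ := by field_simp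
    refine le_trans ?_ (le_latticeAverage_of_shells ⟨0, hd⟩ d hK2 hKρ)
    have hsum : ∑ m ∈ Finset.Icc 1 ⌊κ * L⌋₊, (m : ℝ) ^ (d - 1) / (m : ℝ) ^ d =
        ((harmonic ⌊κ * L⌋₊ : ℚ) : ℝ) := by
      rw [cast_harmonic]
      refine Finset.sum_congr rfl fun m hm => ?_
      have hm0 : (0 : ℝ) < m := by exact_mod_cast (Finset.mem_Icc.1 hm).1
      rw [div_eq_div_iff (by positivity) (by positivity), one_mul, ← pow_succ]
      congr 1
      omega
    have hlog : Real.log L / 2 ≤ ((harmonic ⌊κ * L⌋₊ : ℚ) : ℝ) := by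
      have h5 : Real.log (κ * L) ≤ ((harmonic ⌊κ * L⌋₊ : ℚ) : ℝ) :=
        (Real.log_le_log (by positivity) (by
          push_cast; exact (Nat.lt_floor_add_one _).le)).trans (log_add_one_le_harmonic _)
      have h6 : Real.log (1 / κ ^ 2) ≤ Real.log L := Real.log_le_log (by positivity) hLκ
      rw [one_div, Real.log_inv, Real.log_pow] at h6
      rw [Real.log_mul hκ0.ne' hL0.ne'] at h5
      push_cast at h6
      linarith
    rw [hsum, latticeGrowth, if_neg (lt_irrefl d), if_pos rfl]
    have e : ((L : ℝ) / (2 * Real.pi)) ^ d / (L : ℝ) ^ d = (1 / (2 * Real.pi)) ^ d := by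
      rw [div_pow, one_div, inv_pow]; field_simp
    rw [e]
    have : 0 < (1 / (2 * Real.pi)) ^ d := by positivity
    nlinarith

lemma localGrowth_bounds (d L : ℕ) (hd : 1 ≤ d) (hL : 1 ≤ L) :
    latticeGrowth d 2 L ≤ localGrowth d ((L : ℝ) ^ d) ∧
      localGrowth d ((L : ℝ) ^ d) ≤ 4 * latticeGrowth d 2 L := by
  have hL1 : (1 : ℝ) ≤ L := by exact_mod_cast hL
  have hlog := Real.log_nonneg hL1
  unfold latticeGrowth localGrowth
  rcases (by omega : d = 1 ∨ d = 2 ∨ 3 ≤ d) with rfl | rfl | h3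
  · simp
    linarith
  · simp
    constructor <;> linarith
  · simp only [show ¬ d < 2 by omega, show ¬ d = 2 by omega, show ¬ d = 1 by omega, if_false]
    norm_num

lemma globalGrowth_bounds (d L : ℕ) (hd : 1 ≤ d) (hL : 1 ≤ L) :
    latticeGrowth d 4 L ≤ globalGrowth d ((L : ℝ) ^ d) ∧
      globalGrowth d ((L : ℝ) ^ d) ≤ 4 * latticeGrowth d 4 L := by
  have hL1 : (1 : ℝ) ≤ L := by exact_mod_cast hL
  have hlog := Real.log_nonneg hL1
  unfold latticeGrowth globalGrowth
  rcases (by omega : d = 1 ∨ d = 2 ∨ d = 3 ∨ d = 4 ∨ 5 ≤ d) with rfl | rfl | rfl | rfl | h5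
  · simp
    have : (0 : ℝ) ≤ (L : ℝ) ^ 3 := by positivity
    linarith
  · simp
    have : (0 : ℝ) ≤ (L : ℝ) ^ 2 := by positivity
    linarith
  · have e : ((L : ℝ) ^ 3) ^ (1 / 3 : ℝ) = L := by
      rw [← Real.rpow_natCast, ← Real.rpow_mul (by linarith)]
      norm_num
    simp [-one_div, e]
    linarith
  · simp
    linarith
  · simp only [show ¬ d < 4 by omega, show ¬ d = 4 by omega, show ¬ d = 3 by omega,
      show ¬ d = 2 by omega, show ¬ d = 1 by omega, if_false]
    norm_num

end LatticeSums

/-! ### Estimates for the variance of a single mode -/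

/-- Estimates for the stationary variances of a mode at squared frequency `r`, uniform in the
position gain factor `s ≥ 1`. Here `α` and `φ` are of order `r` and `γ` is of order one, so that
`routh α (s φ) γ c` is of order `1 + s r`. -/
lemma exists_mode_estimates {m C c : ℝ} (hm : 0 < m) (hC : 0 < C) (hc : 0 < c) :
    ∃ κ K : ℝ, 0 < κ ∧ 0 < K ∧ ∀ s r α φ γ : ℝ, 1 ≤ s → 0 < r → r ≤ Real.pi ^ 2 →
      m * r ≤ α → α ≤ C * r → m * r ≤ φ → φ ≤ C * r → m ≤ γ → γ ≤ C →
      κ / s ≤ processVar α (s * φ) γ c ∧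
      processVar α (s * φ) γ c ≤ K ∧
      processVar α (s * φ) γ c * r ≤ K / s ∧
      integratorVar α (s * φ) γ c * r ^ 2 ≤ K / s ∧
      κ / (s * (1 + s * r)) ≤ integratorVar α (s * φ) γ c * r ^ 2 := by
  have hπ := Real.pi_pos
  set A := C * Real.pi ^ 2 with hA
  have hA0 : 0 < A := by positivity
  set D := (A + C) * (A * C + c) + C ^ 2 with hD
  have hD0 : 0 < D := by positivity
  set E := 1 + C / m * (A + C) with hE
  have hE0 : 0 < E := by positivity
  refine ⟨min (1 / (2 * D * (1 + Real.pi ^ 2))) (m / (2 * C ^ 2 * D)),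
    E / (2 * (m * c)) + E / (2 * m ^ 2) + (A + C) / (2 * m ^ 3 * c), by positivity, by positivity,
    fun s r α φ γ hs hr hrπ hα hα' hφ hφ' hγ hγ' => ?_⟩
  have hs0 : 0 < s := by linarith
  have hα0 : 0 < α := (mul_pos hm hr).trans_le hα
  have hφ0 : 0 < φ := (mul_pos hm hr).trans_le hφ
  have hγ0 : 0 < γ := hm.trans_le hγ
  have hαA : α ≤ A := hα'.trans (mul_le_mul_of_nonneg_left hrπ hC.le)
  have hΔ0 : 0 < routh α (s * φ) γ c := by unfold routh; positivity
  set Δ := routh α (s * φ) γ c with hΔ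
  have hΔ1 : m * c ≤ Δ := by
    have h1 : m * c ≤ γ * c := mul_le_mul_of_nonneg_right hγ hc.le
    have h2 : 0 ≤ α * (α * γ + c) + γ * (α * γ) + γ * (s * φ) := by positivity
    have h3 : Δ = α * (α * γ + c) + γ * (α * γ) + γ * (s * φ) + γ * c := by
      rw [hΔ, routh]; ring
    linarith
  have hΔ2 : m ^ 2 * s * r ≤ Δ := by
    have h1 : m * (s * (m * r)) ≤ γ * (s * φ) :=
      mul_le_mul hγ (mul_le_mul_of_nonneg_left hφ hs0.le) (by positivity) hγ0.le
    have h2 : 0 ≤ (α + γ) * (α * γ + c) := by positivity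
    have h3 : Δ = (α + γ) * (α * γ + c) + γ * (s * φ) := rfl
    nlinarith
  have hΔ3 : Δ ≤ D * (1 + s * r) := by
    have h1 : (α + γ) * (α * γ + c) ≤ (A + C) * (A * C + c) := by gcongr
    have h2 : γ * (s * φ) ≤ C * (s * (C * r)) := by gcongr
    have h3 : Δ = (α + γ) * (α * γ + c) + γ * (s * φ) := rfl
    have h4 : 0 ≤ (A + C) * (A * C + c) * (s * r) := by positivity
    have h5 : 0 ≤ C ^ 2 := sq_nonneg C
    rw [hD]
    nlinarith
  have hΔ4 : Δ ≤ D * (1 + Real.pi ^ 2) * s := by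
    refine hΔ3.trans ?_
    rw [mul_assoc]
    refine mul_le_mul_of_nonneg_left ?_ hD0.le
    nlinarith
  have hP : processVar α (s * φ) γ c = (1 + α * (α + γ) / (s * φ)) / (2 * Δ) := by
    rw [processVar, ← hΔ]; field_simp
  have hfrac : α * (α + γ) / (s * φ) ≤ C / m * (A + C) := by
    have h1 : α / (s * φ) ≤ C / m := by
      rw [div_le_div_iff₀ (by positivity) hm]
      calc α * m ≤ C * r * m := mul_le_mul_of_nonneg_right hα' hm.le
        _ = C * (1 * (m * r)) := by ring
        _ ≤ C * (s * φ) := by gcongr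
    calc α * (α + γ) / (s * φ) = α / (s * φ) * (α + γ) := by ring
      _ ≤ C / m * (A + C) := by gcongr
  have hPE : processVar α (s * φ) γ c ≤ E / (2 * Δ) := by
    rw [hP]
    refine div_le_div_of_nonneg_right ?_ (by positivity)
    linarith
  have hI : integratorVar α (s * φ) γ c * r ^ 2 = (α + γ) * r ^ 2 / (2 * α * (s * φ) * Δ) := by
    rw [integratorVar, ← hΔ]; ring
  have k2 : 0 < E / (2 * (m * c)) := by positivity
  have k3 : 0 < E / (2 * m ^ 2) := by positivity
  have k4 : 0 < (A + C) / (2 * m ^ 3 * c) := by positivity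
  refine ⟨?_, ?_, ?_, ?_, ?_⟩
  · calc _ ≤ 1 / (2 * D * (1 + Real.pi ^ 2)) / s := by gcongr; exact min_le_left _ _
      _ = 1 / (2 * (D * (1 + Real.pi ^ 2) * s)) := by rw [div_div]; ring_nf
      _ ≤ 1 / (2 * Δ) := by gcongr
      _ ≤ _ := by
        rw [hP]
        gcongr
        linarith [show 0 ≤ α * (α + γ) / (s * φ) by positivity]
  · calc _ ≤ E / (2 * Δ) := hPE
      _ ≤ E / (2 * (m * c)) := by gcongr
      _ ≤ _ := by linarith
  · calc _ ≤ E / (2 * Δ) * r := by gcongr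
      _ ≤ E / (2 * (m ^ 2 * s * r)) * r := by gcongr
      _ = E / (2 * m ^ 2) / s := by field_simp
      _ ≤ _ := by gcongr; linarith
  · rw [hI]
    calc _ ≤ (A + C) * r ^ 2 / (2 * (m * r) * (s * (m * r)) * (m * c)) := by gcongr
      _ = (A + C) / (2 * m ^ 3 * c) / s := by field_simp
      _ ≤ _ := by gcongr; linarith
  · rw [hI]
    calc _ ≤ m / (2 * C ^ 2 * D) / (s * (1 + s * r)) := by gcongr; exact min_le_right _ _
      _ = m * r ^ 2 / (2 * (C * r) * (s * (C * r)) * (D * (1 + s * r))) := by field_simp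
      _ ≤ (α + γ) * r ^ 2 / (2 * α * (s * φ) * Δ) := by gcongr; linarith

/-! ### Spectral representation of the two performance measures -/

/-- Stationary variance of the position of the mode at frequency `θ`. -/
def modeVar {d : ℕ} (f g a : FeedbackArray d) (c ε : ℝ) (θ : Fin d → ℝ) : ℝ :=
  processVar (negSymbol a θ) (negSymbol f θ) (negSymbol g θ) c +
    (c * ε) ^ 2 * integratorVar (negSymbol a θ) (negSymbol f θ) (negSymbol g θ) c

/-- The spectral weight of the local error. -/
def localWeight {d : ℕ} (θ : Fin d → ℝ) : ℝ := ∑ r, 2 * (1 - Real.cos (θ r))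

/-- The stationary variance of an error with spectral weight `w`, the average over the torus of
the weighted variances of the nonconstant modes. -/
def stationaryVar {d : ℕ} (L : ℕ) [NeZero L] (w : (Fin d → ℝ) → ℝ) (f g a : FeedbackArray d)
    (c ε : ℝ) : ℝ :=
  d * (1 / (L : ℝ) ^ d * ∑ n : Site d L with n ≠ 0, w (freq n) * modeVar f g a c ε (freq n))

/-- Sign conditions on the mode parameters that make all nonconstant modes asymptotically stable. -/
structure HasStableModes {d : ℕ} (f g a : FeedbackArray d) : Prop where
  symm_f : IsSymmetric f
  symm_g : IsSymmetric g
  symm_a : IsSymmetric a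
  zero_f : negSymbol f 0 = 0
  zero_a : negSymbol a 0 = 0
  pos_f : ∀ θ, ‖θ‖ ≤ Real.pi → θ ≠ 0 → 0 < negSymbol f θ
  pos_a : ∀ θ, ‖θ‖ ≤ Real.pi → θ ≠ 0 → 0 < negSymbol a θ
  pos_g : ∀ θ, ‖θ‖ ≤ Real.pi → 0 < negSymbol g θ

section Spectral

variable {d L : ℕ} [NeZero L]

lemma siteDFT_single (n k : Site d L) : siteDFT n (Pi.single k 1) = siteChar n k := by
  rw [siteDFT, Finset.sum_eq_single k]
  · simp
  · intro m _ hm; simp [Pi.single_eq_of_ne hm]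
  · simp

lemma siteChar_comm (n m : Site d L) : siteChar n m = siteChar m n := by
  simp [siteChar, mul_comm]

/-- The weights whose observation is the deviation from the neighbor in direction `r`. -/
def neighborWeight (k : Site d L) (r : Fin d) : Site d L → ℝ :=
  fun l => (Pi.single k 1 : Site d L → ℝ) l + -1 * (Pi.single (k - Pi.single r 1) 1 : Site d L → ℝ) l

/-- The weights whose observation is the deviation from the spatial mean. -/
def meanWeight (k : Site d L) : Site d L → ℝ :=
  fun l => (Pi.single k 1 : Site d L → ℝ) l + -(1 / (L : ℝ) ^ d) * 1

lemma sum_neighborWeight_mul (k : Site d L) (r : Fin d) (x : Site d L → ℝ) :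
    ∑ l, neighborWeight k r l * x l = x k - x (k - Pi.single r 1) := by
  simp [neighborWeight, add_mul, Finset.sum_add_distrib, Pi.single_apply, sub_eq_add_neg]

lemma sum_meanWeight_mul (k : Site d L) (x : Site d L → ℝ) :
    ∑ l, meanWeight k l * x l = x k - 1 / ((L : ℝ) ^ d) * ∑ l, x l := by
  simp only [meanWeight, add_mul, Finset.sum_add_distrib, mul_one, ← Finset.mul_sum]
  simp [Pi.single_apply, sub_eq_add_neg]

lemma norm_sq_one_sub_exp (x : ℝ) :
    ‖1 - starRingEnd ℂ (Complex.exp (Complex.I * (x : ℂ)))‖ ^ 2 = 2 * (1 - Real.cos x) := by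
  rw [Complex.sq_norm, Complex.normSq_apply, mul_comm Complex.I]
  simp only [Complex.sub_re, Complex.sub_im, Complex.one_re, Complex.one_im, Complex.conj_re,
    Complex.conj_im, Complex.exp_ofReal_mul_I_re, Complex.exp_ofReal_mul_I_im]
  nlinarith [Real.sin_sq_add_cos_sq x]

lemma norm_sq_siteDFT_neighborWeight (n k : Site d L) (r : Fin d) :
    ‖siteDFT n (neighborWeight k r)‖ ^ 2 = 2 * (1 - Real.cos (freq n r)) := by
  have e1 : siteDFT n (neighborWeight k r) =
      siteChar n k * (1 - starRingEnd ℂ (siteChar n (Pi.single r 1))) := by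
    unfold neighborWeight
    rw [siteDFT_add, siteDFT_const_mul, siteDFT_single, siteDFT_single, sub_eq_add_neg k,
      siteChar_add, siteChar_neg]
    push_cast
    ring
  have e2 : siteChar n (Pi.single r 1) = Complex.exp (Complex.I * ((freq n r : ℝ) : ℂ)) := by
    have h := siteChar_intCast n (Pi.single r 1)
    have h1 : (fun i => ((Pi.single r 1 : Fin d → ℤ) i : ZMod L)) = Pi.single r 1 := by
      ext i
      by_cases hi : i = r
      · subst hi; simp
      · simp [Pi.single_eq_of_ne hi]
    have h2 : ∑ i, freq n i * (((Pi.single r 1 : Fin d → ℤ) i : ℤ) : ℝ) = freq n r := by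
      rw [Finset.sum_eq_single r]
      · simp
      · intro i _ hi; simp [Pi.single_eq_of_ne hi]
      · simp
    rw [h1, h2] at h
    exact h
  rw [e1, norm_mul, norm_siteChar, one_mul, e2, norm_sq_one_sub_exp]

lemma norm_sq_siteDFT_meanWeight {n : Site d L} (hn : n ≠ 0) (k : Site d L) :
    ‖siteDFT n (meanWeight k)‖ ^ 2 = 1 := by
  have e1 : siteDFT n (fun _ : Site d L => (1 : ℝ)) = 0 := by
    simp only [siteDFT, Complex.ofReal_one, mul_one]
    simp_rw [siteChar_comm n]
    rw [sum_siteChar, if_neg hn]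
  unfold meanWeight
  rw [siteDFT_add, siteDFT_const_mul, siteDFT_single, e1, mul_zero, add_zero, norm_siteChar,
    one_pow]

lemma tendsto_integral_sq_of_hasStableModes {f g a : FeedbackArray d} (h : HasStableModes f g a)
    {c : ℝ} (hc : 0 < c) (ε : ℝ) (b : Site d L → ℝ) (hb : ∑ l, b l = 0) (j : Fin d)
    (ψ₀ : State d L → ℝ) :
    Tendsto (fun t => ∫ ψ, (∑ l, b l * position ψ l j) ^ 2 ∂(stateLaw f g a c ε ψ₀ t)) atTop
      (𝓝 (1 / (L : ℝ) ^ d * ∑ n with n ≠ 0, ‖siteDFT n b‖ ^ 2 * modeVar f g a c ε (freq n))) :=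
  tendsto_integral_sq_stateLaw (α := fun n => negSymbol a (freq n))
    (φ := fun n => negSymbol f (freq n)) (γ := fun n => negSymbol g (freq n)) hc ε
    (fun _ => symbol_eq_neg_negSymbol h.symm_a _) (fun _ => symbol_eq_neg_negSymbol h.symm_f _)
    (fun _ => symbol_eq_neg_negSymbol h.symm_g _)
    (fun n hn => h.pos_a _ (norm_freq_le_pi n) (freq_ne_zero hn))
    (fun n hn => h.pos_f _ (norm_freq_le_pi n) (freq_ne_zero hn))
    (fun n => h.pos_g _ (norm_freq_le_pi n)) (by simp only [freq_zero, h.zero_a])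
    (by simp only [freq_zero, h.zero_f]) b hb j ψ₀

lemma integrable_sq_position (f g a : FeedbackArray d) (c ε t : ℝ) (ψ₀ : State d L → ℝ)
    (b : Site d L → ℝ) (j : Fin d) :
    Integrable (fun ψ => (∑ l, b l * position ψ l j) ^ 2) (stateLaw f g a c ε ψ₀ t) := by
  simp only [← sum_positionWeight_mul]
  exact integrable_sq_stateLaw f g a c ε t ψ₀ _

theorem isPerSiteVariance_global {f g a : FeedbackArray d} (h : HasStableModes f g a)
    {c : ℝ} (hc : 0 < c) (ε : ℝ) :
    IsPerSiteVariance (L := L) globalErrorSq f g a c ε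
      (stationaryVar L (fun _ => 1) f g a c ε) := by
  intro k ψ₀
  have hL : (L : ℝ) ^ d ≠ 0 := pow_ne_zero _ (Nat.cast_ne_zero.2 (NeZero.ne L))
  have hb : ∑ l, meanWeight k l = 0 := by
    have := sum_meanWeight_mul k fun _ => 1
    simp only [mul_one, Finset.sum_const, Finset.card_univ, nsmul_eq_mul] at this
    rw [this]
    simp [hL]
  have hint : ∀ t, ∫ ψ, globalErrorSq k ψ ∂(stateLaw f g a c ε ψ₀ t) =
      ∑ j, ∫ ψ, (∑ l, meanWeight k l * position ψ l j) ^ 2 ∂(stateLaw f g a c ε ψ₀ t) := by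
    intro t
    rw [← integral_finsetSum _ fun j _ => integrable_sq_position f g a c ε t ψ₀ _ j]
    refine integral_congr_ae (Eventually.of_forall fun ψ => ?_)
    simp only [globalErrorSq]
    exact Finset.sum_congr rfl fun j _ => by rw [sum_meanWeight_mul k fun l => position ψ l j]
  simp only [hint]
  have hlim := tendsto_finsetSum Finset.univ fun j _ =>
    tendsto_integral_sq_of_hasStableModes h hc ε (meanWeight k) hb j ψ₀
  convert hlim using 2
  rw [stationaryVar, Finset.sum_const, Finset.card_univ, Fintype.card_fin, nsmul_eq_mul]
  congr 2
  refine Finset.sum_congr rfl fun n hn => ?_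
  rw [norm_sq_siteDFT_meanWeight (Finset.mem_filter.1 hn).2]

theorem isPerSiteVariance_local {f g a : FeedbackArray d} (h : HasStableModes f g a)
    {c : ℝ} (hc : 0 < c) (ε : ℝ) :
    IsPerSiteVariance (L := L) localErrorSq f g a c ε
      (stationaryVar L localWeight f g a c ε) := by
  intro k ψ₀
  have hb : ∀ r, ∑ l, neighborWeight k r l = 0 := by
    intro r
    have := sum_neighborWeight_mul k r fun _ => 1
    simpa using this
  have hint : ∀ t, ∫ ψ, localErrorSq k ψ ∂(stateLaw f g a c ε ψ₀ t) =
      ∑ r, ∑ j, ∫ ψ, (∑ l, neighborWeight k r l * position ψ l j) ^ 2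
        ∂(stateLaw f g a c ε ψ₀ t) := by
    intro t
    have h1 : ∀ r, ∑ j, ∫ ψ, (∑ l, neighborWeight k r l * position ψ l j) ^ 2
        ∂(stateLaw f g a c ε ψ₀ t) =
        ∫ ψ, ∑ j, (∑ l, neighborWeight k r l * position ψ l j) ^ 2
        ∂(stateLaw f g a c ε ψ₀ t) := fun r =>
      (integral_finsetSum _ fun j _ => integrable_sq_position f g a c ε t ψ₀ _ j).symm
    simp only [h1]
    rw [← integral_finsetSum _ fun r _ => integrable_finsetSum _ fun j _ =>
      integrable_sq_position f g a c ε t ψ₀ (neighborWeight k r) j]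
    refine integral_congr_ae (Eventually.of_forall fun ψ => ?_)
    simp only [localErrorSq]
    exact Finset.sum_congr rfl fun r _ => Finset.sum_congr rfl fun j _ => by
      rw [sum_neighborWeight_mul k r fun l => position ψ l j]
  simp only [hint]
  have hlim := tendsto_finsetSum Finset.univ fun r _ => tendsto_finsetSum Finset.univ fun j _ =>
    tendsto_integral_sq_of_hasStableModes h hc ε (neighborWeight k r) (hb r) j ψ₀
  convert hlim using 2
  simp only [Finset.sum_const, Finset.card_univ, Fintype.card_fin, nsmul_eq_mul,
    norm_sq_siteDFT_neighborWeight]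
  rw [← Finset.mul_sum, ← Finset.mul_sum, Finset.sum_comm, stationaryVar]
  simp only [localWeight, Finset.sum_mul]

end Spectral

/-! ### Spectral weights -/

/-- A spectral weight of order `‖θ‖^q`, whose lattice average does not degenerate. -/
structure IsSpectralWeight (d q : ℕ) (w : (Fin d → ℝ) → ℝ) (k K : ℝ) : Prop where
  lower_pos : 0 < k
  upper_pos : 0 < K
  lower : ∀ θ, ‖θ‖ ≤ Real.pi → k * ‖θ‖ ^ q ≤ w θ
  upper : ∀ θ, ‖θ‖ ≤ Real.pi → w θ ≤ K * ‖θ‖ ^ q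
  average : ∀ (L : ℕ) [NeZero L], 2 ≤ L →
    1 / 2 ≤ 1 / (L : ℝ) ^ d * ∑ n : Site d L with n ≠ 0, w (freq n)

lemma isSpectralWeight_one {d : ℕ} (hd : 1 ≤ d) : IsSpectralWeight d 0 (fun _ => 1) 1 1 where
  lower_pos := one_pos
  upper_pos := one_pos
  lower θ _ := by simp
  upper θ _ := by simp
  average L _ hL := by
    have hL2 : (2 : ℝ) ≤ (L : ℝ) ^ d := by
      have h1 : (2 : ℝ) ≤ L := by exact_mod_cast hL
      calc (2 : ℝ) ≤ (L : ℝ) ^ 1 := by simpa using h1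
        _ ≤ _ := pow_le_pow_right₀ (by linarith) hd
    have hcard : ∑ n : Site d L with n ≠ 0, (1 : ℝ) = (L : ℝ) ^ d - 1 := by
      rw [Finset.sum_filter, Finset.sum_ite, Finset.sum_const_zero, add_zero, Finset.sum_const,
        Finset.filter_ne', Finset.card_erase_of_mem (Finset.mem_univ _), Finset.card_univ,
        nsmul_eq_mul, mul_one, Nat.cast_sub Fintype.card_pos]
      simp
    rw [hcard, one_div, one_div, inv_mul_eq_div, le_div_iff₀ (by linarith)]
    linarith

lemma isSpectralWeight_localWeight {d : ℕ} (hd : 1 ≤ d) :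
    IsSpectralWeight d 2 localWeight (4 / Real.pi ^ 2) d where
  lower_pos := by positivity
  upper_pos := by exact_mod_cast hd
  lower θ hθ := by
    have h1 : ‖θ‖ ^ 2 ≤ ∑ i, θ i ^ 2 := by
      have h2 : ‖θ‖ ≤ Real.sqrt (∑ i, θ i ^ 2) := by
        refine (pi_norm_le_iff_of_nonneg (Real.sqrt_nonneg _)).2 fun i => Real.abs_le_sqrt ?_
        exact Finset.single_le_sum (f := fun i => θ i ^ 2) (fun _ _ => sq_nonneg _)
          (Finset.mem_univ i)
      calc ‖θ‖ ^ 2 ≤ Real.sqrt (∑ i, θ i ^ 2) ^ 2 := pow_le_pow_left₀ (norm_nonneg _) h2 2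
        _ = _ := Real.sq_sqrt (Finset.sum_nonneg fun _ _ => sq_nonneg _)
    refine (mul_le_mul_of_nonneg_left h1 (by positivity)).trans ?_
    rw [Finset.mul_sum]
    refine Finset.sum_le_sum fun i _ => ?_
    have := Real.cos_le_one_sub_mul_cos_sq ((norm_le_pi_norm θ i).trans hθ)
    have e : 4 / Real.pi ^ 2 * θ i ^ 2 = 2 * (2 / Real.pi ^ 2 * θ i ^ 2) := by ring
    linarith
  upper θ _ := by
    have h1 : ∀ i ∈ Finset.univ, 2 * (1 - Real.cos (θ i)) ≤ ‖θ‖ ^ 2 := by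
      intro i _
      have h2 := Real.one_sub_sq_div_two_le_cos (x := θ i)
      have h3 : θ i ^ 2 ≤ ‖θ‖ ^ 2 := by
        rw [← sq_abs]; exact pow_le_pow_left₀ (abs_nonneg _) (norm_le_pi_norm θ i) 2
      linarith
    have h2 := Finset.sum_le_card_nsmul _ _ _ h1
    rw [Finset.card_univ, Fintype.card_fin, nsmul_eq_mul] at h2
    exact h2
  average L _ hL := by
    have hL0 : (0 : ℝ) < (L : ℝ) ^ d := pow_pos (Nat.cast_pos.2 (by omega)) d
    have h1 : ∑ n : Site d L with n ≠ 0, localWeight (freq n) =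
        ∑ r, (L : ℝ) ^ d * ∑ m, neighborWeight (0 : Site d L) r m ^ 2 := by
      rw [Finset.sum_filter_of_ne]
      · simp only [localWeight, ← parseval, norm_sq_siteDFT_neighborWeight]
        exact Finset.sum_comm
      · intro n _ hne hn
        simp [hn, freq_zero, localWeight] at hne
    have h2 : ∀ r ∈ Finset.univ, (L : ℝ) ^ d * 1 ≤
        (L : ℝ) ^ d * ∑ m, neighborWeight (0 : Site d L) r m ^ 2 := by
      intro r _
      refine mul_le_mul_of_nonneg_left ?_ hL0.le
      refine le_trans ?_ (Finset.single_le_sum (f := fun m => neighborWeight (0 : Site d L) r m ^ 2)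
        (fun m _ => sq_nonneg _) (Finset.mem_univ 0))
      have hne : (0 : Site d L) ≠ 0 - Pi.single r 1 := by
        have : Fact (1 < L) := ⟨by omega⟩
        intro h
        have := congrFun h r
        simp at this
      simp only [neighborWeight, Pi.single_eq_same, Pi.single_eq_of_ne hne]
      norm_num
    have h3 := Finset.card_nsmul_le_sum _ _ _ h2
    rw [Finset.card_univ, Fintype.card_fin, nsmul_eq_mul, mul_one] at h3
    have h4 : (1 : ℝ) ≤ d := by exact_mod_cast hd
    rw [h1, one_div, one_div, inv_mul_eq_div, le_div_iff₀ hL0]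
    nlinarith

/-! ### Bounds for the stationary variance -/

/-- The mode parameters are of the orders `‖θ‖²`, `‖θ‖²`, `1`. -/
def HasParameterBounds {d : ℕ} (f g a : FeedbackArray d) (m C : ℝ) : Prop :=
  ∀ θ : Fin d → ℝ, ‖θ‖ ≤ Real.pi →
    (m * ‖θ‖ ^ 2 ≤ negSymbol a θ ∧ negSymbol a θ ≤ C * ‖θ‖ ^ 2) ∧
    (m * ‖θ‖ ^ 2 ≤ negSymbol f θ ∧ negSymbol f θ ≤ C * ‖θ‖ ^ 2) ∧
    (m ≤ negSymbol g θ ∧ negSymbol g θ ≤ C)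

section Variance

variable {d : ℕ}

lemma HasParameterBounds.hasStableModes {f g a : FeedbackArray d} {m C : ℝ}
    (h : HasParameterBounds f g a m C) (hm : 0 < m) (hf : IsSymmetric f) (hg : IsSymmetric g)
    (ha : IsSymmetric a) (hf0 : IsRelative f) (ha0 : IsRelative a) {s : ℝ} (hs : 0 < s) :
    HasStableModes (s • f) g a where
  symm_f := hf.smul s
  symm_g := hg
  symm_a := ha
  zero_f := by rw [negSymbol_smul hs.ne', negSymbol_zero_of_isRelative hf0, mul_zero]
  zero_a := negSymbol_zero_of_isRelative ha0
  pos_f θ hθ h0 := by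
    have : 0 < ‖θ‖ := norm_pos_iff.2 h0
    rw [negSymbol_smul hs.ne']
    exact mul_pos hs ((by positivity : 0 < m * ‖θ‖ ^ 2).trans_le (h θ hθ).2.1.1)
  pos_a θ hθ h0 := by
    have : 0 < ‖θ‖ := norm_pos_iff.2 h0
    exact (by positivity : 0 < m * ‖θ‖ ^ 2).trans_le (h θ hθ).1.1
  pos_g θ hθ := hm.trans_le (h θ hθ).2.2.1

/-- The estimates of a mode as functions of the frequency. -/
lemma exists_frequency_estimates {f g a : FeedbackArray d} {m C c : ℝ} (hm : 0 < m) (hC : 0 < C)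
    (hc : 0 < c) (h : HasParameterBounds f g a m C) :
    ∃ κ K : ℝ, 0 < κ ∧ 0 < K ∧ ∀ (s : ℝ) (θ : Fin d → ℝ), 1 ≤ s → θ ≠ 0 → ‖θ‖ ≤ Real.pi →
      ∃ P I : ℝ, (∀ ε, modeVar (s • f) g a c ε θ = P + (c * ε) ^ 2 * I) ∧
      κ / s ≤ P ∧ P ≤ K ∧ P ≤ K / s / ‖θ‖ ^ 2 ∧ I ≤ K / s / ‖θ‖ ^ 4 ∧
      κ / (s * (1 + s * ‖θ‖ ^ 2)) / ‖θ‖ ^ 4 ≤ I := by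
  obtain ⟨κ, K, hκ, hK, hest⟩ := exists_mode_estimates hm hC hc
  refine ⟨κ, K, hκ, hK, fun s θ hs h0 hθ => ?_⟩
  have hn : 0 < ‖θ‖ := norm_pos_iff.2 h0
  obtain ⟨⟨b1, b2⟩, ⟨b3, b4⟩, b5, b6⟩ := h θ hθ
  obtain ⟨e1, e2, e3, e4, e5⟩ := hest s (‖θ‖ ^ 2) (negSymbol a θ) (negSymbol f θ) (negSymbol g θ)
    hs (by positivity) (pow_le_pow_left₀ hn.le hθ 2) b1 b2 b3 b4 b5 b6
  rw [← pow_mul] at e4 e5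
  refine ⟨_, integratorVar (negSymbol a θ) (s * negSymbol f θ) (negSymbol g θ) c,
    fun ε => ?_, e1, e2, ?_, ?_, ?_⟩
  · rw [modeVar, negSymbol_smul (by linarith)]
  · rwa [le_div_iff₀ (by positivity)]
  · rwa [le_div_iff₀ (by positivity)]
  · rwa [div_le_iff₀ (by positivity)]

lemma average_mono {L : ℕ} [NeZero L] {F G : Site d L → ℝ} (h : ∀ n, n ≠ 0 → F n ≤ G n) :
    1 / (L : ℝ) ^ d * ∑ n : Site d L with n ≠ 0, F n ≤
      1 / (L : ℝ) ^ d * ∑ n : Site d L with n ≠ 0, G n :=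
  mul_le_mul_of_nonneg_left (Finset.sum_le_sum fun n hn => h n (Finset.mem_filter.1 hn).2)
    (by positivity)

lemma average_const_mul {L : ℕ} [NeZero L] (r : ℝ) (F : Site d L → ℝ) :
    1 / (L : ℝ) ^ d * ∑ n : Site d L with n ≠ 0, r * F n =
      r * (1 / (L : ℝ) ^ d * ∑ n : Site d L with n ≠ 0, F n) := by
  rw [← Finset.mul_sum]; ring

lemma average_add {L : ℕ} [NeZero L] (F G : Site d L → ℝ) :
    1 / (L : ℝ) ^ d * ∑ n : Site d L with n ≠ 0, (F n + G n) =
      1 / (L : ℝ) ^ d * ∑ n : Site d L with n ≠ 0, F n +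
      1 / (L : ℝ) ^ d * ∑ n : Site d L with n ≠ 0, G n := by
  rw [Finset.sum_add_distrib, mul_add]

lemma latticeAverage_pi (L : ℕ) [NeZero L] (p : ℕ) :
    latticeAverage d L p Real.pi =
      1 / (L : ℝ) ^ d * ∑ n : Site d L with n ≠ 0, 1 / ‖freq n‖ ^ p := by
  rw [latticeAverage]
  congr 2
  ext n
  simp [norm_freq_le_pi]

lemma average_one_le (L : ℕ) [NeZero L] :
    1 / (L : ℝ) ^ d * ∑ n : Site d L with n ≠ 0, (1 : ℝ) ≤ 1 := by
  have hL : (0 : ℝ) < (L : ℝ) ^ d := pow_pos (Nat.cast_pos.2 (NeZero.pos L)) d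
  have h1 : ∑ n : Site d L with n ≠ 0, (1 : ℝ) ≤ (L : ℝ) ^ d := by
    have : ∑ n : Site d L with n ≠ 0, (1 : ℝ) ≤ ∑ n : Site d L, (1 : ℝ) :=
      Finset.sum_le_sum_of_subset_of_nonneg (Finset.filter_subset _ _) fun _ _ _ => zero_le_one
    simpa using this
  rw [one_div, inv_mul_eq_div]
  exact div_le_one_of_le₀ h1 hL.le

lemma exists_le_stationaryVar {f g a : FeedbackArray d} {m C c : ℝ} (hd : 1 ≤ d) (hm : 0 < m)
    (hC : 0 < C) (hc : 0 < c) (h : HasParameterBounds f g a m C) {p q : ℕ} (hpq : q + p = 4)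
    {w : (Fin d → ℝ) → ℝ} {k K : ℝ} (hw : IsSpectralWeight d q w k K) :
    ∃ κ : ℝ, 0 < κ ∧ ∀ (s ε : ℝ) (L : ℕ) [NeZero L], 1 ≤ s → 2 ≤ L →
      κ / s ≤ stationaryVar L w (s • f) g a c ε ∧
      κ * ε ^ 2 / s * latticeAverage d L p (1 / Real.sqrt s) ≤
        stationaryVar L w (s • f) g a c ε ∧
      κ * ε ^ 2 / s ^ 2 ≤ stationaryVar L w (s • f) g a c ε := by
  obtain ⟨κ, K', hκ, hK', hest⟩ := exists_frequency_estimates hm hC hc h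
  have hk := hw.lower_pos
  have hπ := Real.pi_pos
  have hd1 : (1 : ℝ) ≤ d := by exact_mod_cast hd
  set κ₁ := κ / 2 with hκ₁
  set κ₂ := k * c ^ 2 * κ / 2 with hκ₂
  set κ₃ := c ^ 2 * κ / ((1 + Real.pi ^ 2) * Real.pi ^ 4) / 2 with hκ₃
  have p1 : 0 < κ₁ := by positivity
  have p2 : 0 < κ₂ := by positivity
  have p3 : 0 < κ₃ := by positivity
  refine ⟨min κ₁ (min κ₂ κ₃), by positivity, fun s ε L _ hs hL => ?_⟩
  have hs0 : 0 < s := by linarith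
  have hwnn : ∀ n : Site d L, 0 ≤ w (freq n) := fun n =>
    (by positivity : 0 ≤ k * ‖freq n‖ ^ q).trans (hw.lower _ (norm_freq_le_pi n))
  have hest' := fun (n : Site d L) (hn : n ≠ 0) =>
    hest s (freq n) hs (freq_ne_zero hn) (norm_freq_le_pi n)
  have hnorm := fun (n : Site d L) (hn : n ≠ 0) => norm_pos_iff.2 (freq_ne_zero hn)
  have hmv : ∀ n : Site d L, n ≠ 0 → 0 ≤ modeVar (s • f) g a c ε (freq n) := by
    intro n hn
    obtain ⟨P, I, e, h1, -, -, -, h5⟩ := hest' n hn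
    have := hnorm n hn
    have hP : 0 ≤ P := le_trans (by positivity) h1
    have hI : 0 ≤ I := le_trans (by positivity) h5
    rw [e]; positivity
  -- the factor `d` of components is at least one
  have hV : ∀ {r : ℝ}, r ≤ 1 / (L : ℝ) ^ d * ∑ n : Site d L with n ≠ 0,
      w (freq n) * modeVar (s • f) g a c ε (freq n) → r ≤ stationaryVar L w (s • f) g a c ε := by
    intro r hr
    have hnn : 0 ≤ 1 / (L : ℝ) ^ d * ∑ n : Site d L with n ≠ 0,
        w (freq n) * modeVar (s • f) g a c ε (freq n) :=
      mul_nonneg (by positivity) (Finset.sum_nonneg fun n hn =>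
        mul_nonneg (hwnn n) (hmv n (Finset.mem_filter.1 hn).2))
    rw [stationaryVar]
    nlinarith
  have hconst : ∀ {r : ℝ}, 0 ≤ r → (∀ n : Site d L, n ≠ 0 → r ≤ modeVar (s • f) g a c ε (freq n)) →
      r / 2 ≤ stationaryVar L w (s • f) g a c ε := by
    intro r hr0 hr
    refine hV (le_trans ?_ (average_mono (F := fun n => r * w (freq n)) fun n hn => ?_))
    · rw [average_const_mul]
      have := mul_le_mul_of_nonneg_left (hw.average L hL) hr0
      linarith
    · rw [mul_comm]
      exact mul_le_mul_of_nonneg_left (hr n hn) (hwnn n)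
  refine ⟨?_, ?_, ?_⟩
  · calc _ ≤ κ₁ / s := by gcongr; exact min_le_left _ _
      _ = κ / s / 2 := by rw [hκ₁]; ring
      _ ≤ _ := hconst (by positivity) fun n hn => by
        obtain ⟨P, I, e, h1, -, -, -, h5⟩ := hest' n hn
        have := hnorm n hn
        have hI : 0 ≤ I := le_trans (by positivity) h5
        rw [e]
        linarith [show 0 ≤ (c * ε) ^ 2 * I by positivity]
  · have hlat : 0 ≤ latticeAverage d L p (1 / Real.sqrt s) :=
      mul_nonneg (by positivity) (Finset.sum_nonneg fun _ _ => by positivity)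
    calc _ ≤ κ₂ * ε ^ 2 / s * latticeAverage d L p (1 / Real.sqrt s) := by
          gcongr; exact (min_le_right _ _).trans (min_le_left _ _)
      _ ≤ _ := hV ?_
    rw [latticeAverage, mul_left_comm]
    refine mul_le_mul_of_nonneg_left ?_ (by positivity)
    rw [Finset.mul_sum]
    refine le_trans (Finset.sum_le_sum fun n hn => ?_) (Finset.sum_le_sum_of_subset_of_nonneg
      (Finset.monotone_filter_right _ fun n _ hn => hn.1) fun n hn _ =>
        mul_nonneg (hwnn n) (hmv n (Finset.mem_filter.1 hn).2))
    obtain ⟨-, hn, hnρ⟩ := Finset.mem_filter.1 hn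
    obtain ⟨P, I, e, h1, -, -, -, h5⟩ := hest' n hn
    have hpos := hnorm n hn
    have hP : 0 ≤ P := le_trans (by positivity) h1
    -- at these frequencies the mode is governed by its integral action
    have hsr : s * ‖freq n‖ ^ 2 ≤ 1 := by
      rw [le_div_iff₀ (Real.sqrt_pos.2 hs0)] at hnρ
      have h2 : (‖freq n‖ * Real.sqrt s) ^ 2 ≤ 1 ^ 2 := pow_le_pow_left₀ (by positivity) hnρ 2
      rw [mul_pow, Real.sq_sqrt hs0.le] at h2
      linarith
    have hI : κ / (s * 2) / ‖freq n‖ ^ 4 ≤ I := by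
      refine le_trans ?_ h5
      gcongr
      linarith
    calc κ₂ * ε ^ 2 / s * (1 / ‖freq n‖ ^ p)
        = (k * ‖freq n‖ ^ q) * ((c * ε) ^ 2 * (κ / (s * 2) / ‖freq n‖ ^ 4)) := by
          rw [hκ₂, ← hpq, pow_add]; field_simp
      _ ≤ w (freq n) * modeVar (s • f) g a c ε (freq n) := by
          refine mul_le_mul (hw.lower _ (norm_freq_le_pi n)) ?_ (by positivity) (hwnn n)
          rw [e]
          have := mul_le_mul_of_nonneg_left hI (sq_nonneg (c * ε))
          linarith
  · calc _ ≤ κ₃ * ε ^ 2 / s ^ 2 := by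
          gcongr; exact (min_le_right _ _).trans (min_le_right _ _)
      _ = (c * ε) ^ 2 * (κ / (s * ((1 + Real.pi ^ 2) * s)) / Real.pi ^ 4) / 2 := by
          rw [hκ₃]; field_simp
      _ ≤ _ := hconst (by positivity) fun n hn => by
        obtain ⟨P, I, e, h1, -, -, -, h5⟩ := hest' n hn
        have hpos := hnorm n hn
        have hP : 0 ≤ P := le_trans (by positivity) h1
        have hle := norm_freq_le_pi n
        have hI : κ / (s * ((1 + Real.pi ^ 2) * s)) / Real.pi ^ 4 ≤ I := by
          refine le_trans ?_ h5
          have h6 : 1 + s * ‖freq n‖ ^ 2 ≤ (1 + Real.pi ^ 2) * s := by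
            have : s * ‖freq n‖ ^ 2 ≤ s * Real.pi ^ 2 := by gcongr
            linarith
          gcongr
        rw [e]
        have := mul_le_mul_of_nonneg_left hI (sq_nonneg (c * ε))
        linarith

lemma exists_stationaryVar_le {f g a : FeedbackArray d} {m C c : ℝ} (hd : 1 ≤ d) (hm : 0 < m)
    (hC : 0 < C) (hc : 0 < c) (h : HasParameterBounds f g a m C) {p q : ℕ} (hpq : q + p = 2)
    {w : (Fin d → ℝ) → ℝ} {k K : ℝ} (hw : IsSpectralWeight d q w k K) :
    ∃ B : ℝ, 0 < B ∧ ∀ (s ε : ℝ) (L : ℕ) [NeZero L], 1 ≤ s → 2 ≤ L →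
      stationaryVar L w (s • f) g a c ε ≤
        B * (1 + ε ^ 2 / s * latticeGrowth d (p + 2) L) ∧
      stationaryVar L w (s • f) g a c ε ≤
        B * (1 / s * latticeGrowth d p L + ε ^ 2 / s * latticeGrowth d (p + 2) L) := by
  obtain ⟨κ, K', hκ, hK', hest⟩ := exists_frequency_estimates hm hC hc h
  obtain ⟨C₀, hC₀, hlat₀⟩ := exists_latticeAverage_le d p hd
  obtain ⟨C₁, hC₁, hlat₁⟩ := exists_latticeAverage_le d (p + 2) hd
  have hK := hw.upper_pos
  have hπ := Real.pi_pos
  have hd0 : (0 : ℝ) < d := by exact_mod_cast hd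
  set B₀ := d * K * K' * Real.pi ^ q with hB₀
  set B₁ := d * K * K' * C₀ with hB₁
  set B₂ := d * K * K' * c ^ 2 * C₁ with hB₂
  have p0 : 0 < B₀ := by positivity
  have p1 : 0 < B₁ := by positivity
  have p2 : 0 < B₂ := by positivity
  refine ⟨B₀ + B₁ + B₂, by positivity, fun s ε L _ hs hL => ?_⟩
  have hs0 : 0 < s := by linarith
  have hG₀ := latticeGrowth_nonneg (d := d) (show 1 ≤ L by omega) p
  have hG₁ := latticeGrowth_nonneg (d := d) (show 1 ≤ L by omega) (p + 2)
  have hest' := fun (n : Site d L) (hn : n ≠ 0) =>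
    hest s (freq n) hs (freq_ne_zero hn) (norm_freq_le_pi n)
  have hnorm := fun (n : Site d L) (hn : n ≠ 0) => norm_pos_iff.2 (freq_ne_zero hn)
  have hnoise : d * (1 / (L : ℝ) ^ d * ∑ n : Site d L with n ≠ 0,
      K * (c * ε) ^ 2 * (K' / s) * (1 / ‖freq n‖ ^ (p + 2))) ≤
      B₂ * (ε ^ 2 / s * latticeGrowth d (p + 2) L) := by
    rw [average_const_mul, ← latticeAverage_pi]
    calc _ ≤ d * (K * (c * ε) ^ 2 * (K' / s) * (C₁ * latticeGrowth d (p + 2) L)) := by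
          gcongr; exact hlat₁ L hL _
      _ = _ := by rw [hB₂]; ring
  -- weighted contributions of process and measurement noise in a single mode
  have hI : ∀ n : Site d L, n ≠ 0 → ∀ I, I ≤ K' / s / ‖freq n‖ ^ 4 →
      K * ‖freq n‖ ^ q * ((c * ε) ^ 2 * I) ≤
        K * (c * ε) ^ 2 * (K' / s) * (1 / ‖freq n‖ ^ (p + 2)) := by
    intro n hn I hI
    have := hnorm n hn
    calc _ ≤ K * ‖freq n‖ ^ q * ((c * ε) ^ 2 * (K' / s / ‖freq n‖ ^ 4)) := by gcongr
      _ = _ := by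
        rw [show 4 = q + (p + 2) by omega, pow_add]; field_simp
  have hmain : ∀ F : Site d L → ℝ, (∀ n, n ≠ 0 → ∀ P, P ≤ K' → P ≤ K' / s / ‖freq n‖ ^ 2 →
      K * ‖freq n‖ ^ q * P ≤ F n) →
      stationaryVar L w (s • f) g a c ε ≤ d * (1 / (L : ℝ) ^ d * ∑ n : Site d L with n ≠ 0, F n) +
        B₂ * (ε ^ 2 / s * latticeGrowth d (p + 2) L) := by
    intro F hF
    refine le_trans ?_ (add_le_add_right hnoise _)
    rw [stationaryVar, ← mul_add, ← average_add]
    refine mul_le_mul_of_nonneg_left (average_mono fun n hn => ?_) hd0.le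
    obtain ⟨P, I, e, h1, h2, h3, h4, h5⟩ := hest' n hn
    have hpos := hnorm n hn
    have hP0 : 0 ≤ P := le_trans (by positivity) h1
    have hI0 : 0 ≤ I := le_trans (by positivity) h5
    calc _ ≤ K * ‖freq n‖ ^ q * (P + (c * ε) ^ 2 * I) := by
          rw [e]
          exact mul_le_mul_of_nonneg_right (hw.upper _ (norm_freq_le_pi n)) (by positivity)
      _ ≤ _ := by
          rw [mul_add]
          exact add_le_add (hF n hn P h2 h3) (hI n hn I h4)
  have hx : 0 ≤ ε ^ 2 / s * latticeGrowth d (p + 2) L := by positivity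
  have hy : 0 ≤ 1 / s * latticeGrowth d p L := by positivity
  constructor
  · have h1 := hmain (fun _ => K * Real.pi ^ q * K' * 1) fun n hn P hP _ => by
      have := norm_freq_le_pi n
      have := (hnorm n hn).le
      calc _ ≤ K * ‖freq n‖ ^ q * K' := by gcongr
        _ ≤ K * Real.pi ^ q * K' := by gcongr
        _ = _ := by ring
    rw [average_const_mul] at h1
    have h2 : d * (K * Real.pi ^ q * K' * (1 / (L : ℝ) ^ d * ∑ n : Site d L with n ≠ 0, (1 : ℝ))) ≤
        d * (K * Real.pi ^ q * K' * 1) := by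
      gcongr; exact average_one_le L
    have h3 : d * (K * Real.pi ^ q * K' * 1) = B₀ := by rw [hB₀]; ring
    nlinarith
  · have h1 := hmain (fun n => K * (K' / s) * (1 / ‖freq n‖ ^ p)) fun n hn P _ hP => by
      have := hnorm n hn
      calc _ ≤ K * ‖freq n‖ ^ q * (K' / s / ‖freq n‖ ^ 2) := by gcongr
        _ = _ := by rw [← hpq, pow_add]; field_simp
    rw [average_const_mul, ← latticeAverage_pi] at h1
    have h2 : d * (K * (K' / s) * latticeAverage d L p Real.pi) ≤
        d * (K * (K' / s) * (C₀ * latticeGrowth d p L)) := by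
      gcongr; exact hlat₀ L hL _
    have h3 : d * (K * (K' / s) * (C₀ * latticeGrowth d p L)) =
        B₁ * (1 / s * latticeGrowth d p L) := by rw [hB₁]; ring
    nlinarith

/-- Two-sided bounds uniform in the noise intensity, for fixed gains. -/
theorem exists_stationaryVar_bounds {f g a : FeedbackArray d} {m C c : ℝ} (hd : 1 ≤ d)
    (hm : 0 < m) (hC : 0 < C) (hc : 0 < c) (h : HasParameterBounds f g a m C) {p q : ℕ}
    (hpq : q + p = 2) {w : (Fin d → ℝ) → ℝ} {k K : ℝ} (hw : IsSpectralWeight d q w k K) :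
    ∃ (cl cu : ℝ) (L₀ : ℕ), 0 < cl ∧ 0 < cu ∧ ∀ (ε : ℝ) (L : ℕ) [NeZero L], L₀ ≤ L →
      cl * (1 + ε ^ 2 * latticeGrowth d (p + 2) L) ≤ stationaryVar L w f g a c ε ∧
      stationaryVar L w f g a c ε ≤ cu * (1 + ε ^ 2 * latticeGrowth d (p + 2) L) := by
  obtain ⟨κ, hκ, hlow⟩ := exists_le_stationaryVar hd hm hC hc h (show q + (p + 2) = 4 by omega) hw
  obtain ⟨B, hB, hup⟩ := exists_stationaryVar_le hd hm hC hc h hpq hw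
  obtain ⟨κ', L₁, hκ', hnoise⟩ : ∃ (κ' : ℝ) (L₁ : ℕ), 0 < κ' ∧ ∀ (ε : ℝ) (L : ℕ) [NeZero L],
      L₁ ≤ L → κ' * (ε ^ 2 * latticeGrowth d (p + 2) L) ≤ stationaryVar L w f g a c ε := by
    rcases le_or_gt d (p + 2) with hdp | hdp
    · obtain ⟨c₀, hc₀, hlat⟩ := exists_le_latticeAverage d (p + 2) hd hdp
      obtain ⟨L₁, hL₁⟩ := hlat 1 one_pos
      refine ⟨κ * c₀, max 2 L₁, by positivity, fun ε L _ hL => ?_⟩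
      have h1 := (hlow 1 ε L le_rfl ((le_max_left _ _).trans hL)).2.1
      rw [one_smul, Real.sqrt_one, div_one, div_one] at h1
      have h2 := hL₁ L ((le_max_right _ _).trans hL)
      calc _ = κ * ε ^ 2 * (c₀ * latticeGrowth d (p + 2) L) := by ring
        _ ≤ κ * ε ^ 2 * latticeAverage d L (p + 2) 1 := by gcongr
        _ ≤ _ := h1
    · refine ⟨κ, 2, hκ, fun ε L _ hL => ?_⟩
      have h1 := (hlow 1 ε L le_rfl hL).2.2
      rw [one_smul, one_pow, div_one] at h1
      rw [latticeGrowth, if_neg (by omega), if_neg (by omega), mul_one]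
      exact h1
  refine ⟨min κ κ' / 2, B, max 2 L₁, by positivity, hB, fun ε L _ hL => ?_⟩
  have hL2 : 2 ≤ L := (le_max_left _ _).trans hL
  have hG := latticeGrowth_nonneg (d := d) (show 1 ≤ L by omega) (p + 2)
  constructor
  · have h1 := (hlow 1 ε L le_rfl hL2).1
    have h2 := hnoise ε L ((le_max_right _ _).trans hL)
    rw [one_smul, div_one] at h1
    have h3 : min κ κ' ≤ κ := min_le_left _ _
    have h4 : min κ κ' * (ε ^ 2 * latticeGrowth d (p + 2) L) ≤
        κ' * (ε ^ 2 * latticeGrowth d (p + 2) L) :=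
      mul_le_mul_of_nonneg_right (min_le_right _ _) (by positivity)
    linarith
  · have h1 := (hup 1 ε L le_rfl hL2).1
    rwa [one_smul, div_one] at h1

/-- Two-sided bounds uniform in the position gain factor `s`, for large tori. -/
theorem exists_stationaryVar_bounds_smul {f g a : FeedbackArray d} {m C c : ℝ} (hd : 1 ≤ d)
    (hm : 0 < m) (hC : 0 < C) (hc : 0 < c) (h : HasParameterBounds f g a m C) {p q : ℕ}
    (hpq : q + p = 2) {w : (Fin d → ℝ) → ℝ} {k K : ℝ} (hw : IsSpectralWeight d q w k K)
    {εmax : ℝ} (hεmax : 0 < εmax) :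
    ∃ cl cu : ℝ, 0 < cl ∧ 0 < cu ∧ ∀ s ε : ℝ, 1 ≤ s → 0 < ε → ε ≤ εmax →
      ∃ L₀ : ℕ, ∀ (L : ℕ) [NeZero L], L₀ ≤ L →
      cl * (1 / s * (1 + ε ^ 2 * latticeGrowth d (p + 2) L)) ≤
        stationaryVar L w (s • f) g a c ε ∧
      stationaryVar L w (s • f) g a c ε ≤
        cu * (1 / s * (1 + ε ^ 2 * latticeGrowth d (p + 2) L)) := by
  obtain ⟨κ, hκ, hlow⟩ := exists_le_stationaryVar hd hm hC hc h (show q + (p + 2) = 4 by omega) hw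
  obtain ⟨B, hB, hup⟩ := exists_stationaryVar_le hd hm hC hc h hpq hw
  obtain ⟨κ', hκ', hnoise⟩ : ∃ κ' : ℝ, 0 < κ' ∧ ∀ s ε : ℝ, 1 ≤ s → 0 < ε → ε ≤ εmax →
      ∃ L₁ : ℕ, ∀ (L : ℕ) [NeZero L], L₁ ≤ L →
      κ' * (1 / s * (ε ^ 2 * latticeGrowth d (p + 2) L)) ≤
        stationaryVar L w (s • f) g a c ε := by
    rcases le_or_gt d (p + 2) with hdp | hdp
    · obtain ⟨c₀, hc₀, hlat⟩ := exists_le_latticeAverage d (p + 2) hd hdp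
      refine ⟨κ * c₀, by positivity, fun s ε hs hε hε' => ?_⟩
      have hs0 : 0 < s := by linarith
      obtain ⟨L₁, hL₁⟩ := hlat (1 / Real.sqrt s) (by positivity)
      refine ⟨max 2 L₁, fun L _ hL => ?_⟩
      have h1 := (hlow s ε L hs ((le_max_left _ _).trans hL)).2.1
      have h2 := hL₁ L ((le_max_right _ _).trans hL)
      calc _ = κ * ε ^ 2 / s * (c₀ * latticeGrowth d (p + 2) L) := by ring
        _ ≤ κ * ε ^ 2 / s * latticeAverage d L (p + 2) (1 / Real.sqrt s) := by gcongr
        _ ≤ _ := h1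
    -- without divergence the noise term is dominated by the process noise, as `ε ≤ εmax`
    · refine ⟨κ / εmax ^ 2, by positivity, fun s ε hs hε hε' => ⟨2, fun L _ hL => ?_⟩⟩
      have hs0 : 0 < s := by linarith
      have h1 := (hlow s ε L hs hL).1
      rw [latticeGrowth, if_neg (by omega), if_neg (by omega), mul_one]
      calc _ ≤ κ / εmax ^ 2 * (1 / s * εmax ^ 2) := by gcongr
        _ = κ / s := by field_simp
        _ ≤ _ := h1
  refine ⟨min κ κ' / 2, 2 * B, by positivity, by positivity, fun s ε hs hε hε' => ?_⟩
  have hs0 : 0 < s := by linarith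
  obtain ⟨L₁, hL₁⟩ := hnoise s ε hs hε hε'
  refine ⟨max (max 2 L₁) ⌈s / ε ^ 2⌉₊, fun L _ hL => ?_⟩
  have hL2 : 2 ≤ L := ((le_max_left _ _).trans (le_max_left _ _)).trans hL
  have hL1 : L₁ ≤ L := ((le_max_right _ _).trans (le_max_left _ _)).trans hL
  have hLs : s / ε ^ 2 ≤ L := (Nat.le_ceil _).trans (by exact_mod_cast (le_max_right _ _).trans hL)
  have hG := latticeGrowth_nonneg (d := d) (show 1 ≤ L by omega) (p + 2)
  constructor
  · have h1 := (hlow s ε L hs hL2).1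
    have h2 := hL₁ L hL1
    have h3 : min κ κ' * (1 / s) ≤ κ / s := by
      rw [mul_one_div]; gcongr; exact min_le_left _ _
    have h4 : min κ κ' * (1 / s * (ε ^ 2 * latticeGrowth d (p + 2) L)) ≤
        κ' * (1 / s * (ε ^ 2 * latticeGrowth d (p + 2) L)) :=
      mul_le_mul_of_nonneg_right (min_le_right _ _) (by positivity)
    linarith
  · have hx : 0 ≤ 1 / s * (ε ^ 2 * latticeGrowth d (p + 2) L) := by positivity
    have hs1 : 0 < 1 / s := by positivity
    have e1 : ε ^ 2 / s * latticeGrowth d (p + 2) L =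
      1 / s * (ε ^ 2 * latticeGrowth d (p + 2) L) := by ring
    rcases lt_or_ge p d with hdp | hdp
    · have h1 := (hup s ε L hs hL2).2
      rw [show latticeGrowth d p L = 1 by
        rw [latticeGrowth, if_neg (by omega), if_neg (by omega)], e1] at h1
      have : 0 ≤ B * (1 / s * 1 + 1 / s * (ε ^ 2 * latticeGrowth d (p + 2) L)) := by positivity
      linarith
    -- here the variance diverges with the size of the torus, and the divergent part dominates
    · have h1 := (hup s ε L hs hL2).1
      have hL1' : (1 : ℝ) ≤ L := by exact_mod_cast (by omega : 1 ≤ L)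
      have hGL : (L : ℝ) ≤ latticeGrowth d (p + 2) L := by
        rw [latticeGrowth, if_pos (by omega)]
        calc (L : ℝ) = (L : ℝ) ^ 1 := (pow_one _).symm
          _ ≤ _ := pow_le_pow_right₀ hL1' (by omega)
      have h2 : 1 ≤ 1 / s * (ε ^ 2 * latticeGrowth d (p + 2) L) := by
        have h3 := hLs.trans hGL
        rw [div_le_iff₀ (by positivity)] at h3
        rw [one_div, inv_mul_eq_div, le_div_iff₀ hs0]
        linarith
      rw [e1] at h1
      nlinarith

end Variance

/-! ### The algorithm parameter -/

section AlgParam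

variable {d : ℕ}

lemma bddAbove_abs (f : FeedbackArray d) : BddAbove (Set.range fun k => |f k|) := by
  have h : (Set.range fun k => |f k|) ⊆ (fun x => |x|) '' Set.range f := by
    rintro _ ⟨k, rfl⟩
    exact ⟨f k, ⟨k, rfl⟩, rfl⟩
  exact ((f.finite_range.image _).subset h).bddAbove

lemma supNorm_nonneg (f : FeedbackArray d) : 0 ≤ supNorm f := Real.iSup_nonneg fun _ => abs_nonneg _

lemma supNorm_smul {s : ℝ} (hs : 0 ≤ s) (f : FeedbackArray d) :
    supNorm (s • f) = s * supNorm f := by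
  rw [supNorm, supNorm, Real.mul_iSup_of_nonneg hs]
  simp [abs_mul, abs_of_nonneg hs]

lemma supNorm_pos_of_isNondegenerate (hd : 1 ≤ d) {f : FeedbackArray d} (hf : IsNondegenerate f) :
    0 < supNorm f := by
  have hne : f ≠ 0 := by
    rintro rfl
    exact hf (fun _ => 1) (fun h => one_ne_zero (congrFun h ⟨0, hd⟩)) (by simp)
  obtain ⟨k, hk⟩ := Finsupp.ne_iff.1 hne
  exact (abs_pos.2 hk).trans_le (le_ciSup (bddAbove_abs f) k)

/-- The algorithm parameter grows linearly with the position gains. -/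
lemma algParam_smul_bounds {f g : FeedbackArray d} {s : ℝ} (hs : 1 ≤ s) :
    s * supNorm f ≤ algParam (s • f) g ∧ algParam (s • f) g ≤ s * algParam f g := by
  have hs0 : 0 ≤ s := by linarith
  rw [algParam, supNorm_smul hs0]
  refine ⟨le_max_left _ _, max_le (mul_le_mul_of_nonneg_left (le_max_left _ _) hs0) ?_⟩
  calc supNorm g ≤ 1 * algParam f g := by rw [one_mul]; exact le_max_right _ _
    _ ≤ s * algParam f g :=
      mul_le_mul_of_nonneg_right hs ((supNorm_nonneg g).trans (le_max_right _ _))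

end AlgParam

/-- Passage from bounds in terms of `s` and the lattice growth to bounds in terms of the algorithm
parameter and the number of sites. -/
lemma varianceBounds_of_growth {d L : ℕ} [NeZero L]
    {errSq : Site d L → EuclideanSpace ℝ (State d L) → ℝ} {growth : ℝ → ℝ}
    {f g a : FeedbackArray d} {c ε s V G b B cl cl' cu cu' : ℝ} (hs : 0 < s) (hb : 0 < b)
    (hB : 0 < B) (hcl' : 0 ≤ cl') (hcu : 0 ≤ cu)
    (hV : IsPerSiteVariance errSq f g a c ε V)
    (hβ : s * b ≤ algParam f g) (hβ' : algParam f g ≤ s * B)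
    (hG0 : 0 ≤ G) (hG : G ≤ growth ((L : ℝ) ^ d)) (hG' : growth ((L : ℝ) ^ d) ≤ 4 * G)
    (hl : cl * (1 / s * (1 + ε ^ 2 * G)) ≤ V) (hu : V ≤ cu * (1 / s * (1 + ε ^ 2 * G)))
    (hcl : cl' * 4 ≤ cl * b) (hcu' : cu * B ≤ cu') :
    VarianceBounds errSq growth cl' cu' f g a c ε := by
  have hβ0 : 0 < algParam f g := (mul_pos hs hb).trans_le hβ
  have hx : 0 ≤ ε ^ 2 * G := by positivity
  have e : 1 / algParam f g + ε ^ 2 / algParam f g * growth ((L : ℝ) ^ d) =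
      1 / algParam f g * (1 + ε ^ 2 * growth ((L : ℝ) ^ d)) := by ring
  refine ⟨V, hV, ?_, ?_⟩
  · refine le_trans ?_ hl
    rw [e]
    calc _ ≤ cl' * (1 / (s * b) * (4 * (1 + ε ^ 2 * G))) := by
          have h1 : 1 + ε ^ 2 * growth ((L : ℝ) ^ d) ≤ 4 * (1 + ε ^ 2 * G) := by
            nlinarith [mul_le_mul_of_nonneg_left hG' (sq_nonneg ε)]
          have h2 : 0 ≤ 1 + ε ^ 2 * growth ((L : ℝ) ^ d) := by
            have := hG0.trans hG
            positivity
          gcongr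
      _ = cl' * 4 * (1 / (s * b) * (1 + ε ^ 2 * G)) := by ring
      _ ≤ cl * b * (1 / (s * b) * (1 + ε ^ 2 * G)) := by gcongr
      _ = _ := by field_simp
  · refine hu.trans ?_
    rw [e]
    calc cu * (1 / s * (1 + ε ^ 2 * G)) = cu * B * (1 / (s * B) * (1 + ε ^ 2 * G)) := by field_simp
      _ ≤ cu' * (1 / algParam f g * (1 + ε ^ 2 * growth ((L : ℝ) ^ d))) := by
          have h1 : 0 ≤ cu' := (by positivity : 0 ≤ cu * B).trans hcu'
          gcongr

end NoisyIntegralControl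

end

open NoisyIntegralControl in
theorem mainTheorem1 {d : ℕ} (hd : 1 ≤ d)
    (f g a : NoisyIntegralControl.FeedbackArray d) (c : ℝ) (hc : 0 < c)
    (hf_rel : NoisyIntegralControl.IsRelative f)
    (ha_rel : NoisyIntegralControl.IsRelative a)
    (hf_symm : NoisyIntegralControl.IsSymmetric f)
    (hg_symm : NoisyIntegralControl.IsSymmetric g)
    (ha_symm : NoisyIntegralControl.IsSymmetric a)
    (hg_abs : 0 < NoisyIntegralControl.absoluteGain g)
    (hf_nondeg : NoisyIntegralControl.IsNondegenerate f)
    (ha_nondeg : NoisyIntegralControl.IsNondegenerate a)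
    (h_static : NoisyIntegralControl.StaticStable f g)
    (h_integral : NoisyIntegralControl.IntegralStable f g a c) :
    -- for the given control law, uniformly in the noise intensity
    (∃ (cl cu : ℝ) (N₀ : ℕ), 0 < cl ∧ 0 < cu ∧
      ∀ (ε : ℝ), 0 ≤ ε → ∀ (L : ℕ) [NeZero L], N₀ ≤ L ^ d →
        NoisyIntegralControl.LocalAndGlobalBounds L cl cu f g a c ε) ∧
    -- with constants that do not change when `β` grows through the position gains `s • f`
    (∀ εmax : ℝ, 0 < εmax → ∃ cl cu : ℝ, 0 < cl ∧ 0 < cu ∧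
      ∀ s : ℝ, 1 ≤ s → ∀ ε : ℝ, 0 < ε → ε ≤ εmax →
        ∃ N₀ : ℕ, ∀ (L : ℕ) [NeZero L], N₀ ≤ L ^ d →
          NoisyIntegralControl.LocalAndGlobalBounds L cl cu (s • f) g a c ε) := by
  obtain ⟨m, C, hm, hC, h⟩ := exists_parameter_bounds hc hf_rel ha_rel hf_symm hg_symm ha_symm
    hg_abs hf_nondeg ha_nondeg h_static h_integral
  have hpar : HasParameterBounds f g a m C := h
  have hstab : ∀ s : ℝ, 0 < s → HasStableModes (s • f) g a := fun s hs =>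
    hpar.hasStableModes hm hf_symm hg_symm ha_symm hf_rel ha_rel hs
  set b := supNorm f with hb
  set B := algParam f g with hB
  have hb0 : 0 < b := supNorm_pos_of_isNondegenerate hd hf_nondeg
  have hB0 : 0 < B := hb0.trans_le (le_max_left _ _)
  have hside : ∀ {L₀ L : ℕ}, L₀ ^ d ≤ L ^ d → L₀ ≤ L := fun {L₀ L} hL =>
    (Nat.pow_le_pow_iff_left (by omega)).1 hL
  have hwl := isSpectralWeight_localWeight hd
  have hwg := isSpectralWeight_one hd
  constructor
  · obtain ⟨l₁, u₁, L₁, hl₁, hu₁, h₁⟩ := exists_stationaryVar_bounds hd hm hC hc hpar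
      (show 2 + 0 = 2 from rfl) hwl
    obtain ⟨l₂, u₂, L₂, hl₂, hu₂, h₂⟩ := exists_stationaryVar_bounds hd hm hC hc hpar
      (show 0 + 2 = 2 from rfl) hwg
    refine ⟨min l₁ l₂ * b / 4, max u₁ u₂ * B, (max L₁ L₂) ^ d, by positivity,
      mul_pos (lt_max_of_lt_left hu₁) hB0, fun ε _ L _ hL => ?_⟩
    have hL := hside hL
    have hL1 : 1 ≤ L := NeZero.one_le
    have hst := hstab 1 one_pos
    rw [one_smul] at hst
    have k₁ := h₁ ε L ((le_max_left _ _).trans hL)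
    have k₂ := h₂ ε L ((le_max_right _ _).trans hL)
    constructor
    · exact varianceBounds_of_growth (cl := l₁) one_pos hb0 hB0 (by positivity) hu₁.le
        (isPerSiteVariance_local hst hc ε) (by rw [one_mul]; exact le_max_left _ _)
        (by rw [one_mul]) (latticeGrowth_nonneg hL1 2) (localGrowth_bounds d L hd hL1).1
        (localGrowth_bounds d L hd hL1).2
        (by rw [div_one, one_mul]; exact k₁.1) (by rw [div_one, one_mul]; exact k₁.2)
        (by rw [div_mul_cancel₀ _ (by norm_num)]; gcongr; exact min_le_left _ _)
        (by gcongr; exact le_max_left _ _)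
    · exact varianceBounds_of_growth (cl := l₂) one_pos hb0 hB0 (by positivity) hu₂.le
        (isPerSiteVariance_global hst hc ε) (by rw [one_mul]; exact le_max_left _ _)
        (by rw [one_mul]) (latticeGrowth_nonneg hL1 4) (globalGrowth_bounds d L hd hL1).1
        (globalGrowth_bounds d L hd hL1).2
        (by rw [div_one, one_mul]; exact k₂.1) (by rw [div_one, one_mul]; exact k₂.2)
        (by rw [div_mul_cancel₀ _ (by norm_num)]; gcongr; exact min_le_right _ _)
        (by gcongr; exact le_max_right _ _)
  · intro εmax hεmax
    obtain ⟨l₁, u₁, hl₁, hu₁, h₁⟩ := exists_stationaryVar_bounds_smul hd hm hC hc hpar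
      (show 2 + 0 = 2 from rfl) hwl hεmax
    obtain ⟨l₂, u₂, hl₂, hu₂, h₂⟩ := exists_stationaryVar_bounds_smul hd hm hC hc hpar
      (show 0 + 2 = 2 from rfl) hwg hεmax
    refine ⟨min l₁ l₂ * b / 4, max u₁ u₂ * B, by positivity,
      mul_pos (lt_max_of_lt_left hu₁) hB0, fun s hs ε hε hε' => ?_⟩
    have hs0 : 0 < s := by linarith
    obtain ⟨L₁, h₁⟩ := h₁ s ε hs hε hε'
    obtain ⟨L₂, h₂⟩ := h₂ s ε hs hε hε'
    refine ⟨(max L₁ L₂) ^ d, fun L _ hL => ?_⟩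
    have hL := hside hL
    have hL1 : 1 ≤ L := NeZero.one_le
    have hst := hstab s hs0
    have hβ := algParam_smul_bounds (f := f) (g := g) hs
    have k₁ := h₁ L ((le_max_left _ _).trans hL)
    have k₂ := h₂ L ((le_max_right _ _).trans hL)
    constructor
    · exact varianceBounds_of_growth hs0 hb0 hB0 (by positivity) hu₁.le
        (isPerSiteVariance_local hst hc ε) hβ.1 hβ.2
        (latticeGrowth_nonneg hL1 2) (localGrowth_bounds d L hd hL1).1
        (localGrowth_bounds d L hd hL1).2 k₁.1 k₁.2
        (by rw [div_mul_cancel₀ _ (by norm_num)]; gcongr; exact min_le_left _ _)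
        (by gcongr; exact le_max_left _ _)
    · exact varianceBounds_of_growth hs0 hb0 hB0 (by positivity) hu₂.le
        (isPerSiteVariance_global hst hc ε) hβ.1 hβ.2
        (latticeGrowth_nonneg hL1 4) (globalGrowth_bounds d L hd hL1).1
        (globalGrowth_bounds d L hd hL1).2 k₂.1 k₂.2
        (by rw [div_mul_cancel₀ _ (by norm_num)]; gcongr; exact min_le_right _ _)
        (by gcongr; exact le_max_right _ _)
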